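/- Let $(N,\omega)$ be a connected symplectic 4-manifold, that is, a connected (Hausdorff, second countable) smooth 4-manifold without boundary, not necessarily compact, with a smooth closed nondegenerate 2-form $\omega$. A singular 2-simplex $\sigma:\Delta^2\to N$ is called a $C^1$ lagrangian map if it is $C^1$ on the closed simplex and $\sigma^*\omega=0$. For $\alpha\in H_2(N,\mathbb{Z})$ (singular homology) let $[\omega](\alpha)=\int_c\omega$, where $c$ is any integral cycle of $C^1$ singular 2-simplices that represents $\alpha$. A class $\alpha\in H_2(N,\mathbb{Z})$ can be represented by an integral singular cycle $\sum_i n_i\sigma_i$ each of whose 2-simplices $\sigma_i$ is a $C^1$ lagrangian map if and only if $[\omega](\alpha)=0$. -/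

import Mathlib

open scoped Manifold

universe u

noncomputable section

/-! ### Differential two-forms and symplectic forms on a 4-manifold -/

section Forms

variable {N : Type u} [TopologicalSpace N] [ChartedSpace (EuclideanSpace ℝ (Fin 4)) N]

variable (N) in
/-- A (not necessarily continuous) field of alternating 2-forms on the tangent spaces of `N`. -/
abbrev TwoForm : Type u := (x : N) → TangentSpace (𝓡 4) x [⋀^Fin 2]→L[ℝ] ℝ

/-- The expression of a 2-form in the chart around `x`: its pullback by the inverse of that
chart, a 2-form on the (open) target of the chart. -/
def TwoForm.inChart (ω : TwoForm N) (x : N) (y : EuclideanSpace ℝ (Fin 4)) :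
    EuclideanSpace ℝ (Fin 4) [⋀^Fin 2]→L[ℝ] ℝ :=
  (ω ((extChartAt (𝓡 4) x).symm y)).compContinuousLinearMap
    (mfderiv 𝓘(ℝ, EuclideanSpace ℝ (Fin 4)) (𝓡 4) (extChartAt (𝓡 4) x).symm y)

variable (N) in
/-- A symplectic form on the 4-manifold `N`: a smooth, closed, nondegenerate 2-form. -/
structure SymplecticForm where
  /-- The underlying field of alternating forms. -/
  form : TwoForm N
  smooth : ∀ x : N, ContDiffOn ℝ ((⊤ : ℕ∞) : WithTop ℕ∞) (TwoForm.inChart form x) (extChartAt (𝓡 4) x).target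
  closed : ∀ x : N, ∀ y ∈ (extChartAt (𝓡 4) x).target, extDeriv (TwoForm.inChart form x) y = 0
  nondegenerate : ∀ (x : N) (v : TangentSpace (𝓡 4) x),
    (∀ w : TangentSpace (𝓡 4) x, form x ![v, w] = 0) → v = 0

end Forms

/-! ### Singular 2-simplices -/

/-- The standard triangle with vertices `(0,0)`, `(1,0)`, `(0,1)` in the plane. -/
def triangle : Set (ℝ × ℝ) := {p | 0 ≤ p.1 ∧ 0 ≤ p.2 ∧ p.1 + p.2 ≤ 1}

/-- The affine identification of the triangle with the standard 2-simplex in barycentric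
coordinates; it sends `(0,0)`, `(1,0)`, `(0,1)` to the vertices `0`, `1`, `2` in this order. -/
def trianglePoint (p : ℝ × ℝ) (hp : p ∈ triangle) : stdSimplex ℝ (Fin 3) :=
  ⟨![1 - p.1 - p.2, p.1, p.2], by
    obtain ⟨h1, h2, h3⟩ := hp
    refine ⟨fun i => ?_, ?_⟩
    · fin_cases i
      · change 0 ≤ 1 - p.1 - p.2
        linarith
      · exact h1
      · exact h2
    · simp only [Fin.sum_univ_three, Matrix.cons_val]
      ring⟩

/-- Singular 2-simplices of a space. -/
abbrev SingularTwoSimplex (N : Type u) [TopologicalSpace N] : Type u :=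
  C(stdSimplex ℝ (Fin 3), N)

namespace SingularTwoSimplex

variable {N : Type u} [TopologicalSpace N]

open Classical in
/-- A singular 2-simplex read as a map on the triangle in the plane. Its values off the triangle
are irrelevant: everything below only looks at it within the triangle. -/
def planar (σ : SingularTwoSimplex N) (p : ℝ × ℝ) : N :=
  if hp : p ∈ triangle then σ (trianglePoint p hp) else σ (stdSimplex.vertex 0)

variable [ChartedSpace (EuclideanSpace ℝ (Fin 4)) N]

/-- `σ` is a `C^1` map, up to and including the boundary of the closed simplex. -/
def IsC1 (σ : SingularTwoSimplex N) : Prop :=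
  ContMDiffOn 𝓘(ℝ, ℝ × ℝ) (𝓡 4) 1 σ.planar triangle

/-- The pullback `σ^*ω` at a point of the triangle. -/
def pullback (ω : TwoForm N) (σ : SingularTwoSimplex N) (p : ℝ × ℝ) :
    (ℝ × ℝ) [⋀^Fin 2]→L[ℝ] ℝ :=
  (ω (σ.planar p)).compContinuousLinearMap
    (mfderivWithin 𝓘(ℝ, ℝ × ℝ) (𝓡 4) σ.planar triangle p)

/-- `σ` is a `C^1` lagrangian map: it is `C^1` and `σ^*ω = 0`. -/
def IsLagrangian (ω : TwoForm N) (σ : SingularTwoSimplex N) : Prop :=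
  σ.IsC1 ∧ ∀ p ∈ triangle, σ.pullback ω p = 0

/-- The integral `∫_σ ω` of a 2-form over a `C^1` singular 2-simplex. -/
def integral (ω : TwoForm N) (σ : SingularTwoSimplex N) : ℝ :=
  ∫ p in triangle, σ.pullback ω p ![(1, 0), (0, 1)]

end SingularTwoSimplex

/-! ### Integral singular 2-chains and second homology -/

section Homology

variable (N : Type u) [TopologicalSpace N]

/-- The group of integers as a coefficient module. -/
abbrev intCoeff : ModuleCat.{u} ℤ := ModuleCat.of ℤ (ULift.{u} ℤ)

/-- The integral singular chain complex of `N`. -/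
abbrev singularComplex : ChainComplex (ModuleCat.{u} ℤ) ℕ :=
  ((AlgebraicTopology.singularChainComplexFunctor (ModuleCat.{u} ℤ)).obj intCoeff).obj (TopCat.of N)

/-- The second singular homology group `H_2(N, ℤ)`. -/
abbrev H2 : ModuleCat.{u} ℤ :=
  ((AlgebraicTopology.singularHomologyFunctor (ModuleCat.{u} ℤ) 2).obj intCoeff).obj (TopCat.of N)

/-- Integral singular 2-chains, as finite formal integral combinations of singular
2-simplices. -/
abbrev TwoChain : Type u := SingularTwoSimplex N →₀ ℤ

variable {N}

/-- The element of the singular chain complex given by a formal combination of 2-simplices. -/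
def TwoChain.toComplex (c : TwoChain N) : (singularComplex N).X 2 :=
  c.sum fun σ n =>
    (SSet.ιChainComplex (X := TopCat.toSSet.obj (TopCat.of N)) (R := intCoeff) (n := 2)
      (((TopCat.of N).toSSetObjEquiv (.op (SimplexCategory.mk 2))).symm σ)).hom (ULift.up n)

/-- The chain `c` is a cycle and represents the class `α`. -/
def TwoChain.Represents (c : TwoChain N) (α : H2 N) : Prop :=
  ∃ z : (singularComplex N).cycles 2,
    ((singularComplex N).iCycles 2).hom z = c.toComplex ∧
      ((singularComplex N).homologyπ 2).hom z = α

variable [ChartedSpace (EuclideanSpace ℝ (Fin 4)) N]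

/-- All 2-simplices of the chain are `C^1`. -/
def TwoChain.IsC1 (c : TwoChain N) : Prop := ∀ σ ∈ c.support, SingularTwoSimplex.IsC1 σ

/-- All 2-simplices of the chain are `C^1` lagrangian maps. -/
def TwoChain.IsLagrangian (ω : SymplecticForm N) (c : TwoChain N) : Prop :=
  ∀ σ ∈ c.support, SingularTwoSimplex.IsLagrangian ω.form σ

/-- The integral `∫_c ω` of a 2-form over a `C^1` chain. -/
def TwoChain.integral (ω : SymplecticForm N) (c : TwoChain N) : ℝ :=
  c.sum fun σ n => (n : ℝ) * SingularTwoSimplex.integral ω.form σ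

/-- A homology class is lagrangian if an integral cycle all of whose 2-simplices are `C^1`
lagrangian maps represents it. -/
def IsLagrangianClass (ω : SymplecticForm N) (α : H2 N) : Prop :=
  ∃ c : TwoChain N, c.Represents α ∧ c.IsLagrangian ω

open Classical in
/-- The number `[ω](α)`, the value of the de Rham class of `ω` on `α`: the integral of `ω` over a
`C^1` cycle that represents `α`. (Every class has such a representative, and the integral does
not depend on it since `ω` is closed; the value `0` in the other branch never occurs on a
manifold.) -/
def deRhamPairing (ω : SymplecticForm N) (α : H2 N) : ℝ :=
  if h : ∃ c : TwoChain N, c.Represents α ∧ c.IsC1 then h.choose.integral ω else 0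

end Homology

end

/-! ### Formal singular chains and the singular chain complex -/

noncomputable section

open CategoryTheory Limits
namespace LagrangianCycles

/-! One direction is immediate: a lagrangian cycle is a `C^1` cycle over which `ω` integrates to
zero. For the converse, consider two-chains modulo lagrangian simplices and boundaries (`LagQuotient
ω`). Every class `α` has a `C^1` representative `w` whose image in this quotient is `Ψ (∫_w ω)` for
some additive map `Ψ : ℝ →+ LagQuotient ω`. If the integral vanishes, then `w = l + ∂b` with `l`
lagrangian, and `l` represents `α`.

Locally, the existence of `Ψ` is algebra. In a Darboux chart (`exists_darbouxChart`, by Moser's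
method) isotropic affine triangles are lagrangian, so the classes of affine triangles form a cocycle
that vanishes on isotropic ones. Such a cocycle splits into its parts in the two coordinate planes.
Two triangles of opposite areas, one in each plane, combine to an isotropic triangle; hence each
part depends only on the area, and does so additively (`IsotropicCocycle.exists_hom`).

The comparison of charts needs geometry. A regular `C^2` arc in a chart is a sum of affine edges and
the boundary of a lagrangian chain (`arc_mem`), because short arcs can be moved to a point through
three lagrangian strips of segments. The segments of one chart are regular arcs in another. So a
small affine triangle of one chart is homologous, in an overlapping chart, to a lagrangian chain
plus an affine chain, with the same total area by Stokes. Therefore the homomorphisms of overlapping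
charts agree (`isRigid_unique`), and by connectedness a single `Ψ` serves everywhere.

Globally, a cycle is subdivided until its simplices are small, and each edge is homotoped to a
segment of a chart attached to its starting point. Each simplex then becomes a chain whose boundary
consists of such segments, and it can be exchanged for a `C^1` chain with class `Ψ` of its area
(`exists_straight`, `exists_c1_homologous`).

It remains to see that the pairing is well defined: a `C^1` cycle that bounds a merely continuous
chain has area zero (`area_bd_eq_zero`). Subdivision does not change the area of a `C^1` cycle
(`area_subdiv`), since affine tetrahedra in a triangle are degenerate. The area of a small `C^1`
cycle can be computed from the straightened edges of its simplices, and that expression makes sense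
for continuous chains and vanishes on boundaries. As the simplices are only `C^1`, Green's formula
is needed for `C^1` functions. -/

/-- The alternating sum of a family of face maps, on chains. -/
def altSum {X Y : Type*} {m : ℕ} (δ : Fin m → X → Y) : (X →₀ ℤ) →+ (Y →₀ ℤ) :=
  ∑ i : Fin m, (-1 : ℤ) ^ (i : ℕ) • Finsupp.mapDomain.addMonoidHom (δ i)

theorem altSum_single {X Y : Type*} {m : ℕ} (δ : Fin m → X → Y) (x : X) (k : ℤ) :
    altSum δ (Finsupp.single x k) =
      ∑ i : Fin m, (-1 : ℤ) ^ (i : ℕ) • Finsupp.single (δ i x) k := by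
  simp [altSum, Finsupp.mapDomain_single]

/-- Singular simplices. -/
abbrev Simp (N : Type*) [TopologicalSpace N] (n : ℕ) := C(stdSimplex ℝ (Fin (n + 1)), N)

section
variable {N : Type*} [TopologicalSpace N]

/-- The faces of a singular simplex. -/
def Simp.face {n : ℕ} (i : Fin (n + 2)) (σ : Simp N (n + 1)) : Simp N n :=
  σ.comp ⟨stdSimplex.map i.succAbove, stdSimplex.continuous_map _⟩

/-- The boundary of singular chains. -/
def bd (n : ℕ) : (Simp N (n + 1) →₀ ℤ) →+ (Simp N n →₀ ℤ) := altSum Simp.face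

theorem bd_single {n : ℕ} (σ : Simp N (n + 1)) (k : ℤ) :
    bd n (Finsupp.single σ k) =
      ∑ i : Fin (n + 2), (-1 : ℤ) ^ (i : ℕ) • Finsupp.single (σ.face i) k :=
  altSum_single _ _ _

end

section
variable (N : Type u) [TopologicalSpace N]

/-- The simplex in the singular simplicial set. -/
abbrev toSSetSimp {n : ℕ} (σ : Simp N n) :
    (TopCat.toSSet.obj (TopCat.of N)).obj (.op (SimplexCategory.mk n)) :=
  ((TopCat.of N).toSSetObjEquiv (.op (SimplexCategory.mk n))).symm σ

/-- The generator of the chain complex given by a simplex. -/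
abbrev gen {n : ℕ} (σ : Simp N n) : intCoeff.{u} ⟶ (singularComplex N).X n :=
  SSet.ιChainComplex (X := TopCat.toSSet.obj (TopCat.of N)) (R := intCoeff) (n := n)
    (toSSetSimp N σ)

/-- Comparison of formal chains with the singular complex. -/
def toX (n : ℕ) : (Simp N n →₀ ℤ) →+ (singularComplex N).X n :=
  Finsupp.liftAddHom fun σ => (gen N σ).hom.toAddMonoidHom.comp
    (AddEquiv.ulift.{0, u} (α := ℤ)).symm.toAddMonoidHom

theorem toX_single {n : ℕ} (σ : Simp N n) (k : ℤ) :
    toX N n (Finsupp.single σ k) = (gen N σ).hom (ULift.up k) := by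
  simp [toX]
  rfl

theorem toSSetSimp_face {n : ℕ} (i : Fin (n + 2)) (σ : Simp N (n + 1)) :
    (TopCat.toSSet.obj (TopCat.of N)).δ i (toSSetSimp N σ) = toSSetSimp N (σ.face i) := by
  exact TopCat.toSSetObjEquiv_symm_naturality (X := TopCat.of N) (SimplexCategory.δ i) σ

theorem gen_d {n : ℕ} (σ : Simp N (n + 1)) :
    gen N σ ≫ (singularComplex N).d (n + 1) n =
      ∑ i : Fin (n + 2), (-1) ^ (i : ℕ) • gen N (σ.face i) := by
  refine (SSet.ιChainComplex_d _ _ _).trans ?_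
  refine Finset.sum_congr rfl fun i _ => ?_
  rw [toSSetSimp_face]
  rfl

theorem toX_bd {n : ℕ} (c : Simp N (n + 1) →₀ ℤ) :
    toX N n (bd n c) = ((singularComplex N).d (n + 1) n).hom (toX N (n + 1) c) := by
  induction c using Finsupp.induction_linear with
  | zero => simp
  | add f g hf hg => simp only [map_add, hf, hg]
  | single σ k =>
    rw [bd_single, toX_single, map_sum]
    have := congrArg (fun f => f.hom (ULift.up k)) (gen_d N σ)
    simp only [ModuleCat.hom_comp, LinearMap.comp_apply] at this
    rw [this, ModuleCat.hom_sum, LinearMap.sum_apply]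
    refine Finset.sum_congr rfl fun i _ => ?_
    rw [map_zsmul, toX_single]
    rfl

/-- The inverse comparison. -/
def ofX (n : ℕ) : (singularComplex N).X n ⟶ ModuleCat.of ℤ (Simp N n →₀ ℤ) :=
  Cofan.IsColimit.desc (SSet.isColimitChainComplexXCofan (TopCat.toSSet.obj (TopCat.of N))
    intCoeff n) fun x => ModuleCat.ofHom
      ((Finsupp.lsingle (((TopCat.of N).toSSetObjEquiv (.op (SimplexCategory.mk n))) x)).comp
        (ULift.moduleEquiv (R := ℤ) (M := ℤ)).toLinearMap)

theorem gen_ofX {n : ℕ} (σ : Simp N n) (k : ℤ) :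
    (ofX N n).hom ((gen N σ).hom (ULift.up k)) = Finsupp.single σ k := by
  have := Cofan.IsColimit.fac (SSet.isColimitChainComplexXCofan (TopCat.toSSet.obj (TopCat.of N))
    intCoeff n) (fun x => ModuleCat.ofHom
      ((Finsupp.lsingle (((TopCat.of N).toSSetObjEquiv (.op (SimplexCategory.mk n))) x)).comp
        (ULift.moduleEquiv (R := ℤ) (M := ℤ)).toLinearMap)) (toSSetSimp N σ)
  have h2 := congrArg (fun f => f.hom (ULift.up k)) this
  refine h2.trans ?_
  simp

theorem ofX_toX {n : ℕ} (c : Simp N n →₀ ℤ) : (ofX N n).hom (toX N n c) = c := by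
  induction c using Finsupp.induction_linear with
  | zero => simp
  | add f g hf hg => simp only [map_add, hf, hg]
  | single σ k => rw [toX_single, gen_ofX]

theorem toX_ofX {n : ℕ} (c : (singularComplex N).X n) : toX N n ((ofX N n).hom c) = c := by
  have : ofX N n ≫ ModuleCat.ofHom (Y := (singularComplex N).X n)
      { toFun := toX N n
        map_add' := map_add _
        map_smul' := fun k x => by simpa using map_intCast_smul (toX N n) ℤ ℤ k x } = 𝟙 _ := by
    refine SSet.chainComplex_hom_ext fun x => ?_
    obtain ⟨σ, rfl⟩ := ((TopCat.of N).toSSetObjEquiv (.op (SimplexCategory.mk n))).symm.surjective x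
    ext ⟨k⟩
    change toX N n ((ofX N n).hom ((gen N σ).hom (ULift.up _))) = (gen N σ).hom (ULift.up _)
    rw [gen_ofX, toX_single]
  exact congrArg (fun f => f.hom c) this

theorem toX_injective (n : ℕ) : Function.Injective (toX N n) :=
  Function.LeftInverse.injective (ofX_toX N)

variable {N}

/-- Transported from `d ∘ d = 0` along the injective comparison `toX`, which avoids a second
computation with face maps. -/
theorem bd_bd {n : ℕ} (c : Simp N (n + 2) →₀ ℤ) : bd n (bd (n + 1) c) = 0 := by
  apply toX_injective
  rw [toX_bd, toX_bd, map_zero]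
  have := congrArg (fun f => f.hom (toX N (n + 2) c)) ((singularComplex N).d_comp_d (n + 2) (n + 1) n)
  exact this

theorem toComplex_eq (c : TwoChain N) : c.toComplex = toX N 2 c := by
  simp only [TwoChain.toComplex, toX, Finsupp.liftAddHom_apply]
  rfl

theorem bd_eq_zero_of_represents {c : TwoChain N} {α : H2 N} (h : c.Represents α) :
    bd 1 c = 0 := by
  obtain ⟨z, hz, -⟩ := h
  apply toX_injective
  rw [toX_bd, map_zero, ← toComplex_eq, ← hz]
  exact congrArg (fun f => f.hom z) ((singularComplex N).iCycles_d 2 1)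

theorem homologyπ_toCycles (b : (singularComplex N).X 3) :
    ((singularComplex N).homologyπ 2).hom (((singularComplex N).toCycles 3 2).hom b) = 0 :=
  congrArg (fun g => g.hom b) ((singularComplex N).toCycles_comp_homologyπ 3 2)

theorem iCycles_toCycles (b : (singularComplex N).X 3) :
    ((singularComplex N).iCycles 2).hom (((singularComplex N).toCycles 3 2).hom b) =
      ((singularComplex N).d 3 2).hom b :=
  congrArg (fun g => g.hom b) ((singularComplex N).toCycles_i 3 2)

/-- Needed twice: to pass from a representative to its `C^1` replacement, and at the very end to
discard the boundary and keep only the lagrangian part. -/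
theorem represents_add_bd {c : TwoChain N} {α : H2 N} (h : c.Represents α)
    (b : Simp N 3 →₀ ℤ) : TwoChain.Represents (c + bd 2 b) α := by
  obtain ⟨z, hz, hα⟩ := h
  refine ⟨z + ((singularComplex N).toCycles 3 2).hom (toX N 3 b), ?_, ?_⟩
  · rw [map_add, hz, iCycles_toCycles, toComplex_eq, toComplex_eq, ← toX_bd, map_add]
  · rw [map_add, homologyπ_toCycles, add_zero, hα]

theorem exists_represents (α : H2 N) : ∃ c : TwoChain N, c.Represents α := by
  obtain ⟨z, hz⟩ := (ModuleCat.epi_iff_surjective ((singularComplex N).homologyπ 2)).1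
    inferInstance α
  refine ⟨(ofX N 2).hom (((singularComplex N).iCycles 2).hom z), z, ?_, hz⟩
  rw [toComplex_eq, toX_ofX]

/-- Homology is the cokernel of `toCycles`, so by exactness two cycles with the same class differ by
a boundary. The bounding chain is only continuous, even when both cycles are `C^1`. -/
theorem exists_bd_of_represents {c c' : TwoChain N} {α : H2 N} (h : c.Represents α)
    (h' : c'.Represents α) : ∃ b : Simp N 3 →₀ ℤ, c - c' = bd 2 b := by
  obtain ⟨z, hz, hα⟩ := h
  obtain ⟨z', hz', hα'⟩ := h'
  let S := ShortComplex.mk _ _ ((singularComplex N).toCycles_comp_homologyπ 3 2)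
  have hS : S.Exact := S.exact_of_g_is_cokernel
    ((singularComplex N).homologyIsCokernel 3 2 (by simp))
  obtain ⟨b, hb⟩ := (ShortComplex.moduleCat_exact_iff S).1 hS (z - z') (by
    change ((singularComplex N).homologyπ 2).hom (z - z') = 0
    rw [map_sub]
    exact sub_eq_zero.2 (hα.trans hα'.symm))
  refine ⟨(ofX N 3).hom b, toX_injective N 2 ?_⟩
  rw [toX_bd, toX_ofX, map_sub, ← toComplex_eq, ← toComplex_eq, ← hz, ← hz', ← map_sub,
    ← iCycles_toCycles]
  exact congrArg _ hb.symm

end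

end LagrangianCycles

end

/-! ### Chains of affine simplices: cones and barycentric subdivision -/

noncomputable section

set_option linter.unusedSectionVars false
namespace LagrangianCycles

section Chains
variable {X A : Type*} [AddCommGroup A]

theorem chain_hom_ext {f g : (X →₀ ℤ) →+ A}
    (h : ∀ x, f (Finsupp.single x 1) = g (Finsupp.single x 1)) : f = g := by
  refine Finsupp.addHom_ext fun x k => ?_
  have : Finsupp.single x k = k • Finsupp.single x (1 : ℤ) := by simp
  rw [this, map_zsmul, map_zsmul, h]

/-- The additive extension of a function on generators to chains. -/
def extend (φ : X → A) : (X →₀ ℤ) →+ A := Finsupp.liftAddHom fun x => zmultiplesHom A (φ x)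

@[simp] theorem extend_single (φ : X → A) (x : X) (k : ℤ) :
    extend φ (Finsupp.single x k) = k • φ x := by
  simp [extend]

/-- The chains all of whose generators are in `s`. -/
def chainsIn (s : Set X) : AddSubgroup (X →₀ ℤ) where
  carrier := {c | ∀ x ∈ c.support, x ∈ s}
  zero_mem' := by simp
  add_mem' {a b} ha hb x hx := by
    classical
    rcases Finset.mem_union.1 (Finsupp.support_add hx) with h | h
    exacts [ha x h, hb x h]
  neg_mem' {a} ha x hx := ha x (by simpa using hx)

theorem single_mem_chainsIn {s : Set X} {x : X} (hx : x ∈ s) (k : ℤ) :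
    Finsupp.single x k ∈ chainsIn s := by
  intro y hy
  obtain rfl : y = x := by simpa using Finsupp.support_single_subset hy
  exact hx

theorem map_mem_of_chainsIn {s : Set X} (f : (X →₀ ℤ) →+ A) (B : AddSubgroup A)
    (h : ∀ x ∈ s, f (Finsupp.single x 1) ∈ B) {c : X →₀ ℤ} (hc : c ∈ chainsIn s) : f c ∈ B := by
  rw [← Finsupp.sum_single c, Finsupp.sum, map_sum]
  refine B.sum_mem fun x hx => ?_
  have : Finsupp.single x (c x) = c x • Finsupp.single x (1 : ℤ) := by simp
  rw [this, map_zsmul]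
  exact B.zsmul_mem (h x (hc x hx)) _

/-- Most identities below hold only for generators subject to a condition (continuity, smallness, a
given chart). This restricted extensionality reduces them to single generators. -/
theorem eqOn_chainsIn {s : Set X} {f g : (X →₀ ℤ) →+ A}
    (h : ∀ x ∈ s, f (Finsupp.single x 1) = g (Finsupp.single x 1)) {c : X →₀ ℤ}
    (hc : c ∈ chainsIn s) : f c = g c := by
  have := map_mem_of_chainsIn (f - g) ⊥ (fun x hx => by simp [h x hx]) hc
  simpa [sub_eq_zero] using this

theorem chainsIn_mono {s t : Set X} (h : s ⊆ t) : chainsIn s ≤ chainsIn t :=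
  fun _ hc x hx => h (hc x hx)

theorem altSum_mem {Y : Type*} {m : ℕ} (δ : Fin m → X → Y) {s : Set X} {t : Set Y}
    (h : ∀ x ∈ s, ∀ i, δ i x ∈ t) {c : X →₀ ℤ} (hc : c ∈ chainsIn s) :
    altSum δ c ∈ chainsIn t := by
  refine map_mem_of_chainsIn _ _ (fun x hx => ?_) hc
  rw [altSum_single]
  exact sum_mem fun i _ => AddSubgroup.zsmul_mem _ (single_mem_chainsIn (h x hx i) 1) _

end Chains

section Tuples
variable {F F' : Type*} [AddCommGroup F] [Module ℝ F] [AddCommGroup F'] [Module ℝ F']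

/-- Tuples of points, seen as affine simplices. -/
abbrev Tup (F : Type*) (n : ℕ) := Fin (n + 1) → F

/-- The boundary of chains of tuples. -/
def tbd (n : ℕ) : (Tup F (n + 1) →₀ ℤ) →+ (Tup F n →₀ ℤ) :=
  altSum fun i v => v ∘ i.succAbove

/-- The cone on chains of tuples. -/
def cone {n : ℕ} (b : F) : (Tup F n →₀ ℤ) →+ (Tup F (n + 1) →₀ ℤ) :=
  Finsupp.mapDomain.addMonoidHom fun v => Fin.cons b v

@[simp] theorem cone_single {n : ℕ} (b : F) (v : Tup F n) (k : ℤ) :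
    cone b (Finsupp.single v k) = Finsupp.single (Fin.cons b v : Tup F (n + 1)) k := by
  simp [cone, Finsupp.mapDomain_single]

theorem tbd_single {n : ℕ} (v : Tup F (n + 1)) (k : ℤ) :
    tbd n (Finsupp.single v k) =
      ∑ i : Fin (n + 2), (-1 : ℤ) ^ (i : ℕ) • Finsupp.single (v ∘ i.succAbove) k :=
  altSum_single _ _ _

theorem tbd_zero_single (v : Tup F 1) (k : ℤ) : tbd 0 (Finsupp.single v k) =
    Finsupp.single (v ∘ (0 : Fin 2).succAbove) k -
      Finsupp.single (v ∘ (1 : Fin 2).succAbove) k := by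
  rw [tbd_single]
  exact (Fin.sum_univ_two _).trans (by simp [sub_eq_add_neg])

theorem cons_comp_succAbove_succ {n : ℕ} (b : F) (v : Tup F (n + 1)) (i : Fin (n + 2)) :
    (Fin.cons b v : Tup F (n + 2)) ∘ i.succ.succAbove =
      (Fin.cons b (v ∘ i.succAbove) : Tup F (n + 1)) := by
  funext j
  refine Fin.cases ?_ (fun j => ?_) j <;> simp

/-- Omitting the apex returns the base, and omitting a vertex of the base gives the cone on a face.
All the inductions on the degree below rest on this formula. -/
theorem tbd_cone {n : ℕ} (b : F) (c : Tup F (n + 1) →₀ ℤ) :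
    tbd (n + 1) (cone b c) = c - cone b (tbd n c) := by
  suffices (tbd (n + 1)).comp (cone b) = AddMonoidHom.id _ - (cone b).comp (tbd n) from
    DFunLike.congr_fun this c
  refine chain_hom_ext fun v => ?_
  simp only [AddMonoidHom.comp_apply, cone_single, tbd_single, AddMonoidHom.sub_apply,
    AddMonoidHom.id_apply, map_sum, map_zsmul]
  rw [Fin.sum_univ_succ, sub_eq_add_neg, ← Finset.sum_neg_distrib]
  congr 1
  · simp
  · refine Finset.sum_congr rfl fun i _ => ?_
    rw [cons_comp_succAbove_succ, Fin.val_succ, pow_succ]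
    simp

theorem tbd_tbd {n : ℕ} (c : Tup F (n + 2) →₀ ℤ) : tbd n (tbd (n + 1) c) = 0 := by
  suffices h : ∀ v : Tup F (n + 2), tbd n (tbd (n + 1) (Finsupp.single v 1)) = 0 from
    DFunLike.congr_fun (chain_hom_ext (f := (tbd n).comp (tbd (n + 1))) (g := 0) h) c
  clear c
  induction n with
  | zero =>
    intro v
    simp only [tbd_single, Fin.sum_univ_succ, map_add, map_zsmul, Fin.val_zero, Fin.val_succ,
      Finset.univ_eq_empty, Finset.sum_empty]
    have h1 : (v ∘ (Fin.succ 0).succAbove) ∘ (0 : Fin 2).succAbove =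
        (v ∘ (0 : Fin 3).succAbove) ∘ (0 : Fin 2).succAbove := by
      funext j; fin_cases j; rfl
    have h2 : (v ∘ (Fin.succ 0).succAbove) ∘ (Fin.succ 0 : Fin 2).succAbove =
        (v ∘ (Fin.succ (Fin.succ 0) : Fin 3).succAbove) ∘ (Fin.succ 0 : Fin 2).succAbove := by
      funext j; fin_cases j; rfl
    have h3 : (v ∘ (0 : Fin 3).succAbove) ∘ (Fin.succ 0 : Fin 2).succAbove =
        (v ∘ (Fin.succ (Fin.succ 0) : Fin 3).succAbove) ∘ (0 : Fin 2).succAbove := by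
      funext j; fin_cases j; rfl
    rw [h1, h2, h3]
    simp
    abel
  | succ n ih =>
    intro v
    -- Every tuple is the cone on its tail with apex its zeroth entry, so the cone formula reduces
    -- the claim to one degree lower.
    have hv : Finsupp.single v (1 : ℤ) = cone (v 0) (Finsupp.single (Fin.tail v) 1) := by
      rw [cone_single, Fin.cons_self_tail]
    have ih' : ∀ c : Tup F (n + 2) →₀ ℤ, tbd n (tbd (n + 1) c) = 0 := fun c =>
      DFunLike.congr_fun (chain_hom_ext (f := (tbd n).comp (tbd (n + 1))) (g := 0) ih) c
    rw [hv, tbd_cone, map_sub, tbd_cone, ih', map_zero, sub_zero, sub_self]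

/-- The barycenter of a tuple. -/
def bary {n : ℕ} (v : Tup F n) : F := ((n : ℝ) + 1)⁻¹ • ∑ i, v i

/-- Barycentric subdivision of chains of tuples. -/
def Sd : (n : ℕ) → (Tup F n →₀ ℤ) →+ (Tup F n →₀ ℤ)
  | 0 => AddMonoidHom.id _
  | n + 1 => extend fun v => cone (bary v) (Sd n (tbd n (Finsupp.single v 1)))

theorem Sd_single {n : ℕ} (v : Tup F (n + 1)) : Sd (n + 1) (Finsupp.single v 1) =
    cone (bary v) (Sd n (tbd n (Finsupp.single v 1))) := by
  rw [Sd, extend_single, one_smul]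

theorem tbd_Sd {n : ℕ} (c : Tup F (n + 1) →₀ ℤ) : tbd n (Sd (n + 1) c) = Sd n (tbd n c) := by
  suffices h : ∀ v : Tup F (n + 1), tbd n (Sd (n + 1) (Finsupp.single v 1)) =
      Sd n (tbd n (Finsupp.single v 1)) from
    DFunLike.congr_fun (chain_hom_ext (f := (tbd n).comp (Sd (n + 1)))
      (g := (Sd n).comp (tbd n)) h) c
  clear c
  induction n with
  | zero =>
    intro v
    rw [Sd_single]
    rw [Sd, AddMonoidHom.id_apply, tbd_zero_single, map_sub, cone_single,
      cone_single, map_sub, tbd_zero_single, tbd_zero_single]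
    have h : ∀ (w : Tup F 0), (Fin.cons (bary v) w : Tup F 1) ∘ (Fin.succAbove 1) =
        fun _ => bary v := fun w => by
      funext j; fin_cases j; rfl
    have h2 : ∀ (w : Tup F 0), (Fin.cons (bary v) w : Tup F 1) ∘ (Fin.succAbove 0) = w :=
      fun w => by
      funext j; fin_cases j; rfl
    rw [h, h, h2, h2]
    simp
  | succ n ih =>
    intro v
    have ih' : ∀ c, tbd n (Sd (n + 1) c) = Sd n (tbd n c) := fun c =>
      DFunLike.congr_fun (chain_hom_ext (f := (tbd n).comp (Sd (F := F) (n + 1)))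
        (g := (Sd n).comp (tbd n)) ih) c
    rw [Sd_single, tbd_cone, ih', tbd_tbd, map_zero, map_zero, sub_zero]

/-- The chain homotopy between the identity and barycentric subdivision. -/
def SdT : (n : ℕ) → (Tup F n →₀ ℤ) →+ (Tup F (n + 1) →₀ ℤ)
  | 0 => 0
  | n + 1 => extend fun v => cone (bary v)
      (Finsupp.single v 1 - SdT n (tbd n (Finsupp.single v 1)))

theorem SdT_single {n : ℕ} (v : Tup F (n + 1)) : SdT (n + 1) (Finsupp.single v 1) =
    cone (bary v) (Finsupp.single v 1 - SdT n (tbd n (Finsupp.single v 1))) := by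
  rw [SdT, extend_single, one_smul]

/-- The chain `v - SdT (∂v)` has boundary `Sd (∂v)` by induction; coning it from the barycenter
produces the missing term `Sd v`. -/
theorem tbd_SdT {n : ℕ} (c : Tup F (n + 1) →₀ ℤ) :
    tbd (n + 1) (SdT (n + 1) c) = c - Sd (n + 1) c - SdT n (tbd n c) := by
  suffices h : ∀ v : Tup F (n + 1), tbd (n + 1) (SdT (n + 1) (Finsupp.single v 1)) =
      Finsupp.single v 1 - Sd (n + 1) (Finsupp.single v 1) - SdT n (tbd n (Finsupp.single v 1)) from
    DFunLike.congr_fun (chain_hom_ext (f := (tbd (n + 1)).comp (SdT (n + 1)))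
      (g := AddMonoidHom.id _ - Sd (n + 1) - (SdT n).comp (tbd n)) h) c
  clear c
  induction n with
  | zero =>
    intro v
    rw [SdT_single, tbd_cone, Sd_single]
    simp only [SdT, Sd, AddMonoidHom.zero_apply, sub_zero, AddMonoidHom.id_apply]
  | succ n ih =>
    intro v
    have ih' : ∀ c, tbd (n + 1) (SdT (n + 1) c) = c - Sd (n + 1) c - SdT n (tbd n c) := fun c =>
      DFunLike.congr_fun (chain_hom_ext (f := (tbd (n + 1)).comp (SdT (F := F) (n + 1)))
        (g := AddMonoidHom.id _ - Sd (n + 1) - (SdT n).comp (tbd n)) ih) c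
    rw [SdT_single, tbd_cone, map_sub (tbd (n + 1)), ih', tbd_tbd, map_zero, sub_zero, Sd_single,
      sub_sub_cancel]
    abel

/-- The map on chains of tuples induced by a linear map. -/
def tmap {n : ℕ} (ℓ : F →ₗ[ℝ] F') : (Tup F n →₀ ℤ) →+ (Tup F' n →₀ ℤ) :=
  Finsupp.mapDomain.addMonoidHom fun v => ℓ ∘ v

@[simp] theorem tmap_single {n : ℕ} (ℓ : F →ₗ[ℝ] F') (v : Tup F n) (k : ℤ) :
    tmap ℓ (Finsupp.single v k) = Finsupp.single (ℓ ∘ v) k := by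
  simp [tmap, Finsupp.mapDomain_single]

theorem tbd_tmap {n : ℕ} (ℓ : F →ₗ[ℝ] F') (c : Tup F (n + 1) →₀ ℤ) :
    tbd n (tmap ℓ c) = tmap ℓ (tbd n c) := by
  refine DFunLike.congr_fun (chain_hom_ext (f := (tbd n).comp (tmap ℓ))
      (g := (tmap ℓ).comp (tbd n)) fun v => ?_) c
  simp [tbd_single, map_sum, Function.comp_assoc]

theorem cone_tmap {n : ℕ} (ℓ : F →ₗ[ℝ] F') (b : F) (c : Tup F n →₀ ℤ) :
    cone (ℓ b) (tmap ℓ c) = tmap ℓ (cone b c) := by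
  refine DFunLike.congr_fun (chain_hom_ext (f := (cone (ℓ b)).comp (tmap ℓ))
      (g := (tmap ℓ).comp (cone b)) fun v => ?_) c
  simp only [AddMonoidHom.comp_apply, tmap_single, cone_single]
  congr 1
  funext j
  refine Fin.cases ?_ (fun j => ?_) j <;> simp

theorem bary_comp {n : ℕ} (ℓ : F →ₗ[ℝ] F') (v : Tup F n) : bary (ℓ ∘ v) = ℓ (bary v) := by
  simp [bary, map_sum]

theorem Sd_tmap {n : ℕ} (ℓ : F →ₗ[ℝ] F') (c : Tup F n →₀ ℤ) :
    Sd n (tmap ℓ c) = tmap ℓ (Sd n c) := by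
  induction n with
  | zero => rfl
  | succ n ih =>
    refine DFunLike.congr_fun (chain_hom_ext (f := (Sd (n + 1)).comp (tmap ℓ))
      (g := (tmap ℓ).comp (Sd (n + 1))) fun v => ?_) c
    simp only [AddMonoidHom.comp_apply]
    rw [tmap_single, Sd_single, Sd_single, ← tmap_single,
      tbd_tmap, ih, bary_comp, cone_tmap]

theorem SdT_tmap {n : ℕ} (ℓ : F →ₗ[ℝ] F') (c : Tup F n →₀ ℤ) :
    SdT n (tmap ℓ c) = tmap ℓ (SdT n c) := by
  induction n with
  | zero => simp [SdT]
  | succ n ih =>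
    refine DFunLike.congr_fun (chain_hom_ext (f := (SdT (n + 1)).comp (tmap ℓ))
      (g := (tmap ℓ).comp (SdT (n + 1))) fun v => ?_) c
    simp only [AddMonoidHom.comp_apply]
    rw [tmap_single, SdT_single, SdT_single, ← tmap_single,
      tbd_tmap, ih, bary_comp, ← map_sub, cone_tmap]

/-- Iterated barycentric subdivision. -/
def SdIter (k n : ℕ) : (Tup F n →₀ ℤ) →+ (Tup F n →₀ ℤ) :=
  k.rec (AddMonoidHom.id _) fun _ f => (Sd n).comp f

/-- The chain homotopy between the identity and iterated barycentric subdivision. -/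
def SdTIter (k n : ℕ) : (Tup F n →₀ ℤ) →+ (Tup F (n + 1) →₀ ℤ) :=
  k.rec 0 fun j f => f + (SdT n).comp (SdIter j n)

theorem SdIter_succ (k n : ℕ) (c : Tup F n →₀ ℤ) :
    SdIter (k + 1) n c = Sd n (SdIter k n c) := rfl

theorem SdTIter_succ (k n : ℕ) (c : Tup F n →₀ ℤ) :
    SdTIter (k + 1) n c = SdTIter k n c + SdT n (SdIter k n c) := rfl

theorem tbd_SdIter (k : ℕ) {n : ℕ} (c : Tup F (n + 1) →₀ ℤ) :
    tbd n (SdIter k (n + 1) c) = SdIter k n (tbd n c) := by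
  induction k with
  | zero => rfl
  | succ k ih => rw [SdIter_succ, SdIter_succ, tbd_Sd, ih]

theorem tbd_SdTIter (k : ℕ) {n : ℕ} (c : Tup F (n + 1) →₀ ℤ) :
    tbd (n + 1) (SdTIter k (n + 1) c) = c - SdIter k (n + 1) c - SdTIter k n (tbd n c) := by
  induction k with
  | zero => simp [SdTIter, SdIter]
  | succ k ih =>
    rw [SdTIter_succ, SdTIter_succ, map_add, ih, tbd_SdT, tbd_SdIter, SdIter_succ]
    abel

theorem SdIter_tmap (k : ℕ) {n : ℕ} (ℓ : F →ₗ[ℝ] F') (c : Tup F n →₀ ℤ) :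
    SdIter k n (tmap ℓ c) = tmap ℓ (SdIter k n c) := by
  induction k with
  | zero => rfl
  | succ k ih => rw [SdIter_succ, SdIter_succ, ih, Sd_tmap]

theorem SdTIter_tmap (k : ℕ) {n : ℕ} (ℓ : F →ₗ[ℝ] F') (c : Tup F n →₀ ℤ) :
    SdTIter k n (tmap ℓ c) = tmap ℓ (SdTIter k n c) := by
  induction k with
  | zero => simp [SdTIter]
  | succ k ih => rw [SdTIter_succ, SdTIter_succ, ih, SdIter_tmap, SdT_tmap, map_add]

/-- The tuples of points of a set. -/
def tupIn (K : Set F) (n : ℕ) : Set (Tup F n) := {v | ∀ i, v i ∈ K}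

variable {K : Set F}

theorem tbd_mem {n : ℕ} {c : Tup F (n + 1) →₀ ℤ} (hc : c ∈ chainsIn (tupIn K (n + 1))) :
    tbd n c ∈ chainsIn (tupIn K n) :=
  altSum_mem (s := tupIn K (n + 1)) (t := tupIn K n) _ (fun _ hv i j => hv (i.succAbove j)) hc

theorem cons_mem_tupIn {n : ℕ} {b : F} (hb : b ∈ K) {v : Tup F n} (hv : v ∈ tupIn K n) :
    (Fin.cons b v : Tup F (n + 1)) ∈ tupIn K (n + 1) := fun i =>
  Fin.cases (by simpa using hb) (fun j => by simpa using hv j) i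

theorem cone_mem {n : ℕ} {b : F} (hb : b ∈ K) {c : Tup F n →₀ ℤ} (hc : c ∈ chainsIn (tupIn K n)) :
    cone b c ∈ chainsIn (tupIn K (n + 1)) := by
  refine map_mem_of_chainsIn _ _ (fun v hv => ?_) hc
  rw [cone_single]
  exact single_mem_chainsIn (cons_mem_tupIn hb hv) 1

theorem bary_mem (hK : Convex ℝ K) {n : ℕ} {v : Tup F n} (hv : v ∈ tupIn K n) : bary v ∈ K := by
  rw [bary, Finset.smul_sum]
  refine hK.sum_mem (fun _ _ => by positivity) ?_ fun i _ => hv i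
  simp
  field_simp

theorem Sd_mem (hK : Convex ℝ K) {n : ℕ} {c : Tup F n →₀ ℤ} (hc : c ∈ chainsIn (tupIn K n)) :
    Sd n c ∈ chainsIn (tupIn K n) := by
  induction n with
  | zero => exact hc
  | succ n ih =>
    refine map_mem_of_chainsIn _ _ (fun v hv => ?_) hc
    rw [Sd_single]
    exact cone_mem (bary_mem hK hv) (ih (tbd_mem (single_mem_chainsIn hv 1)))

theorem SdT_mem (hK : Convex ℝ K) {n : ℕ} {c : Tup F n →₀ ℤ} (hc : c ∈ chainsIn (tupIn K n)) :
    SdT n c ∈ chainsIn (tupIn K (n + 1)) := by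
  induction n with
  | zero => exact zero_mem _
  | succ n ih =>
    refine map_mem_of_chainsIn _ _ (fun v hv => ?_) hc
    rw [SdT_single]
    exact cone_mem (bary_mem hK hv) (sub_mem (single_mem_chainsIn hv 1)
      (ih (tbd_mem (single_mem_chainsIn hv 1))))

theorem SdIter_mem (hK : Convex ℝ K) (k : ℕ) {n : ℕ} {c : Tup F n →₀ ℤ}
    (hc : c ∈ chainsIn (tupIn K n)) : SdIter k n c ∈ chainsIn (tupIn K n) := by
  induction k with
  | zero => exact hc
  | succ k ih => exact Sd_mem hK ih

theorem SdTIter_mem (hK : Convex ℝ K) (k : ℕ) {n : ℕ} {c : Tup F n →₀ ℤ}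
    (hc : c ∈ chainsIn (tupIn K n)) : SdTIter k n c ∈ chainsIn (tupIn K (n + 1)) := by
  induction k with
  | zero => exact zero_mem _
  | succ k ih => exact add_mem ih (SdT_mem hK (SdIter_mem hK k hc))

end Tuples

/-! ### Decay of the diameters under subdivision -/

section Mesh
variable {F : Type*} [NormedAddCommGroup F] [NormedSpace ℝ F]

/-- The tuples of points at mutual distance at most `d`. -/
def tupDiam (F : Type*) [NormedAddCommGroup F] (d : ℝ) (n : ℕ) : Set (Tup F n) :=
  {v | ∀ i j, dist (v i) (v j) ≤ d}

/-- The difference between a vertex and the barycenter is the mean of `n + 2` differences of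
vertices, one of which is zero. Closed balls are convex, so the bound at the vertices extends to
their hull. -/
theorem dist_bary_le {n : ℕ} {d : ℝ} {v : Tup F (n + 1)} (hv : v ∈ tupDiam F d (n + 1))
    {y : F} (hy : y ∈ convexHull ℝ (Set.range v)) :
    dist (bary v) y ≤ ((n : ℝ) + 1) / (n + 2) * d := by
  have : convexHull ℝ (Set.range v) ⊆ Metric.closedBall (bary v) (((n : ℝ) + 1) / (n + 2) * d) := by
    refine convexHull_min ?_ (convex_closedBall _ _)
    rintro _ ⟨j, rfl⟩
    rw [Metric.mem_closedBall, dist_eq_norm]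
    have h1 : v j - bary v = ((n : ℝ) + 2)⁻¹ • ∑ i, (v j - v i) := by
      rw [bary, Finset.sum_sub_distrib, smul_sub]
      congr 1
      · rw [Finset.sum_const, Finset.card_univ, Fintype.card_fin, ← Nat.cast_smul_eq_nsmul ℝ,
          smul_smul]
        push_cast
        rw [show ((n : ℝ) + 2)⁻¹ * (n + 1 + 1) = 1 by field_simp; ring, one_smul]
      · congr 2
        push_cast
        ring
    rw [h1, norm_smul, Real.norm_of_nonneg (by positivity)]
    have h2 : ‖∑ i, (v j - v i)‖ ≤ (n + 1) * d := by
      rw [Fin.sum_univ_succAbove _ j, sub_self, zero_add]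
      refine (norm_sum_le _ _).trans ?_
      refine (Finset.sum_le_card_nsmul _ _ d fun i _ => ?_).trans ?_
      · rw [← dist_eq_norm]; exact hv _ _
      · simp
    calc ((n : ℝ) + 2)⁻¹ * ‖∑ i, (v j - v i)‖ ≤ ((n : ℝ) + 2)⁻¹ * ((n + 1) * d) := by gcongr
      _ = _ := by ring
  rw [dist_comm]
  exact this hy

/-- A simplex of the subdivision is the barycenter joined to a simplex of a subdivided face.
Distances to the barycenter are controlled by `dist_bary_le`, the others by induction, as `n / (n +
1)` increases with `n`. The proof therefore also tracks that the subdivided faces stay in the convex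
hull. -/
theorem Sd_mem_tupDiam {n : ℕ} {d : ℝ} (hd : 0 ≤ d) {c : Tup F n →₀ ℤ}
    (hc : c ∈ chainsIn (tupDiam F d n)) :
    Sd n c ∈ chainsIn (tupDiam F ((n : ℝ) / (n + 1) * d) n) := by
  induction n with
  | zero =>
    refine map_mem_of_chainsIn _ _ (fun v hv => single_mem_chainsIn ?_ 1) hc
    intro i j
    rw [Subsingleton.elim (α := Fin 1) i j]
    simp
  | succ n ih =>
    refine map_mem_of_chainsIn _ _ (fun v hv => ?_) hc
    rw [Sd_single]
    have h1 := ih (c := tbd n (Finsupp.single v 1))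
      (altSum_mem (s := tupDiam F d (n + 1)) (t := tupDiam F d n) _ (fun _ hv i j k => hv _ _) (single_mem_chainsIn hv 1))
    have h2 : Sd n (tbd n (Finsupp.single v 1)) ∈
        chainsIn (tupIn (convexHull ℝ (Set.range v)) n) :=
      Sd_mem (convex_convexHull _ _) (tbd_mem (single_mem_chainsIn
        (s := tupIn (convexHull ℝ (Set.range v)) (n + 1))
        (fun i => subset_convexHull _ _ (Set.mem_range_self i)) 1))
    have h3 : Sd n (tbd n (Finsupp.single v 1)) ∈ chainsIn
      (tupDiam F ((n : ℝ) / (n + 1) * d) n ∩ tupIn (convexHull ℝ (Set.range v)) n) :=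
      fun x hx => ⟨h1 x hx, h2 x hx⟩
    refine map_mem_of_chainsIn _ _ (fun w hw => ?_) h3
    rw [cone_single]
    refine single_mem_chainsIn ?_ 1
    have hle : (n : ℝ) / (n + 1) * d ≤ ((n + 1 : ℕ) : ℝ) / ((n + 1 : ℕ) + 1) * d := by
      gcongr ?_ * d
      push_cast
      rw [div_le_div_iff₀ (by positivity) (by positivity)]
      nlinarith
    have heq : ((n + 1 : ℕ) : ℝ) / ((n + 1 : ℕ) + 1) * d = ((n : ℝ) + 1) / (n + 2) * d := by
      push_cast; ring_nf
    intro i j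
    refine Fin.cases ?_ (fun i => ?_) i <;> refine Fin.cases ?_ (fun j => ?_) j
    · simp only [Fin.cons_zero, dist_self]; positivity
    · simp only [Fin.cons_zero, Fin.cons_succ]
      rw [heq]
      exact dist_bary_le hv (hw.2 j)
    · simp only [Fin.cons_zero, Fin.cons_succ]
      rw [heq, dist_comm]
      exact dist_bary_le hv (hw.2 i)
    · simp only [Fin.cons_succ]
      exact (hw.1 i j).trans hle

theorem SdIter_mem_tupDiam {k n : ℕ} {d : ℝ} (hd : 0 ≤ d) {c : Tup F n →₀ ℤ}
    (hc : c ∈ chainsIn (tupDiam F d n)) :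
    SdIter k n c ∈ chainsIn (tupDiam F (((n : ℝ) / (n + 1)) ^ k * d) n) := by
  induction k with
  | zero =>
    rw [pow_zero, one_mul]
    exact hc
  | succ k ih =>
    have := Sd_mem_tupDiam (by positivity) ih
    rwa [← mul_assoc, ← pow_succ'] at this

end Mesh
end LagrangianCycles

end

/-! ### Subdivision of singular chains -/

noncomputable section

set_option linter.unusedSectionVars false
namespace LagrangianCycles

section Affine
variable {F : Type*} [NormedAddCommGroup F] [NormedSpace ℝ F]
variable {F' : Type*} [NormedAddCommGroup F'] [NormedSpace ℝ F']
variable {N : Type*} [TopologicalSpace N]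

/-- The linear combination of the points of a tuple. -/
def comb {n : ℕ} (v : Tup F n) : (Fin (n + 1) → ℝ) →ₗ[ℝ] F := Fintype.linearCombination ℝ v

theorem comb_apply {n : ℕ} (v : Tup F n) (x : Fin (n + 1) → ℝ) : comb v x = ∑ i, x i • v i :=
  Fintype.linearCombination_apply ℝ v x

theorem continuous_comb {n : ℕ} (v : Tup F n) : Continuous (comb v) :=
  LinearMap.continuous_of_finiteDimensional _

theorem comb_mem {K : Set F} (hK : Convex ℝ K) {n : ℕ} {v : Tup F n} (hv : v ∈ tupIn K n)
    {x : Fin (n + 1) → ℝ} (hx : x ∈ stdSimplex ℝ (Fin (n + 1))) : comb v x ∈ K := by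
  rw [comb_apply]
  exact hK.sum_mem (fun i _ => hx.1 i) hx.2 fun i _ => hv i

theorem comb_funOnFinite {m n : ℕ} (f : Fin (m + 1) → Fin (n + 1)) (v : Tup F n)
    (y : Fin (m + 1) → ℝ) : comb v (FunOnFinite.linearMap ℝ ℝ f y) = comb (v ∘ f) y := by
  classical
  simp only [comb_apply, FunOnFinite.linearMap_apply_apply, Finset.sum_smul]
  rw [← Finset.sum_fiberwise (s := Finset.univ) (g := f) (f := fun j => y j • (v ∘ f) j)]
  refine Finset.sum_congr rfl fun i _ => Finset.sum_congr (by ext; simp) fun j hj => ?_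
  rw [Function.comp_apply, (Finset.mem_filter.1 hj).2]

theorem map_comp_comb {n : ℕ} (ℓ : F →ₗ[ℝ] F') (v : Tup F n) (x : Fin (n + 1) → ℝ) :
    comb (ℓ ∘ v) x = ℓ (comb v x) := by
  simp [comb_apply, map_sum]

open Classical in
/-- The singular simplex obtained by restricting a map to the affine simplex spanned by a tuple. -/
def affSimplex (G : F → N) {n : ℕ} (v : Tup F n) : Simp N n :=
  if h : Continuous fun x : stdSimplex ℝ (Fin (n + 1)) => G (comb v x) then ⟨_, h⟩
  -- A default value: in every use the points of `v` lie in a convex set on which `G` is continuous,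
  -- where the first branch applies.
  else ContinuousMap.const _ (G (v 0))

variable {K : Set F} {G : F → N}

theorem affSimplex_apply (hG : ContinuousOn G K) (hK : Convex ℝ K) {n : ℕ} {v : Tup F n}
    (hv : v ∈ tupIn K n) (x : stdSimplex ℝ (Fin (n + 1))) : affSimplex G v x = G (comb v x) := by
  have h : Continuous fun x : stdSimplex ℝ (Fin (n + 1)) => G (comb v x) :=
    hG.comp_continuous ((continuous_comb v).comp continuous_subtype_val)
      fun x => comb_mem hK hv x.2
  rw [affSimplex, dif_pos h]
  rfl

theorem affSimplex_face (hG : ContinuousOn G K) (hK : Convex ℝ K) {n : ℕ} {v : Tup F (n + 1)}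
    (hv : v ∈ tupIn K (n + 1)) (i : Fin (n + 2)) :
    (affSimplex G v).face i = affSimplex G (v ∘ i.succAbove) := by
  ext x
  rw [affSimplex_apply (v := v ∘ i.succAbove) hG hK (fun j => hv _)]
  change affSimplex G v (stdSimplex.map i.succAbove x) = _
  rw [affSimplex_apply hG hK hv, stdSimplex.map_coe, comb_funOnFinite]

theorem affSimplex_congr {G' : F → N} (hG : ContinuousOn G K) (hK : Convex ℝ K)
    (h : Set.EqOn G G' K) {n : ℕ} {v : Tup F n} (hv : v ∈ tupIn K n) :
    affSimplex G v = affSimplex G' v := by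
  ext x
  rw [affSimplex_apply hG hK hv, affSimplex_apply (hG.congr h.symm) hK hv]
  exact h (comb_mem hK hv x.2)

theorem affSimplex_comp (ℓ : F' →ₗ[ℝ] F) {n : ℕ} (v : Tup F' n) :
    affSimplex G (ℓ ∘ v) = affSimplex (G ∘ ℓ) v := by
  have : (fun x : stdSimplex ℝ (Fin (n + 1)) => G (comb (ℓ ∘ v) x)) =
      fun x : stdSimplex ℝ (Fin (n + 1)) => (G ∘ ℓ) (comb v x) := by
    funext x
    rw [map_comp_comb]
    rfl
  by_cases h : Continuous fun x : stdSimplex ℝ (Fin (n + 1)) => (G ∘ ℓ) (comb v x)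
  · rw [affSimplex, affSimplex, dif_pos h, dif_pos (this ▸ h)]
    ext x
    exact congrFun this x
  · rw [affSimplex, affSimplex, dif_neg h, dif_neg (this ▸ h)]
    rfl

/-- The singular chain obtained by applying a map to a chain of affine simplices. -/
def push (G : F → N) {n : ℕ} : (Tup F n →₀ ℤ) →+ (Simp N n →₀ ℤ) :=
  Finsupp.mapDomain.addMonoidHom (affSimplex G)

@[simp] theorem push_single {n : ℕ} (v : Tup F n) (k : ℤ) :
    push G (Finsupp.single v k) = Finsupp.single (affSimplex G v) k := by
  simp [push, Finsupp.mapDomain_single]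

theorem bd_push (hG : ContinuousOn G K) (hK : Convex ℝ K) {n : ℕ} {c : Tup F (n + 1) →₀ ℤ}
    (hc : c ∈ chainsIn (tupIn K (n + 1))) : bd n (push G c) = push G (tbd n c) := by
  refine eqOn_chainsIn (f := (bd n).comp (push G)) (g := (push G).comp (tbd n)) (fun v hv => ?_) hc
  simp [bd_single, tbd_single, map_sum, affSimplex_face hG hK hv]

theorem push_congr {G' : F → N} (hG : ContinuousOn G K) (hK : Convex ℝ K)
    (h : Set.EqOn G G' K) {n : ℕ} {c : Tup F n →₀ ℤ} (hc : c ∈ chainsIn (tupIn K n)) :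
    push G c = push G' c :=
  eqOn_chainsIn (fun v hv => by simp [affSimplex_congr hG hK h hv]) hc

theorem push_tmap (ℓ : F' →ₗ[ℝ] F) {n : ℕ} (c : Tup F' n →₀ ℤ) :
    push G (tmap ℓ c) = push (G ∘ ℓ) c :=
  DFunLike.congr_fun (chain_hom_ext (f := (push G).comp (tmap ℓ)) (g := push (G ∘ ℓ))
    fun v => by simp [affSimplex_comp]) c

open Classical in
/-- A singular simplex as a map on the ambient vector space of the standard simplex. -/
def ambient {n : ℕ} (σ : Simp N n) (x : Fin (n + 1) → ℝ) : N :=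
  if h : x ∈ stdSimplex ℝ (Fin (n + 1)) then σ ⟨x, h⟩ else σ (stdSimplex.vertex 0)

theorem ambient_coe {n : ℕ} (σ : Simp N n) (x : stdSimplex ℝ (Fin (n + 1))) :
    ambient σ x = σ x := by
  exact dif_pos x.2

theorem ambient_of_mem {n : ℕ} (σ : Simp N n) {x : Fin (n + 1) → ℝ}
    (hx : x ∈ stdSimplex ℝ (Fin (n + 1))) : ambient σ x = σ ⟨x, hx⟩ :=
  ambient_coe σ ⟨x, hx⟩

theorem continuousOn_ambient {n : ℕ} (σ : Simp N n) :
    ContinuousOn (ambient σ) (stdSimplex ℝ (Fin (n + 1))) := by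
  rw [continuousOn_iff_continuous_domRestrict]
  convert σ.continuous using 1
  ext x
  exact ambient_coe σ x

/-- The vertices of the standard simplex. -/
def stdTup (n : ℕ) : Tup (Fin (n + 1) → ℝ) n := fun i => Pi.single i 1

theorem stdTup_mem (n : ℕ) : stdTup n ∈ tupIn (stdSimplex ℝ (Fin (n + 1))) n :=
  fun i => single_mem_stdSimplex ℝ i

theorem comb_stdTup {n : ℕ} (x : Fin (n + 1) → ℝ) : comb (stdTup n) x = x := by
  rw [comb_apply]
  funext j
  simp [stdTup, Finset.sum_apply, Pi.single_apply]

theorem affSimplex_ambient {n : ℕ} (σ : Simp N n) : affSimplex (ambient σ) (stdTup n) = σ := by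
  ext x
  rw [affSimplex_apply (continuousOn_ambient σ) (convex_stdSimplex ℝ _) (stdTup_mem n),
    comb_stdTup, ambient_coe]

theorem ambient_face {n : ℕ} (σ : Simp N (n + 1)) (i : Fin (n + 2)) :
    Set.EqOn (ambient (σ.face i)) (ambient σ ∘ FunOnFinite.linearMap ℝ ℝ i.succAbove)
      (stdSimplex ℝ (Fin (n + 1))) := by
  intro x hx
  rw [ambient_of_mem _ hx]
  exact (ambient_coe σ (stdSimplex.map i.succAbove ⟨x, hx⟩)).symm

theorem stdTup_comp {n : ℕ} (i : Fin (n + 2)) : stdTup (n + 1) ∘ i.succAbove =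
    FunOnFinite.linearMap ℝ ℝ i.succAbove ∘ stdTup n := by
  funext j
  simp [stdTup, FunOnFinite.linearMap_piSingle]

theorem push_ambient_face {n m : ℕ} (σ : Simp N (n + 1)) (i : Fin (n + 2))
    {c : Tup (Fin (n + 1) → ℝ) m →₀ ℤ} (hc : c ∈ chainsIn (tupIn (stdSimplex ℝ (Fin (n + 1))) m)) :
    push (ambient σ) (tmap (FunOnFinite.linearMap ℝ ℝ i.succAbove) c) =
      push (ambient (σ.face i)) c := by
  rw [push_tmap, push_congr (continuousOn_ambient _) (convex_stdSimplex ℝ _) (ambient_face σ i) hc]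

/-- The natural operation on singular chains given by a family of chains in standard simplices. -/
def natOp {m : ℕ} {n : ℕ} (z : Tup (Fin (n + 1) → ℝ) m →₀ ℤ) :
    (Simp N n →₀ ℤ) →+ (Simp N m →₀ ℤ) :=
  extend fun σ => push (ambient σ) z

/-- The faces of the standard simplex are linear images of standard simplices, and the operators
commute with linear maps. An operator applied to `∂σ` can therefore be computed inside the standard
simplex of `σ`, so that identities for tuples pass to singular chains. -/
theorem natOp_bd {m n : ℕ} (f : (Tup (Fin (n + 1) → ℝ) n →₀ ℤ) →+ (Tup (Fin (n + 1) → ℝ) m →₀ ℤ))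
    (g : (Tup (Fin (n + 2) → ℝ) n →₀ ℤ) →+ (Tup (Fin (n + 2) → ℝ) m →₀ ℤ))
    (hfg : ∀ (ℓ : (Fin (n + 1) → ℝ) →ₗ[ℝ] (Fin (n + 2) → ℝ)) c, g (tmap ℓ c) = tmap ℓ (f c))
    (hf : f (Finsupp.single (stdTup n) 1) ∈ chainsIn (tupIn (stdSimplex ℝ (Fin (n + 1))) m))
    (σ : Simp N (n + 1)) :
    natOp (f (Finsupp.single (stdTup n) 1)) (bd n (Finsupp.single σ 1)) =
      push (ambient σ) (g (tbd n (Finsupp.single (stdTup (n + 1)) 1))) := by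
  rw [bd_single, tbd_single]
  simp only [map_sum, map_zsmul]
  refine Finset.sum_congr rfl fun i _ => ?_
  rw [stdTup_comp, ← tmap_single, hfg, push_ambient_face σ i hf, natOp, extend_single, one_smul]

/-- Iterated barycentric subdivision of singular chains. -/
def subdiv (k n : ℕ) : (Simp N n →₀ ℤ) →+ (Simp N n →₀ ℤ) :=
  natOp (SdIter k n (Finsupp.single (stdTup n) 1))

/-- The chain homotopy between the identity and iterated barycentric subdivision. -/
def subdivT (k n : ℕ) : (Simp N n →₀ ℤ) →+ (Simp N (n + 1) →₀ ℤ) :=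
  natOp (SdTIter k n (Finsupp.single (stdTup n) 1))

theorem single_stdTup_mem (n : ℕ) : Finsupp.single (stdTup n) (1 : ℤ) ∈
    chainsIn (tupIn (stdSimplex ℝ (Fin (n + 1))) n) := single_mem_chainsIn (stdTup_mem n) 1

theorem bd_subdiv (k : ℕ) {n : ℕ} (c : Simp N (n + 1) →₀ ℤ) :
    bd n (subdiv k (n + 1) c) = subdiv k n (bd n c) := by
  refine DFunLike.congr_fun (chain_hom_ext (f := (bd n).comp (subdiv k (n + 1)))
    (g := (subdiv k n).comp (bd n)) fun σ => ?_) c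
  simp only [AddMonoidHom.comp_apply]
  rw [subdiv, subdiv, natOp_bd (SdIter k n) (SdIter k n) (fun ℓ c => SdIter_tmap k ℓ c)
    (SdIter_mem (convex_stdSimplex ℝ _) k (single_stdTup_mem n)), natOp, extend_single,
    one_smul, bd_push (continuousOn_ambient σ) (convex_stdSimplex ℝ _)
    (SdIter_mem (convex_stdSimplex ℝ _) k (single_stdTup_mem _)), tbd_SdIter]

theorem bd_subdivT (k : ℕ) {n : ℕ} (c : Simp N (n + 1) →₀ ℤ) :
    bd (n + 1) (subdivT k (n + 1) c) = c - subdiv k (n + 1) c - subdivT k n (bd n c) := by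
  refine DFunLike.congr_fun (chain_hom_ext (f := (bd (n + 1)).comp (subdivT k (n + 1)))
    (g := AddMonoidHom.id _ - subdiv k (n + 1) - (subdivT k n).comp (bd n)) fun σ => ?_) c
  simp only [AddMonoidHom.comp_apply, AddMonoidHom.sub_apply, AddMonoidHom.id_apply]
  rw [subdivT, subdivT, natOp_bd (SdTIter k n) (SdTIter k n) (fun ℓ c => SdTIter_tmap k ℓ c)
    (SdTIter_mem (convex_stdSimplex ℝ _) k (single_stdTup_mem n)), natOp, extend_single,
    one_smul, bd_push (continuousOn_ambient σ) (convex_stdSimplex ℝ _)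
    (SdTIter_mem (convex_stdSimplex ℝ _) k (single_stdTup_mem _)), tbd_SdTIter, map_sub, map_sub,
    push_single, affSimplex_ambient, subdiv, natOp, extend_single, one_smul]

theorem stdTup_mem_tupDiam (n : ℕ) : stdTup n ∈ tupDiam (Fin (n + 1) → ℝ) 1 n := by
  intro i j
  refine (dist_pi_le_iff zero_le_one).2 fun k => ?_
  rw [stdTup, stdTup, Real.dist_eq, Pi.single_apply, Pi.single_apply]
  split_ifs <;> simp

/-- A sufficiently fine subdivision of a simplex is subordinate to an open cover. -/
theorem exists_subdiv_single {ι : Type*} {n : ℕ} (σ : Simp N n) (U : ι → Set N)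
    (hU : ∀ i, IsOpen (U i)) (hσ : ∀ x, ∃ i, σ x ∈ U i) :
    ∃ k₀, ∀ k ≥ k₀, subdiv k n (Finsupp.single σ 1) ∈
      chainsIn {τ : Simp N n | Set.range τ ⊆ Set.range σ ∧ ∃ i, Set.range τ ⊆ U i} := by
  obtain ⟨δ, hδ, h⟩ := lebesgue_number_lemma_of_metric (isCompact_univ (X := stdSimplex ℝ (Fin (n + 1))))
    (c := fun i => σ ⁻¹' U i) (fun i => (hU i).preimage σ.continuous)
    fun x _ => Set.mem_iUnion.2 (hσ x)
  have hlt : (n : ℝ) / (n + 1) < 1 := by rw [div_lt_one (by positivity)]; linarith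
  obtain ⟨k₀, hk₀⟩ := exists_pow_lt_of_lt_one hδ hlt
  refine ⟨k₀, fun k hk => ?_⟩
  -- The vertices have mutual sup distance at most one, so after `k` subdivisions the mesh is at
  -- most this power, which lies below the Lebesgue number.
  have hk' : ((n : ℝ) / (n + 1)) ^ k < δ :=
    (pow_le_pow_of_le_one (by positivity) hlt.le hk).trans_lt hk₀
  rw [subdiv, natOp, extend_single, one_smul]
  have h1 := SdIter_mem_tupDiam (k := k) zero_le_one (single_mem_chainsIn (stdTup_mem_tupDiam n) 1)
  have h2 := SdIter_mem (convex_stdSimplex ℝ _) k (single_stdTup_mem n)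
  refine map_mem_of_chainsIn _ _ (s := tupDiam _ (((n : ℝ) / (n + 1)) ^ k * 1) n ∩
    tupIn (stdSimplex ℝ (Fin (n + 1))) n) (fun v hv => ?_) fun x hx => ⟨h1 x hx, h2 x hx⟩
  rw [push_single]
  refine single_mem_chainsIn ?_ 1
  have key := fun x => affSimplex_apply (continuousOn_ambient σ) (convex_stdSimplex ℝ _) hv.2 x
  refine ⟨?_, ?_⟩
  · rintro _ ⟨x, rfl⟩
    rw [key, ambient_of_mem σ (comb_mem (x := ⇑x) (convex_stdSimplex ℝ _) hv.2 x.2)]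
    exact Set.mem_range_self _
  · obtain ⟨i, hi⟩ := h ⟨v 0, hv.2 0⟩ trivial
    refine ⟨i, ?_⟩
    rintro _ ⟨x, rfl⟩
    have hx := comb_mem (x := ⇑x) (convex_stdSimplex ℝ _) hv.2 x.2
    rw [key, ambient_of_mem σ hx]
    refine hi ?_
    rw [Metric.mem_ball, Subtype.dist_eq]
    refine lt_of_le_of_lt ?_ hk'
    have : comb v x ∈ Metric.closedBall (v 0) (((n : ℝ) / (n + 1)) ^ k * 1) :=
      comb_mem (convex_closedBall _ _) (fun j => hv.1 j 0) x.2
    simpa using this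

theorem exists_subdiv {ι : Type*} {n : ℕ} (c : Simp N n →₀ ℤ) (U : ι → Set N)
    (hU : ∀ i, IsOpen (U i)) (hc : ∀ σ ∈ c.support, ∀ x, ∃ i, σ x ∈ U i) :
    ∃ k₀, ∀ k ≥ k₀, subdiv k n c ∈ chainsIn {τ : Simp N n | (∃ σ ∈ c.support, Set.range τ ⊆ Set.range σ) ∧
      ∃ i, Set.range τ ⊆ U i} := by
  choose! k₀ hk₀ using fun σ (hσ : σ ∈ c.support) => exists_subdiv_single σ U hU (hc σ hσ)
  refine ⟨c.support.sup k₀, fun k hk => ?_⟩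
  refine map_mem_of_chainsIn _ _ (s := {σ | σ ∈ c.support}) (fun σ hσ => ?_) (fun x hx => hx)
  refine chainsIn_mono ?_ (hk₀ σ hσ k ((Finset.le_sup hσ).trans hk))
  exact fun τ hτ => ⟨⟨σ, hσ, hτ.1⟩, hτ.2⟩

end Affine

/-! ### Cones on singular simplices in a chart onto a ball -/

section Cone
variable {N : Type*} [TopologicalSpace N]
variable {E : Type*} [NormedAddCommGroup E] [NormedSpace ℝ E]

/-- The simplices with image in a set. -/
def simpIn (S : Set N) (n : ℕ) : Set (Simp N n) := {σ | Set.range σ ⊆ S}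

theorem face_mem_simpIn {S : Set N} {n : ℕ} {σ : Simp N (n + 1)} (hσ : σ ∈ simpIn S (n + 1))
    (i : Fin (n + 2)) : σ.face i ∈ simpIn S n := by
  rintro _ ⟨x, rfl⟩
  exact hσ ⟨_, rfl⟩

theorem bd_mem {S : Set N} {n : ℕ} {c : Simp N (n + 1) →₀ ℤ} (hc : c ∈ chainsIn (simpIn S (n + 1))) :
    bd n c ∈ chainsIn (simpIn S n) :=
  altSum_mem _ (fun _ hσ i => face_mem_simpIn hσ i) hc

/-- The cone with apex the origin on a singular simplex in a chart, in the model space. -/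
def coneFun (D : OpenPartialHomeomorph N E) {n : ℕ} (σ : Simp N n) (x : Fin (n + 2) → ℝ) : E :=
  (1 - x 0) • D (ambient σ ((1 - x 0)⁻¹ • Fin.tail x))

variable {D : OpenPartialHomeomorph N E} {r : ℝ}

theorem tail_mem {n : ℕ} {x : Fin (n + 2) → ℝ} (hx : x ∈ stdSimplex ℝ (Fin (n + 2)))
    (h : x 0 ≠ 1) : (1 - x 0)⁻¹ • Fin.tail x ∈ stdSimplex ℝ (Fin (n + 1)) := by
  have h0 : 0 ≤ 1 - x 0 := by
    have := (mem_Icc_of_mem_stdSimplex hx 0).2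
    linarith
  refine ⟨fun i => mul_nonneg (inv_nonneg.2 h0) (hx.1 _), ?_⟩
  have h1 := hx.2
  rw [Fin.sum_univ_succ] at h1
  simp only [Pi.smul_apply, smul_eq_mul, ← Finset.mul_sum]
  have : ∑ i : Fin (n + 1), Fin.tail x i = 1 - x 0 := by
    simp only [Fin.tail]
    linarith
  rw [this]
  exact inv_mul_cancel₀ (sub_ne_zero.2 (Ne.symm h))

/-- The factor `1 - x 0` damps a point of the ball. The first bound gives continuity at the apex,
where the base point of the cone has no meaning; the second keeps the cone inside the chart. -/
theorem coneFun_norm (hD : D.target = Metric.ball 0 r) {n : ℕ} {σ : Simp N n}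
    (hσ : σ ∈ simpIn D.source n) {x : Fin (n + 2) → ℝ} (hx : x ∈ stdSimplex ℝ (Fin (n + 2))) :
    ‖coneFun D σ x‖ ≤ (1 - x 0) * r ∧ coneFun D σ x ∈ Metric.ball (0 : E) r := by
  have h01 := mem_Icc_of_mem_stdSimplex hx 0
  have hr : 0 < r := by
    have h1 := D.map_source (hσ ⟨stdSimplex.vertex 0, rfl⟩)
    rw [hD] at h1
    exact Metric.pos_of_mem_ball h1
  by_cases h : x 0 = 1
  · simp [coneFun, h, hr]
  · have h1 : D (ambient σ ((1 - x 0)⁻¹ • Fin.tail x)) ∈ Metric.ball (0 : E) r := by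
      rw [← hD, ambient_of_mem _ (tail_mem hx h)]
      exact D.map_source (hσ ⟨_, rfl⟩)
    rw [mem_ball_zero_iff] at h1
    have h2 : ‖coneFun D σ x‖ = (1 - x 0) * ‖D (ambient σ ((1 - x 0)⁻¹ • Fin.tail x))‖ := by
      rw [coneFun, norm_smul, Real.norm_of_nonneg (by linarith [h01.2])]
    rw [mem_ball_zero_iff, h2]
    refine ⟨mul_le_mul_of_nonneg_left h1.le (by linarith [h01.2]), ?_⟩
    nlinarith [h01.1, h01.2, norm_nonneg (D (ambient σ ((1 - x 0)⁻¹ • Fin.tail x)))]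

theorem continuous_coneFun (hD : D.target = Metric.ball 0 r) {n : ℕ} {σ : Simp N n}
    (hσ : σ ∈ simpIn D.source n) :
    Continuous fun x : stdSimplex ℝ (Fin (n + 2)) => coneFun D σ x := by
  rw [continuous_iff_continuousAt]
  intro x
  by_cases h : x 0 = 1
  · have h0 : coneFun D σ x = 0 := by simp [coneFun, h]
    rw [ContinuousAt, h0]
    have hc : Continuous fun y : stdSimplex ℝ (Fin (n + 2)) => (1 - y 0) * r := by
      refine (continuous_const.sub ?_).mul continuous_const
      exact (continuous_apply 0).comp continuous_subtype_val
    have hc' := hc.tendsto x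
    rw [h, sub_self, zero_mul] at hc'
    exact squeeze_zero_norm (fun y => (coneFun_norm hD hσ y.2).1) hc'
  · have hopen : {y : stdSimplex ℝ (Fin (n + 2)) | y 0 ≠ 1} ∈ nhds x := by
      refine IsOpen.mem_nhds ?_ h
      exact isOpen_ne_fun ((continuous_apply 0).comp continuous_subtype_val) continuous_const
    have hx0 : Continuous fun y : stdSimplex ℝ (Fin (n + 2)) => 1 - y 0 :=
      continuous_const.sub ((continuous_apply 0).comp continuous_subtype_val)
    have hcont : ContinuousOn (fun y : stdSimplex ℝ (Fin (n + 2)) => coneFun D σ y)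
        {y | y 0 ≠ 1} := by
      refine hx0.continuousOn.smul ?_
      have h1 : ContinuousOn (fun y : Fin (n + 1) → ℝ => D (ambient σ y))
          (stdSimplex ℝ (Fin (n + 1))) :=
        D.continuousOn.comp (continuousOn_ambient σ) fun y hy => by
          rw [ambient_of_mem _ hy]; exact hσ ⟨_, rfl⟩
      refine h1.comp (f := fun y : stdSimplex ℝ (Fin (n + 2)) => (1 - y 0)⁻¹ • Fin.tail ⇑y) ?_
        fun y hy => tail_mem y.2 hy
      refine (hx0.continuousOn.inv₀ fun y hy => sub_ne_zero.2 (Ne.symm hy)).smul ?_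
      refine Continuous.continuousOn (continuous_pi fun i => ?_)
      exact (continuous_apply i.succ).comp continuous_subtype_val
    exact hcont.continuousAt hopen

open Classical in
/-- The cone with apex the center of a chart on a singular simplex. -/
def coneSimp (D : OpenPartialHomeomorph N E) {n : ℕ} (σ : Simp N n) : Simp N (n + 1) :=
  if h : Continuous fun x : stdSimplex ℝ (Fin (n + 2)) => D.symm (coneFun D σ x) then ⟨_, h⟩
  else ContinuousMap.const _ (D.symm 0)

theorem coneSimp_apply (hD : D.target = Metric.ball 0 r) {n : ℕ} {σ : Simp N n}
    (hσ : σ ∈ simpIn D.source n) (x : stdSimplex ℝ (Fin (n + 2))) :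
    coneSimp D σ x = D.symm (coneFun D σ x) := by
  have h : Continuous fun x : stdSimplex ℝ (Fin (n + 2)) => D.symm (coneFun D σ x) :=
    D.continuousOn_symm.comp_continuous (continuous_coneFun hD hσ) fun x => by
      rw [hD]; exact (coneFun_norm hD hσ x.2).2
  rw [coneSimp, dif_pos h]
  rfl

theorem coneSimp_mem (hD : D.target = Metric.ball 0 r) {n : ℕ} {σ : Simp N n}
    (hσ : σ ∈ simpIn D.source n) : coneSimp D σ ∈ simpIn D.source (n + 1) := by
  rintro _ ⟨x, rfl⟩
  rw [coneSimp_apply hD hσ]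
  refine D.map_target ?_
  rw [hD]
  exact (coneFun_norm hD hσ x.2).2

theorem coneSimp_face_zero (hD : D.target = Metric.ball 0 r) {n : ℕ} {σ : Simp N n}
    (hσ : σ ∈ simpIn D.source n) : (coneSimp D σ).face 0 = σ := by
  ext y
  change coneSimp D σ (stdSimplex.map (Fin.succAbove 0) y) = _
  rw [coneSimp_apply hD hσ]
  have h0 : stdSimplex.map (Fin.succAbove 0) y 0 = 0 := by
    rw [stdSimplex.map_coe, FunOnFinite.linearMap_apply_apply]
    simp
  have h1 : Fin.tail ⇑(stdSimplex.map (Fin.succAbove 0) y) = ⇑y := by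
    funext i
    rw [Fin.tail, stdSimplex.map_coe, FunOnFinite.linearMap_apply_apply]
    simp [Finset.filter_eq']
  rw [coneFun, h0, h1]
  simp only [sub_zero, inv_one, one_smul]
  rw [ambient_coe, D.left_inv (hσ ⟨y, rfl⟩)]

theorem coneSimp_face_succ (hD : D.target = Metric.ball 0 r) {n : ℕ} {σ : Simp N (n + 1)}
    (hσ : σ ∈ simpIn D.source (n + 1)) (i : Fin (n + 2)) :
    (coneSimp D σ).face i.succ = coneSimp D (σ.face i) := by
  ext y
  change coneSimp D σ (stdSimplex.map i.succ.succAbove y) = _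
  rw [coneSimp_apply hD hσ, coneSimp_apply hD (face_mem_simpIn hσ i)]
  congr 1
  have h0 : stdSimplex.map i.succ.succAbove y 0 = y 0 := by
    rw [stdSimplex.map_coe, FunOnFinite.linearMap_apply_apply]
    rw [Finset.sum_eq_single 0]
    · intro j hj hj0
      obtain ⟨j, rfl⟩ := Fin.exists_succ_eq.2 hj0
      simp at hj
    · simp
  have h1 : Fin.tail ⇑(stdSimplex.map i.succ.succAbove y) =
      FunOnFinite.linearMap ℝ ℝ i.succAbove (Fin.tail ⇑y) := by
    funext k
    rw [Fin.tail, stdSimplex.map_coe, FunOnFinite.linearMap_apply_apply,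
      FunOnFinite.linearMap_apply_apply, Finset.sum_filter, Finset.sum_filter, Fin.sum_univ_succ]
    simp [Fin.tail, Fin.succ_succAbove_succ, (Fin.succ_ne_zero k).symm]
  rw [coneFun, coneFun, h0, h1]
  by_cases h : y 0 = 1
  · simp [h]
  · rw [← map_smul, ambient_face σ i (tail_mem (x := ⇑y) y.2 h)]
    rfl

/-- The cone operator on singular chains in a chart. -/
def coneChain (D : OpenPartialHomeomorph N E) {n : ℕ} :
    (Simp N n →₀ ℤ) →+ (Simp N (n + 1) →₀ ℤ) :=
  Finsupp.mapDomain.addMonoidHom (coneSimp D)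

theorem coneChain_mem (hD : D.target = Metric.ball 0 r) {n : ℕ} {c : Simp N n →₀ ℤ}
    (hc : c ∈ chainsIn (simpIn D.source n)) :
    coneChain D c ∈ chainsIn (simpIn D.source (n + 1)) := by
  refine map_mem_of_chainsIn _ _ (fun σ hσ => ?_) hc
  simp only [coneChain, Finsupp.mapDomain.addMonoidHom_apply, Finsupp.mapDomain_single]
  exact single_mem_chainsIn (coneSimp_mem hD hσ) 1

theorem bd_coneChain (hD : D.target = Metric.ball 0 r) {n : ℕ} {c : Simp N (n + 1) →₀ ℤ}
    (hc : c ∈ chainsIn (simpIn D.source (n + 1))) :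
    bd (n + 1) (coneChain D c) = c - coneChain D (bd n c) := by
  refine eqOn_chainsIn (f := (bd (n + 1)).comp (coneChain D))
    (g := AddMonoidHom.id _ - (coneChain D).comp (bd n)) (fun σ hσ => ?_) hc
  simp only [AddMonoidHom.comp_apply, AddMonoidHom.sub_apply, AddMonoidHom.id_apply, bd_single,
    map_sum, map_zsmul]
  simp only [coneChain, Finsupp.mapDomain.addMonoidHom_apply, Finsupp.mapDomain_single, bd_single]
  rw [Fin.sum_univ_succ, sub_eq_add_neg, ← Finset.sum_neg_distrib, coneSimp_face_zero hD hσ]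
  congr 1
  · simp
  · refine Finset.sum_congr rfl fun i _ => ?_
    rw [coneSimp_face_succ hD hσ, Fin.val_succ, pow_succ]
    simp

/-- Cycles of positive degree in a chart ball are boundaries. -/
theorem exists_bd_eq (hD : D.target = Metric.ball 0 r) {n : ℕ} {c : Simp N (n + 1) →₀ ℤ}
    (hc : c ∈ chainsIn (simpIn D.source (n + 1))) (h : bd n c = 0) :
    ∃ b ∈ chainsIn (simpIn D.source (n + 2)), bd (n + 1) b = c :=
  ⟨coneChain D c, coneChain_mem hD hc, by rw [bd_coneChain hD hc, h, map_zero, sub_zero]⟩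

end Cone

end LagrangianCycles

end

/-! ### Green's formula for `C^1` functions -/

noncomputable section

set_option linter.unusedSectionVars false
namespace LagrangianCycles

section Green
open MeasureTheory intervalIntegral Set

/-- Green's formula on the unit square with the second function replaced by an average, for
functions which are merely continuously differentiable. -/
theorem green_square_average {a ax ay b bx byy : ℝ → ℝ → ℝ}
    (ha : Continuous (Function.uncurry a)) (hax : Continuous (Function.uncurry ax))
    (hay : Continuous (Function.uncurry ay)) (hb : Continuous (Function.uncurry b))
    (hbx : Continuous (Function.uncurry bx)) (hby : Continuous (Function.uncurry byy))
    (dax : ∀ x ∈ Ioo (0 : ℝ) 1, ∀ y ∈ Icc (0 : ℝ) 1, HasDerivAt (fun s => a s y) (ax x y) x)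
    (day : ∀ x ∈ Icc (0 : ℝ) 1, ∀ y ∈ Ioo (0 : ℝ) 1, HasDerivAt (fun s => a x s) (ay x y) y)
    (dbx : ∀ x ∈ Ioo (0 : ℝ) 1, ∀ y ∈ Icc (0 : ℝ) 1, HasDerivAt (fun s => b s y) (bx x y) x)
    (dby : ∀ x ∈ Icc (0 : ℝ) 1, ∀ y ∈ Ioo (0 : ℝ) 1, HasDerivAt (fun s => b x s) (byy x y) y)
    {h : ℝ} (hh : h ∈ Ioo (0 : ℝ) 1) :
    ∫ y in (0 : ℝ)..1, ∫ x in (0 : ℝ)..1,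
        (ax x y * (∫ t in (0 : ℝ)..1, byy ((1 - h) * x + h * t) y) -
          ay x y * ((1 - h) * ∫ t in (0 : ℝ)..1, bx ((1 - h) * x + h * t) y)) =
      (∫ y in (0 : ℝ)..1, (a 1 y * (∫ t in (0 : ℝ)..1, byy ((1 - h) * 1 + h * t) y) -
          a 0 y * (∫ t in (0 : ℝ)..1, byy ((1 - h) * 0 + h * t) y))) -
      ∫ x in (0 : ℝ)..1, (a x 1 * ((1 - h) * ∫ t in (0 : ℝ)..1, bx ((1 - h) * x + h * t) 1) -
          a x 0 * ((1 - h) * ∫ t in (0 : ℝ)..1, bx ((1 - h) * x + h * t) 0)) := by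
  obtain ⟨h0, h1⟩ := hh
  have ha' : Continuous fun p : ℝ × ℝ => a p.1 p.2 := ha
  have hax' : Continuous fun p : ℝ × ℝ => ax p.1 p.2 := hax
  have hay' : Continuous fun p : ℝ × ℝ => ay p.1 p.2 := hay
  have hb' : Continuous fun p : ℝ × ℝ => b p.1 p.2 := hb
  have hbx' : Continuous fun p : ℝ × ℝ => bx p.1 p.2 := hbx
  have hby' : Continuous fun p : ℝ × ℝ => byy p.1 p.2 := hby
  -- `B1` and `B2` are the partial derivatives of the average of `b` in the first variable over the
  -- window from `(1 - h) * x` to `(1 - h) * x + h`, which stays inside the unit interval. Averaging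
  -- gains one derivative in that variable, so the mixed derivative `C` exists and is continuous.
  set B1 : ℝ → ℝ → ℝ := fun x y => (1 - h) * ∫ t in (0 : ℝ)..1, bx ((1 - h) * x + h * t) y with hB1
  set B2 : ℝ → ℝ → ℝ := fun x y => ∫ t in (0 : ℝ)..1, byy ((1 - h) * x + h * t) y with hB2
  set C : ℝ → ℝ → ℝ := fun x y =>
    (1 - h) / h * (byy ((1 - h) * x + h) y - byy ((1 - h) * x) y) with hC
  have cB1 : Continuous fun p : ℝ × ℝ => B1 p.1 p.2 := by
    refine continuous_const.mul (continuous_parametric_intervalIntegral_of_continuous' ?_ _ _)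
    exact hbx'.comp (f := fun q : (ℝ × ℝ) × ℝ => ((1 - h) * q.1.1 + h * q.2, q.1.2)) (by fun_prop)
  have cB2 : Continuous fun p : ℝ × ℝ => B2 p.1 p.2 := by
    refine continuous_parametric_intervalIntegral_of_continuous' ?_ _ _
    exact hby'.comp (f := fun q : (ℝ × ℝ) × ℝ => ((1 - h) * q.1.1 + h * q.2, q.1.2)) (by fun_prop)
  have cC : Continuous fun p : ℝ × ℝ => C p.1 p.2 := by
    refine continuous_const.mul (Continuous.sub ?_ ?_)
    · exact hby'.comp (f := fun q : ℝ × ℝ => ((1 - h) * q.1 + h, q.2)) (by fun_prop)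
    · exact hby'.comp (f := fun q : ℝ × ℝ => ((1 - h) * q.1, q.2)) (by fun_prop)
  have slice1 : ∀ {g : ℝ → ℝ → ℝ}, (Continuous fun p : ℝ × ℝ => g p.1 p.2) → ∀ y,
      Continuous fun x => g x y := fun hg y => hg.comp (f := fun x : ℝ => (x, y)) (by fun_prop)
  have slice2 : ∀ {g : ℝ → ℝ → ℝ}, (Continuous fun p : ℝ × ℝ => g p.1 p.2) → ∀ x,
      Continuous fun y => g x y := fun hg x => hg.comp (f := fun y : ℝ => (x, y)) (by fun_prop)
  have dB2 : ∀ x y, HasDerivAt (fun s => B2 s y) (C x y) x := by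
    intro x y
    have hF : ∀ s, B2 s y = h⁻¹ * ((∫ t in (0 : ℝ)..((1 - h) * s + h), byy t y) -
        ∫ t in (0 : ℝ)..((1 - h) * s), byy t y) := by
      intro s
      have h3 := intervalIntegral.integral_comp_add_mul (a := 0) (b := 1) (fun t => byy t y) h0.ne'
        ((1 - h) * s)
      simp only [hB2]
      rw [h3, smul_eq_mul, mul_zero, add_zero, mul_one]
      congr 1
      rw [integral_interval_sub_left ((slice1 hby' y).intervalIntegrable _ _)
        ((slice1 hby' y).intervalIntegrable _ _)]
    have hd : ∀ c, HasDerivAt (fun s => ∫ t in (0 : ℝ)..((1 - h) * s + c), byy t y)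
        (byy ((1 - h) * x + c) y * (1 - h)) x := by
      intro c
      have h4 := integral_hasDerivAt_right ((slice1 hby' y).intervalIntegrable 0 ((1 - h) * x + c))
        ((slice1 hby' y).stronglyMeasurableAtFilter _ _) (slice1 hby' y).continuousAt
      have h5 : HasDerivAt (fun s : ℝ => (1 - h) * s + c) (1 - h) x := by
        simpa using ((hasDerivAt_id x).const_mul (1 - h)).add_const c
      exact h4.comp x h5
    have h6 := hd 0
    simp only [add_zero] at h6
    have h7 := ((hd h).sub h6).const_mul h⁻¹
    rw [funext hF]
    refine h7.congr_deriv ?_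
    simp only [hC]
    field_simp
  have hB1' : ∀ x ∈ Icc (0 : ℝ) 1, ∀ y ∈ Icc (0 : ℝ) 1, B1 x y =
      (1 - h) / h * (b ((1 - h) * x + h) y - b ((1 - h) * x) y) := by
    intro x hx y hy
    have h3 := intervalIntegral.integral_comp_add_mul (a := 0) (b := 1) (fun t => bx t y) h0.ne'
        ((1 - h) * x)
    simp only [hB1]
    rw [h3, smul_eq_mul, mul_zero, add_zero, mul_one]
    have h4 : (∫ t in ((1 - h) * x)..((1 - h) * x + h), bx t y) =
        b ((1 - h) * x + h) y - b ((1 - h) * x) y := by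
      refine integral_eq_sub_of_hasDerivAt_of_le (by linarith) (slice1 hb' y).continuousOn
        (fun s hs => dbx s ⟨?_, ?_⟩ y hy) ((slice1 hbx' y).intervalIntegrable _ _)
      · have := mul_nonneg (by linarith : 0 ≤ 1 - h) hx.1
        linarith [hs.1]
      · have := mul_le_mul_of_nonneg_left hx.2 (by linarith : 0 ≤ 1 - h)
        linarith [hs.2]
    rw [h4]
    field_simp
  have dB1 : ∀ x ∈ Icc (0 : ℝ) 1, ∀ y ∈ Ioo (0 : ℝ) 1, HasDerivAt (fun s => B1 x s) (C x y) y := by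
    intro x hx y hy
    have hx1 : (1 - h) * x + h ∈ Icc (0 : ℝ) 1 := by
      constructor <;> nlinarith [hx.1, hx.2]
    have hx2 : (1 - h) * x ∈ Icc (0 : ℝ) 1 := by
      constructor <;> nlinarith [hx.1, hx.2]
    refine (((dby _ hx1 y hy).sub (dby _ hx2 y hy)).const_mul ((1 - h) / h)).congr_of_eventuallyEq ?_
    filter_upwards [Icc_mem_nhds hy.1 hy.2] with s hs
    exact hB1' x hx s hs
  -- The derivatives of `a * B2` in the first and of `a * B1` in the second variable both contain `a
  -- * C`. This term cancels in the difference, which is the integrand of Green's formula.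
  have e1 : ∀ y ∈ Icc (0 : ℝ) 1, (∫ x in (0 : ℝ)..1, (ax x y * B2 x y + a x y * C x y)) =
      a 1 y * B2 1 y - a 0 y * B2 0 y := by
    intro y hy
    exact integral_eq_sub_of_hasDerivAt_of_le zero_le_one
      ((slice1 ha' y).mul (slice1 cB2 y)).continuousOn
      (fun x hx => (dax x hx y hy).mul (dB2 x y))
      ((((slice1 hax' y).mul (slice1 cB2 y)).add
        ((slice1 ha' y).mul (slice1 cC y))).intervalIntegrable _ _)
  have e2 : ∀ x ∈ Icc (0 : ℝ) 1, (∫ y in (0 : ℝ)..1, (ay x y * B1 x y + a x y * C x y)) =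
      a x 1 * B1 x 1 - a x 0 * B1 x 0 := by
    intro x hx
    exact integral_eq_sub_of_hasDerivAt_of_le zero_le_one
      ((slice2 ha' x).mul (slice2 cB1 x)).continuousOn
      (fun y hy => (day x hx y hy).mul (dB1 x hx y hy))
      ((((slice2 hay' x).mul (slice2 cB1 x)).add
        ((slice2 ha' x).mul (slice2 cC x))).intervalIntegrable _ _)
  have c1 : Continuous fun p : ℝ × ℝ => ax p.1 p.2 * B2 p.1 p.2 + a p.1 p.2 * C p.1 p.2 :=
    (hax'.mul cB2).add (ha'.mul cC)
  have c2 : Continuous fun p : ℝ × ℝ => ay p.1 p.2 * B1 p.1 p.2 + a p.1 p.2 * C p.1 p.2 :=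
    (hay'.mul cB1).add (ha'.mul cC)
  have swap : ∀ {g : ℝ → ℝ → ℝ}, (Continuous fun p : ℝ × ℝ => g p.1 p.2) →
      ∫ x in (0 : ℝ)..1, ∫ y in (0 : ℝ)..1, g x y = ∫ y in (0 : ℝ)..1, ∫ x in (0 : ℝ)..1, g x y := by
    intro g hg
    simp only [integral_of_le (zero_le_one' ℝ)]
    refine integral_integral_swap ?_
    rw [Measure.prod_restrict]
    exact (hg.continuousOn.integrableOn_compact (isCompact_Icc.prod isCompact_Icc)).mono_set
      (prod_mono Ioc_subset_Icc_self Ioc_subset_Icc_self)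
  have inner : ∀ {g : ℝ → ℝ → ℝ}, (Continuous fun p : ℝ × ℝ => g p.1 p.2) →
      Continuous fun y => ∫ x in (0 : ℝ)..1, g x y := by
    intro g hg
    exact continuous_parametric_intervalIntegral_of_continuous' (f := fun y x => g x y)
      (hg.comp continuous_swap) _ _
  have E1 : (∫ y in (0 : ℝ)..1, (a 1 y * B2 1 y - a 0 y * B2 0 y)) =
      ∫ y in (0 : ℝ)..1, ∫ x in (0 : ℝ)..1, (ax x y * B2 x y + a x y * C x y) := by
    refine integral_congr fun y hy => ?_
    rw [uIcc_of_le zero_le_one] at hy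
    exact (e1 y hy).symm
  have E2 : (∫ x in (0 : ℝ)..1, (a x 1 * B1 x 1 - a x 0 * B1 x 0)) =
      ∫ y in (0 : ℝ)..1, ∫ x in (0 : ℝ)..1, (ay x y * B1 x y + a x y * C x y) := by
    rw [← swap c2]
    refine integral_congr fun x hx => ?_
    rw [uIcc_of_le zero_le_one] at hx
    exact (e2 x hx).symm
  change (∫ y in (0 : ℝ)..1, ∫ x in (0 : ℝ)..1, (ax x y * B2 x y - ay x y * B1 x y)) =
    (∫ y in (0 : ℝ)..1, (a 1 y * B2 1 y - a 0 y * B2 0 y)) -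
      ∫ x in (0 : ℝ)..1, (a x 1 * B1 x 1 - a x 0 * B1 x 0)
  rw [E1, E2, ← integral_sub ((inner c1).intervalIntegrable _ _) ((inner c2).intervalIntegrable _ _)]
  refine integral_congr fun y _ => ?_
  refine Eq.trans ?_ (integral_sub
    ((slice1 (g := fun x y => ax x y * B2 x y + a x y * C x y) c1 y).intervalIntegrable _ _)
    ((slice1 (g := fun x y => ay x y * B1 x y + a x y * C x y) c2 y).intervalIntegrable _ _))
  refine integral_congr fun x _ => ?_
  ring

/-- Green's formula on the unit square for functions which are merely continuously
differentiable. -/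
theorem green_square {a ax ay b bx byy : ℝ → ℝ → ℝ}
    (ha : Continuous (Function.uncurry a)) (hax : Continuous (Function.uncurry ax))
    (hay : Continuous (Function.uncurry ay)) (hb : Continuous (Function.uncurry b))
    (hbx : Continuous (Function.uncurry bx)) (hby : Continuous (Function.uncurry byy))
    (dax : ∀ x ∈ Ioo (0 : ℝ) 1, ∀ y ∈ Icc (0 : ℝ) 1, HasDerivAt (fun s => a s y) (ax x y) x)
    (day : ∀ x ∈ Icc (0 : ℝ) 1, ∀ y ∈ Ioo (0 : ℝ) 1, HasDerivAt (fun s => a x s) (ay x y) y)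
    (dbx : ∀ x ∈ Ioo (0 : ℝ) 1, ∀ y ∈ Icc (0 : ℝ) 1, HasDerivAt (fun s => b s y) (bx x y) x)
    (dby : ∀ x ∈ Icc (0 : ℝ) 1, ∀ y ∈ Ioo (0 : ℝ) 1, HasDerivAt (fun s => b x s) (byy x y) y) :
    ∫ y in (0 : ℝ)..1, ∫ x in (0 : ℝ)..1, (ax x y * byy x y - ay x y * bx x y) =
      (∫ y in (0 : ℝ)..1, (a 1 y * byy 1 y - a 0 y * byy 0 y)) -
      ∫ x in (0 : ℝ)..1, (a x 1 * bx x 1 - a x 0 * bx x 0) := by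
  have ha' : Continuous fun p : ℝ × ℝ => a p.1 p.2 := ha
  have hax' : Continuous fun p : ℝ × ℝ => ax p.1 p.2 := hax
  have hay' : Continuous fun p : ℝ × ℝ => ay p.1 p.2 := hay
  have hbx' : Continuous fun p : ℝ × ℝ => bx p.1 p.2 := hbx
  have hby' : Continuous fun p : ℝ × ℝ => byy p.1 p.2 := hby
  set L : ℝ → ℝ := fun h => ∫ y in (0 : ℝ)..1, ∫ x in (0 : ℝ)..1,
        (ax x y * (∫ t in (0 : ℝ)..1, byy ((1 - h) * x + h * t) y) -
          ay x y * ((1 - h) * ∫ t in (0 : ℝ)..1, bx ((1 - h) * x + h * t) y)) with hL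
  set R : ℝ → ℝ := fun h =>
      (∫ y in (0 : ℝ)..1, (a 1 y * (∫ t in (0 : ℝ)..1, byy ((1 - h) * 1 + h * t) y) -
          a 0 y * (∫ t in (0 : ℝ)..1, byy ((1 - h) * 0 + h * t) y))) -
      ∫ x in (0 : ℝ)..1, (a x 1 * ((1 - h) * ∫ t in (0 : ℝ)..1, bx ((1 - h) * x + h * t) 1) -
          a x 0 * ((1 - h) * ∫ t in (0 : ℝ)..1, bx ((1 - h) * x + h * t) 0)) with hR
  have cInt : ∀ {g : ℝ → ℝ → ℝ}, (Continuous fun p : ℝ × ℝ => g p.1 p.2) →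
      Continuous fun q : ℝ × ℝ × ℝ => ∫ t in (0 : ℝ)..1, g ((1 - q.1) * q.2.1 + q.1 * t) q.2.2 := by
    intro g hg
    refine continuous_parametric_intervalIntegral_of_continuous' ?_ _ _
    exact hg.comp (f := fun q : (ℝ × ℝ × ℝ) × ℝ => ((1 - q.1.1) * q.1.2.1 + q.1.1 * q.2, q.1.2.2))
      (by fun_prop)
  have cx := cInt hbx'
  have cy := cInt hby'
  have cL : Continuous L := by
    refine continuous_parametric_intervalIntegral_of_continuous' (f := fun h y => _) ?_ _ _
    refine continuous_parametric_intervalIntegral_of_continuous'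
      (f := fun (p : ℝ × ℝ) x => _) ?_ _ _
    refine Continuous.sub (Continuous.mul ?_ ?_) (Continuous.mul ?_ (Continuous.mul ?_ ?_))
    · exact hax'.comp (f := fun q : (ℝ × ℝ) × ℝ => (q.2, q.1.2)) (by fun_prop)
    · exact cy.comp (f := fun q : (ℝ × ℝ) × ℝ => (q.1.1, q.2, q.1.2)) (by fun_prop)
    · exact hay'.comp (f := fun q : (ℝ × ℝ) × ℝ => (q.2, q.1.2)) (by fun_prop)
    · fun_prop
    · exact cx.comp (f := fun q : (ℝ × ℝ) × ℝ => (q.1.1, q.2, q.1.2)) (by fun_prop)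
  have cR : Continuous R := by
    refine Continuous.sub ?_ ?_
    · refine continuous_parametric_intervalIntegral_of_continuous' (f := fun h y => _) ?_ _ _
      refine Continuous.sub (Continuous.mul ?_ ?_) (Continuous.mul ?_ ?_)
      · exact ha'.comp (f := fun q : ℝ × ℝ => (1, q.2)) (by fun_prop)
      · exact cy.comp (f := fun q : ℝ × ℝ => (q.1, 1, q.2)) (by fun_prop)
      · exact ha'.comp (f := fun q : ℝ × ℝ => (0, q.2)) (by fun_prop)
      · exact cy.comp (f := fun q : ℝ × ℝ => (q.1, 0, q.2)) (by fun_prop)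
    · refine continuous_parametric_intervalIntegral_of_continuous' (f := fun h x => _) ?_ _ _
      refine Continuous.sub (Continuous.mul ?_ (Continuous.mul (by fun_prop) ?_))
        (Continuous.mul ?_ (Continuous.mul (by fun_prop) ?_))
      · exact ha'.comp (f := fun q : ℝ × ℝ => (q.2, 1)) (by fun_prop)
      · exact cx.comp (f := fun q : ℝ × ℝ => (q.1, q.2, 1)) (by fun_prop)
      · exact ha'.comp (f := fun q : ℝ × ℝ => (q.2, 0)) (by fun_prop)
      · exact cx.comp (f := fun q : ℝ × ℝ => (q.1, q.2, 0)) (by fun_prop)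
  -- Both sides of the averaged formula are continuous in `h`, and at `h = 0` they are the sides of
  -- the formula for `b` itself.
  have key : L 0 = R 0 := by
    have h1 : Filter.Tendsto L (nhdsWithin 0 (Ioo 0 1)) (nhds (L 0)) :=
      cL.continuousAt.tendsto.mono_left nhdsWithin_le_nhds
    have h2 : Filter.Tendsto R (nhdsWithin 0 (Ioo 0 1)) (nhds (R 0)) :=
      cR.continuousAt.tendsto.mono_left nhdsWithin_le_nhds
    have : (nhdsWithin (0 : ℝ) (Ioo 0 1)).NeBot := left_nhdsWithin_Ioo_neBot zero_lt_one
    refine tendsto_nhds_unique (h1.congr' ?_) h2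
    filter_upwards [self_mem_nhdsWithin] with h hh
    exact green_square_average ha hax hay hb hbx hby dax day dbx dby hh
  simpa [hL, hR] using key

/-- A continuous map of the plane onto the triangle, restricting to a parametrization by the unit
square. -/
def squash (x y : ℝ) : ℝ × ℝ := (max 0 (min x 1), max 0 (min y 1) * (1 - max 0 (min x 1)))

theorem continuous_squash : Continuous (Function.uncurry squash) := by
  unfold squash Function.uncurry
  fun_prop

theorem squash_mem (x y : ℝ) : squash x y ∈ triangle := by
  have h1 : 0 ≤ max 0 (min x 1) := le_max_left _ _
  have h2 : max 0 (min x 1) ≤ 1 := max_le zero_le_one (min_le_right _ _)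
  have h3 : 0 ≤ max 0 (min y 1) := le_max_left _ _
  have h4 : max 0 (min y 1) ≤ 1 := max_le zero_le_one (min_le_right _ _)
  refine ⟨h1, mul_nonneg h3 (by linarith), ?_⟩
  have := mul_le_mul_of_nonneg_right h4 (by linarith : 0 ≤ 1 - max 0 (min x 1))
  simp only [squash]
  linarith

theorem squash_of_mem {x y : ℝ} (hx : x ∈ Icc (0 : ℝ) 1) (hy : y ∈ Icc (0 : ℝ) 1) :
    squash x y = (x, y * (1 - x)) := by
  simp [squash, hx.1, hx.2, hy.1, hy.2]

theorem convex_triangle : Convex ℝ triangle := by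
  rintro p ⟨h1, h2, h3⟩ q ⟨h4, h5, h6⟩ s t hs ht hst
  refine ⟨?_, ?_, ?_⟩
  · simp only [Prod.fst_add, Prod.smul_fst, smul_eq_mul]; positivity
  · simp only [Prod.snd_add, Prod.smul_snd, smul_eq_mul]; positivity
  · simp only [Prod.fst_add, Prod.smul_fst, smul_eq_mul, Prod.snd_add, Prod.smul_snd]
    nlinarith

theorem isCompact_triangle : IsCompact triangle := by
  have : triangle = Function.uncurry squash '' (Icc 0 1 ×ˢ Icc 0 1) := by
    apply Subset.antisymm
    · rintro ⟨x, y⟩ ⟨h1, h2, h3⟩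
      simp only at h1 h2 h3
      by_cases hx : x = 1
      · refine ⟨(1, 0), ⟨by simp, by simp⟩, ?_⟩
        simp only [Function.uncurry]
        rw [squash_of_mem (by simp) (by simp), Prod.mk.injEq]
        exact ⟨hx.symm, by linarith⟩
      · have h4 : 0 < 1 - x := lt_of_le_of_ne (by linarith) fun h => hx (by linarith)
        have h5 : y / (1 - x) ∈ Icc (0 : ℝ) 1 := ⟨div_nonneg h2 h4.le,
          by rw [div_le_one h4]; linarith⟩
        refine ⟨(x, y / (1 - x)), ⟨⟨h1, by linarith⟩, h5⟩, ?_⟩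
        simp only [Function.uncurry]
        rw [squash_of_mem ⟨h1, by linarith⟩ h5, div_mul_cancel₀ _ h4.ne']
    · rintro _ ⟨p, -, rfl⟩
      exact squash_mem _ _
  rw [this]
  exact (isCompact_Icc.prod isCompact_Icc).image continuous_squash

theorem uniqueDiffOn_triangle : UniqueDiffOn ℝ triangle := by
  refine uniqueDiffOn_convex convex_triangle ?_
  have h : IsOpen {p : ℝ × ℝ | 0 < p.1 ∧ 0 < p.2 ∧ p.1 + p.2 < 1} := by
    refine (isOpen_lt continuous_const continuous_fst).inter
      ((isOpen_lt continuous_const continuous_snd).inter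
      (isOpen_lt (continuous_fst.add continuous_snd) continuous_const))
  exact ⟨(1 / 4, 1 / 4), interior_maximal
    (fun (p : ℝ × ℝ) (hp : _ ∧ _ ∧ _) => ⟨hp.1.le, hp.2.1.le, hp.2.2.le⟩ :
      {p : ℝ × ℝ | 0 < p.1 ∧ 0 < p.2 ∧ p.1 + p.2 < 1} ⊆ triangle) h
    ⟨by norm_num, by norm_num, by norm_num⟩⟩

theorem continuous_comp_squash {X : Type*} [TopologicalSpace X] {g : ℝ × ℝ → X}
    (hg : ContinuousOn g triangle) : Continuous (Function.uncurry fun x y => g (squash x y)) :=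
  hg.comp_continuous continuous_squash fun _ => squash_mem _ _

/-- Fubini, followed by the substitution `y ↦ y * (1 - x)` on each vertical slice; the factor `1 -
x` is the Jacobian of `squash`. The clamping in `squash` makes the integrand continuous on the whole
plane. -/
theorem integral_triangle {g : ℝ × ℝ → ℝ} (hg : ContinuousOn g triangle) :
    ∫ p in triangle, g p =
      ∫ y in (0 : ℝ)..1, ∫ x in (0 : ℝ)..1, (1 - x) * g (squash x y) := by
  have hmeas : MeasurableSet triangle := isCompact_triangle.measurableSet
  have hc : Continuous fun p : ℝ × ℝ => (1 - p.1) * g (squash p.1 p.2) :=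
    (continuous_const.sub continuous_fst).mul (continuous_comp_squash hg)
  rw [← intervalIntegral_intervalIntegral_swap
    (F := fun x y => (1 - x) * g (squash x y)) (by
      simp only [uIoc_of_le (zero_le_one' ℝ)]
      exact (hc.continuousOn.integrableOn_compact (isCompact_Icc.prod isCompact_Icc)).mono_set
        (prod_mono Ioc_subset_Icc_self Ioc_subset_Icc_self))]
  rw [← MeasureTheory.integral_indicator hmeas, Measure.volume_eq_prod, integral_prod _
    (by rw [← Measure.volume_eq_prod]
        exact (integrable_indicator_iff hmeas).2
          (hg.integrableOn_compact isCompact_triangle))]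
  rw [integral_of_le zero_le_one, ← integral_Icc_eq_integral_Ioc,
    ← MeasureTheory.integral_indicator measurableSet_Icc]
  congr 1
  funext x
  by_cases hx : x ∈ Icc (0 : ℝ) 1
  · rw [indicator_of_mem hx]
    have h1 : (fun y => triangle.indicator g (x, y)) =
        (Icc (0 : ℝ) (1 - x)).indicator fun y => g (x, y) := by
      funext y
      by_cases hy : y ∈ Icc (0 : ℝ) (1 - x)
      · rw [indicator_of_mem hy, indicator_of_mem]
        exact ⟨hx.1, hy.1, by simp only; linarith [hy.2]⟩
      · rw [indicator_of_notMem hy, indicator_of_notMem]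
        rintro ⟨-, h2, h3⟩
        simp only at h2 h3
        exact hy ⟨h2, by linarith⟩
    rw [h1, MeasureTheory.integral_indicator measurableSet_Icc, integral_Icc_eq_integral_Ioc,
      ← integral_of_le (by linarith [hx.2]), intervalIntegral.integral_const_mul]
    have h2 := intervalIntegral.mul_integral_comp_mul_right (a := 0) (b := 1) (c := 1 - x)
      (f := fun y => g (x, y))
    rw [zero_mul, one_mul] at h2
    rw [← h2]
    congr 1
    refine integral_congr fun y hy => ?_
    rw [uIcc_of_le zero_le_one] at hy
    rw [squash_of_mem hx hy]
  · rw [indicator_of_notMem hx]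
    have h1 : (fun y => triangle.indicator g (x, y)) = fun _ => 0 := by
      funext y
      rw [indicator_of_notMem]
      rintro ⟨h1, h2, h3⟩
      simp only at h1 h2 h3
      exact hx ⟨h1, by linarith⟩
    rw [h1, MeasureTheory.integral_zero]

theorem hasDerivAt_squash_left {a : ℝ × ℝ → ℝ} (ha : DifferentiableOn ℝ a triangle)
    {x y : ℝ} (hx : x ∈ Ioo (0 : ℝ) 1) (hy : y ∈ Icc (0 : ℝ) 1) :
    HasDerivAt (fun s => a (squash s y)) (fderivWithin ℝ a triangle (squash x y) (1, -y)) x := by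
  have hx' := Ioo_subset_Icc_self hx
  have h1 : HasDerivWithinAt (fun s => squash s y) (1, -y) (Icc 0 1) x := by
    have : HasDerivAt (fun s : ℝ => ((s, y * (1 - s)) : ℝ × ℝ)) (1, -y) x := by
      have h2 : HasDerivAt (fun s : ℝ => y * (1 - s)) (-y) x := by
        simpa using ((hasDerivAt_id x).const_sub 1).const_mul y
      exact (hasDerivAt_id x).prodMk h2
    exact this.hasDerivWithinAt.congr (fun s hs => squash_of_mem hs hy) (squash_of_mem hx' hy)
  have h2 := (ha _ (squash_mem x y)).hasFDerivWithinAt.comp_hasDerivWithinAt x h1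
    fun s _ => squash_mem s y
  exact h2.hasDerivAt (Icc_mem_nhds hx.1 hx.2)

theorem hasDerivAt_squash_right {a : ℝ × ℝ → ℝ} (ha : DifferentiableOn ℝ a triangle)
    {x y : ℝ} (hx : x ∈ Icc (0 : ℝ) 1) (hy : y ∈ Ioo (0 : ℝ) 1) :
    HasDerivAt (fun s => a (squash x s)) (fderivWithin ℝ a triangle (squash x y) (0, 1 - x)) y := by
  have hy' := Ioo_subset_Icc_self hy
  have h1 : HasDerivWithinAt (fun s => squash x s) (0, 1 - x) (Icc 0 1) y := by
    have : HasDerivAt (fun s : ℝ => ((x, s * (1 - x)) : ℝ × ℝ)) (0, 1 - x) y := by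
      have h2 : HasDerivAt (fun s : ℝ => s * (1 - x)) (1 - x) y := by
        simpa using (hasDerivAt_id y).mul_const (1 - x)
      exact (hasDerivAt_const y x).prodMk h2
    exact this.hasDerivWithinAt.congr (fun s hs => squash_of_mem hx hs) (squash_of_mem hx hy')
  have h2 := (ha _ (squash_mem x y)).hasFDerivWithinAt.comp_hasDerivWithinAt y h1
    fun s _ => squash_mem x s
  exact h2.hasDerivAt (Icc_mem_nhds hy.1 hy.2)

theorem continuousOn_fderivWithin_triangle {a : ℝ × ℝ → ℝ} (ha : ContDiffOn ℝ 1 a triangle) :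
    ContinuousOn (fderivWithin ℝ a triangle) triangle :=
  ha.continuousOn_fderivWithin uniqueDiffOn_triangle le_rfl

/-- Green's formula on the triangle. -/
theorem green_triangle {a b : ℝ × ℝ → ℝ} (ha : ContDiffOn ℝ 1 a triangle)
    (hb : ContDiffOn ℝ 1 b triangle) :
    ∫ p in triangle, (fderivWithin ℝ a triangle p (1, 0) * fderivWithin ℝ b triangle p (0, 1) -
        fderivWithin ℝ a triangle p (0, 1) * fderivWithin ℝ b triangle p (1, 0)) =
      (∫ t in (0 : ℝ)..1, a (1 - t, t) * fderivWithin ℝ b triangle (1 - t, t) (-1, 1)) -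
      (∫ t in (0 : ℝ)..1, a (0, t) * fderivWithin ℝ b triangle (0, t) (0, 1)) +
      ∫ t in (0 : ℝ)..1, a (t, 0) * fderivWithin ℝ b triangle (t, 0) (1, 0) := by
  have cA := continuousOn_fderivWithin_triangle ha
  have cB := continuousOn_fderivWithin_triangle hb
  have dA := ha.differentiableOn one_ne_zero
  have dB := hb.differentiableOn one_ne_zero
  have c0 : ∀ {g : ℝ × ℝ → (ℝ × ℝ) →L[ℝ] ℝ}, ContinuousOn g triangle → ∀ v : ℝ × ℝ,
      ContinuousOn (fun p => g p v) triangle := fun hg v => hg.clm_apply continuousOn_const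
  rw [integral_triangle (g := fun p => fderivWithin ℝ a triangle p (1, 0) *
    fderivWithin ℝ b triangle p (0, 1) - fderivWithin ℝ a triangle p (0, 1) *
      fderivWithin ℝ b triangle p (1, 0))
    (((c0 cA _).mul (c0 cB _)).sub ((c0 cA _).mul (c0 cB _)))]
  have cs : ∀ {g : ℝ × ℝ → (ℝ × ℝ) →L[ℝ] ℝ}, ContinuousOn g triangle → ∀ {v : ℝ × ℝ → ℝ × ℝ},
      Continuous v → Continuous (Function.uncurry fun x y => g (squash x y) (v (x, y))) :=
    fun hg v hv => (continuous_comp_squash hg).clm_apply hv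
  have key := green_square (a := fun x y => a (squash x y)) (b := fun x y => b (squash x y))
    (ax := fun x y => fderivWithin ℝ a triangle (squash x y) (1, -y))
    (ay := fun x y => fderivWithin ℝ a triangle (squash x y) (0, 1 - x))
    (bx := fun x y => fderivWithin ℝ b triangle (squash x y) (1, -y))
    (byy := fun x y => fderivWithin ℝ b triangle (squash x y) (0, 1 - x))
    (continuous_comp_squash ha.continuousOn)
    (cs cA (v := fun p => (1, -p.2)) (by fun_prop)) (cs cA (v := fun p => (0, 1 - p.1)) (by fun_prop))
    (continuous_comp_squash hb.continuousOn)
    (cs cB (v := fun p => (1, -p.2)) (by fun_prop)) (cs cB (v := fun p => (0, 1 - p.1)) (by fun_prop))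
    (fun x hx y hy => hasDerivAt_squash_left dA hx hy)
    (fun x hx y hy => hasDerivAt_squash_right dA hx hy)
    (fun x hx y hy => hasDerivAt_squash_left dB hx hy)
    (fun x hx y hy => hasDerivAt_squash_right dB hx hy)
  have lin : ∀ (g : (ℝ × ℝ) →L[ℝ] ℝ) (s t : ℝ), g (s, t) = s * g (1, 0) + t * g (0, 1) := by
    intro g s t
    have : ((s, t) : ℝ × ℝ) = s • (1, 0) + t • (0, 1) := by simp
    rw [this, map_add, map_smul, map_smul, smul_eq_mul, smul_eq_mul]
  -- The Jacobian is absorbed: the partial derivatives of the reparametrized functions are the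
  -- differentials on `(1, -y)` and `(0, 1 - x)`, two vectors of determinant `1 - x`.
  have hL : ∀ x y, (1 - x) * (fderivWithin ℝ a triangle (squash x y) (1, 0) *
      fderivWithin ℝ b triangle (squash x y) (0, 1) - fderivWithin ℝ a triangle (squash x y) (0, 1) *
        fderivWithin ℝ b triangle (squash x y) (1, 0)) =
      fderivWithin ℝ a triangle (squash x y) (1, -y) *
        fderivWithin ℝ b triangle (squash x y) (0, 1 - x) -
      fderivWithin ℝ a triangle (squash x y) (0, 1 - x) *
        fderivWithin ℝ b triangle (squash x y) (1, -y) := by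
    intro x y
    rw [lin (fderivWithin ℝ a triangle (squash x y)) 1 (-y),
      lin (fderivWithin ℝ a triangle (squash x y)) 0 (1 - x),
      lin (fderivWithin ℝ b triangle (squash x y)) 1 (-y),
      lin (fderivWithin ℝ b triangle (squash x y)) 0 (1 - x)]
    ring
  simp only [hL]
  rw [key]
  -- The side of the square over `x = 1` collapses to a vertex of the triangle, where the tangent
  -- vector is zero, and contributes nothing.
  have i1 : (∫ y in (0 : ℝ)..1, (a (squash 1 y) * fderivWithin ℝ b triangle (squash 1 y) (0, 1 - 1) -
      a (squash 0 y) * fderivWithin ℝ b triangle (squash 0 y) (0, 1 - 0))) =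
      - ∫ t in (0 : ℝ)..1, a (0, t) * fderivWithin ℝ b triangle (0, t) (0, 1) := by
    rw [← intervalIntegral.integral_neg]
    refine integral_congr fun y hy => ?_
    rw [uIcc_of_le zero_le_one] at hy
    rw [squash_of_mem (x := 0) (by simp) hy, sub_self, sub_zero, mul_one,
      show ((0, 0) : ℝ × ℝ) = 0 from rfl, map_zero]
    ring
  have i2 : (∫ x in (0 : ℝ)..1, (a (squash x 1) * fderivWithin ℝ b triangle (squash x 1) (1, -1) -
      a (squash x 0) * fderivWithin ℝ b triangle (squash x 0) (1, -0))) =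
      - (∫ t in (0 : ℝ)..1, a (1 - t, t) * fderivWithin ℝ b triangle (1 - t, t) (-1, 1)) -
        ∫ t in (0 : ℝ)..1, a (t, 0) * fderivWithin ℝ b triangle (t, 0) (1, 0) := by
    have cc := (continuous_comp_squash ha.continuousOn).mul (cs cB (v := fun p => (1, -p.2)) (by fun_prop))
    have h1 : Continuous fun x => a (squash x 1) * fderivWithin ℝ b triangle (squash x 1) (1, -1) :=
      cc.comp (f := fun x : ℝ => (x, (1 : ℝ))) (by fun_prop)
    have h0 : Continuous fun x => a (squash x 0) * fderivWithin ℝ b triangle (squash x 0) (1, -0) :=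
      cc.comp (f := fun x : ℝ => (x, (0 : ℝ))) (by fun_prop)
    rw [intervalIntegral.integral_sub (h1.intervalIntegrable _ _) (h0.intervalIntegrable _ _)]
    congr 1
    · have h3 := intervalIntegral.integral_comp_sub_left (a := 0) (b := 1)
        (fun x => a (squash x 1) * fderivWithin ℝ b triangle (squash x 1) (1, -1)) 1
      rw [sub_self, sub_zero] at h3
      rw [← h3, ← intervalIntegral.integral_neg]
      refine integral_congr fun t ht => ?_
      rw [uIcc_of_le zero_le_one] at ht
      rw [squash_of_mem (x := 1 - t) ⟨by linarith [ht.2], by linarith [ht.1]⟩ (by simp), one_mul,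
        sub_sub_cancel, show ((-1, 1) : ℝ × ℝ) = -(1, -1) by simp, map_neg]
      ring
    · refine integral_congr fun t ht => ?_
      rw [uIcc_of_le zero_le_one] at ht
      rw [squash_of_mem ht (by simp), zero_mul, neg_zero]
  rw [i1, i2]
  ring

end Green
end LagrangianCycles

end

/-! ### Continuous densities over degenerate tetrahedra in the plane -/

noncomputable section

set_option linter.unusedSectionVars false
namespace LagrangianCycles

section AffineIntegral
open MeasureTheory intervalIntegral Set

/-- The affine parametrization of the triangle spanned by a triple of points. -/
def plane {F : Type*} [AddCommGroup F] [Module ℝ F] (v : Tup F 2) (p : ℝ × ℝ) : F :=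
  v 0 + p.1 • (v 1 - v 0) + p.2 • (v 2 - v 0)

theorem plane_mem {F : Type*} [AddCommGroup F] [Module ℝ F] {K : Set F} (hK : Convex ℝ K)
    {v : Tup F 2} (hv : v ∈ tupIn K 2) {p : ℝ × ℝ} (hp : p ∈ triangle) : plane v p ∈ K := by
  obtain ⟨h1, h2, h3⟩ := hp
  have : plane v p = ∑ i : Fin 3, (![1 - p.1 - p.2, p.1, p.2] i) • v i := by
    simp only [plane, Fin.sum_univ_three, Matrix.cons_val]
    module
  rw [this]
  refine hK.sum_mem (fun i _ => ?_) ?_ fun i _ => hv i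
  · fin_cases i
    · change 0 ≤ 1 - p.1 - p.2
      linarith
    · exact h1
    · exact h2
  · simp only [Fin.sum_univ_three, Matrix.cons_val]
    ring

/-- Twice the signed area of a triangle in the plane. -/
def tdet (v : Tup (ℝ × ℝ) 2) : ℝ :=
  (v 1 - v 0).1 * (v 2 - v 0).2 - (v 2 - v 0).1 * (v 1 - v 0).2

/-- The integral of the two-form with density `h` over an affine triangle in the plane. -/
def areaInt (h : ℝ × ℝ → ℝ) (v : Tup (ℝ × ℝ) 2) : ℝ := ∫ p in triangle, h (plane v p) * tdet v

theorem continuous_plane {F : Type*} [NormedAddCommGroup F] [NormedSpace ℝ F] (v : Tup F 2) :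
    Continuous (plane v) := by
  unfold plane
  fun_prop

theorem hasFDerivAt_plane {F : Type*} [NormedAddCommGroup F] [NormedSpace ℝ F] (v : Tup F 2)
    (p : ℝ × ℝ) : HasFDerivAt (plane v)
      ((ContinuousLinearMap.fst ℝ ℝ ℝ).smulRight (v 1 - v 0) +
        (ContinuousLinearMap.snd ℝ ℝ ℝ).smulRight (v 2 - v 0)) p := by
  refine HasFDerivAt.add ?_ ?_
  · exact (((ContinuousLinearMap.fst ℝ ℝ ℝ).smulRight (v 1 - v 0)).hasFDerivAt).const_add (v 0)
  · exact ((ContinuousLinearMap.snd ℝ ℝ ℝ).smulRight (v 2 - v 0)).hasFDerivAt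

theorem contDiff_plane {F : Type*} [NormedAddCommGroup F] [NormedSpace ℝ F] (v : Tup F 2)
    {n : WithTop ℕ∞} : ContDiff ℝ n (plane v) := by
  unfold plane
  fun_prop

/-- The signed integral of `P dy` over a segment. -/
def edgeInt (P : ℝ × ℝ → ℝ) (a b : ℝ × ℝ) : ℝ :=
  ∫ t in (0 : ℝ)..1, P (a + t • (b - a)) * (b - a).2

/-- If `h` is the derivative of `P` in the first variable, then `h dx ∧ dy = d(P dy)`, and Green's
formula applies on the affine triangle. -/
theorem areaInt_eq_edgeInt {P h : ℝ × ℝ → ℝ} (hP : ContDiff ℝ 1 P)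
    (hh : ∀ q, fderiv ℝ P q (1, 0) = h q) (v : Tup (ℝ × ℝ) 2) :
    areaInt h v = edgeInt P (v 1) (v 2) - edgeInt P (v 0) (v 2) + edgeInt P (v 0) (v 1) := by
  have ha : ContDiff ℝ 1 fun p => P (plane v p) := hP.comp (contDiff_plane v)
  have hb : ContDiff ℝ 1 fun p => (plane v p).2 := contDiff_snd.comp (contDiff_plane v)
  have key := green_triangle ha.contDiffOn hb.contDiffOn
  have da : ∀ p ∈ triangle, ∀ e, fderivWithin ℝ (fun p => P (plane v p)) triangle p e =
      fderiv ℝ P (plane v p) (e.1 • (v 1 - v 0) + e.2 • (v 2 - v 0)) := by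
    intro p hp e
    rw [fderivWithin_eq_fderiv (uniqueDiffOn_triangle p hp) (ha.differentiable one_ne_zero p)]
    have := ((hP.differentiable one_ne_zero (plane v p)).hasFDerivAt.comp p (hasFDerivAt_plane v p)).fderiv
    change fderiv ℝ (P ∘ plane v) p e = _
    rw [this]
    simp
  have db : ∀ p ∈ triangle, ∀ e, fderivWithin ℝ (fun p => (plane v p).2) triangle p e =
      (e.1 • (v 1 - v 0) + e.2 • (v 2 - v 0)).2 := by
    intro p hp e
    rw [fderivWithin_eq_fderiv (uniqueDiffOn_triangle p hp) (hb.differentiable one_ne_zero p)]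
    have := ((ContinuousLinearMap.snd ℝ ℝ ℝ).hasFDerivAt.comp p (hasFDerivAt_plane v p)).fderiv
    change fderiv ℝ (ContinuousLinearMap.snd ℝ ℝ ℝ ∘ plane v) p e = _
    rw [this]
    simp
  have lin : ∀ (g : (ℝ × ℝ) →L[ℝ] ℝ) (w : ℝ × ℝ), g w = w.1 * g (1, 0) + w.2 * g (0, 1) := by
    intro g w
    have : w = w.1 • (1, 0) + w.2 • (0, 1) := by ext <;> simp
    conv_lhs => rw [this]
    rw [map_add, map_smul, map_smul, smul_eq_mul, smul_eq_mul]
  have h1 : areaInt h v = ∫ p in triangle,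
      (fderivWithin ℝ (fun p => P (plane v p)) triangle p (1, 0) *
        fderivWithin ℝ (fun p => (plane v p).2) triangle p (0, 1) -
      fderivWithin ℝ (fun p => P (plane v p)) triangle p (0, 1) *
        fderivWithin ℝ (fun p => (plane v p).2) triangle p (1, 0)) := by
    refine setIntegral_congr_fun isCompact_triangle.measurableSet fun p hp => ?_
    rw [da p hp, da p hp, db p hp, db p hp]
    simp only [one_smul, zero_smul, add_zero, zero_add]
    rw [lin (fderiv ℝ P (plane v p)) (v 1 - v 0), lin (fderiv ℝ P (plane v p)) (v 2 - v 0), hh, tdet]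
    ring
  rw [h1, key]
  have mem : ∀ t ∈ uIcc (0 : ℝ) 1, (1 - t, t) ∈ triangle ∧ (0, t) ∈ triangle ∧ (t, 0) ∈ triangle := by
    intro t ht
    rw [uIcc_of_le zero_le_one] at ht
    exact ⟨⟨by simp only; linarith [ht.2], ht.1, by simp⟩, ⟨le_rfl, ht.1, by simpa using ht.2⟩,
      ⟨ht.1, le_rfl, by simpa using ht.2⟩⟩
  congr 1
  · congr 1
    · refine integral_congr fun t ht => ?_
      rw [db _ (mem t ht).1]
      congr 2
      · simp only [plane]
        module
      · simp
    · refine integral_congr fun t ht => ?_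
      rw [db _ (mem t ht).2.1]
      congr 2
      · simp only [plane]
        module
      · simp
  · refine integral_congr fun t ht => ?_
    rw [db _ (mem t ht).2.2]
    congr 2
    · simp only [plane]
      module
    · simp

/-- The alternating sum of the integrals of a density over the faces of a tetrahedron. -/
def tetraInt (h : ℝ × ℝ → ℝ) (w : Tup (ℝ × ℝ) 3) : ℝ :=
  ∑ i : Fin 4, (-1 : ℝ) ^ (i : ℕ) * areaInt h (w ∘ i.succAbove)

/-- Each of the six edges of the tetrahedron lies on two faces, which induce opposite signs. -/
theorem tetraInt_eq_zero_of_primitive {P h : ℝ × ℝ → ℝ} (hP : ContDiff ℝ 1 P)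
    (hh : ∀ q, fderiv ℝ P q (1, 0) = h q) (w : Tup (ℝ × ℝ) 3) : tetraInt h w = 0 := by
  simp only [tetraInt, areaInt_eq_edgeInt hP hh, Fin.sum_univ_four, Function.comp_apply]
  have e : ∀ i j, (Fin.succAbove (n := 3) i j) = (if j.castSucc < i then j.castSucc else j.succ) :=
    fun i j => rfl
  simp [e, Fin.lt_def]
  ring

theorem areaInt_integrable {h : ℝ × ℝ → ℝ} (hh : ContinuousOn h triangle) {v : Tup (ℝ × ℝ) 2}
    (hv : v ∈ tupIn triangle 2) : IntegrableOn (fun p => h (plane v p) * tdet v) triangle := by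
  refine ContinuousOn.integrableOn_compact isCompact_triangle ?_
  exact (hh.comp (continuous_plane v).continuousOn fun p hp => plane_mem convex_triangle hv hp).mul
    continuousOn_const

theorem areaInt_sub_le {h g : ℝ × ℝ → ℝ} (hh : ContinuousOn h triangle)
    (hg : ContinuousOn g triangle) {ε : ℝ} (hε : ∀ p ∈ triangle, |h p - g p| ≤ ε)
    {v : Tup (ℝ × ℝ) 2} (hv : v ∈ tupIn triangle 2) :
    |areaInt h v - areaInt g v| ≤ ε * |tdet v| * volume.real triangle := by
  rw [areaInt, areaInt, ← integral_sub (areaInt_integrable hh hv) (areaInt_integrable hg hv)]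
  rw [← Real.norm_eq_abs]
  refine norm_setIntegral_le_of_norm_le_const (C := ε * |tdet v|)
    (isCompact_triangle.measure_lt_top (μ := volume))
    fun p hp => ?_
  rw [← sub_mul, norm_mul, Real.norm_eq_abs, Real.norm_eq_abs]
  exact mul_le_mul_of_nonneg_right (hε _ (plane_mem convex_triangle hv hp)) (abs_nonneg _)

theorem tetraInt_add {h g : ℝ × ℝ → ℝ} (hh : ContinuousOn h triangle) (hg : ContinuousOn g triangle)
    {w : Tup (ℝ × ℝ) 3} (hw : w ∈ tupIn triangle 3) :
    tetraInt (h + g) w = tetraInt h w + tetraInt g w := by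
  simp only [tetraInt]
  rw [← Finset.sum_add_distrib]
  refine Finset.sum_congr rfl fun i _ => ?_
  rw [← mul_add, areaInt, areaInt, areaInt,
    ← integral_add (areaInt_integrable (v := w ∘ i.succAbove) hh fun j => hw _)
      (areaInt_integrable (v := w ∘ i.succAbove) hg fun j => hw _)]
  simp only [Pi.add_apply, add_mul]

theorem tetraInt_smul (c : ℝ) (h : ℝ × ℝ → ℝ) (w : Tup (ℝ × ℝ) 3) :
    tetraInt (c • h) w = c * tetraInt h w := by
  simp only [tetraInt, Finset.mul_sum, areaInt, Pi.smul_apply, smul_eq_mul, mul_assoc,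
    MeasureTheory.integral_const_mul]
  exact Finset.sum_congr rfl fun i _ => by ring

/-- The integral of a continuous density over the boundary of a degenerate tetrahedron in the
triangle vanishes. -/
theorem tetraInt_eq_zero {h : ℝ × ℝ → ℝ} (hh : ContinuousOn h triangle) {w : Tup (ℝ × ℝ) 3}
    (hw : w ∈ tupIn triangle 3) : tetraInt h w = 0 := by
  have : CompactSpace triangle := isCompact_iff_compactSpace.1 isCompact_triangle
  let X : C(triangle, ℝ) := ⟨fun p => p.1.1, by fun_prop⟩
  let Y : C(triangle, ℝ) := ⟨fun p => p.1.2, by fun_prop⟩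
  -- A merely continuous density is uniformly approximated by polynomials (Stone–Weierstrass).
  -- Monomials have polynomial primitives in the first variable, and the integral depends on the
  -- density continuously in the sup norm, with constant `C` below.
  let S : Subalgebra ℝ C(triangle, ℝ) := Algebra.adjoin ℝ {X, Y}
  have hS : S.SeparatesPoints := by
    intro p q hpq
    by_cases h1 : p.1.1 = q.1.1
    · refine ⟨Y, ⟨Y, Algebra.subset_adjoin (by simp), rfl⟩, fun h2 => hpq ?_⟩
      exact Subtype.ext (Prod.ext h1 h2)
    · exact ⟨X, ⟨X, Algebra.subset_adjoin (by simp), rfl⟩, h1⟩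
  have htop := ContinuousMap.subalgebra_topologicalClosure_eq_top_of_separatesPoints S hS
  have poly : ∀ g ∈ S, ∃ G : ℝ × ℝ → ℝ, Continuous G ∧ tetraInt G w = 0 ∧ ∀ p, G p.1 = g p := by
    intro g hg
    rw [← Subalgebra.mem_toSubmodule, Algebra.adjoin_eq_span] at hg
    induction hg using Submodule.span_induction with
    | mem g hg =>
      obtain ⟨i, j, rfl⟩ := (Submonoid.mem_closure_pair _ _ _).1 hg
      refine ⟨fun p => p.1 ^ i * p.2 ^ j, by fun_prop, ?_, fun p => rfl⟩
      refine tetraInt_eq_zero_of_primitive (P := fun p => ((i + 1 : ℝ)⁻¹ * p.1 ^ (i + 1)) * p.2 ^ j)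
        (by fun_prop) (fun q => ?_) w
      have h1 := ((((hasFDerivAt_fst (𝕜 := ℝ) (p := q)).pow (i + 1)).const_mul (i + 1 : ℝ)⁻¹).mul
        ((hasFDerivAt_snd (𝕜 := ℝ) (p := q)).pow j))
      have h2 := congrArg (fun L : ℝ × ℝ →L[ℝ] ℝ => L (1, 0)) h1.fderiv
      refine Eq.trans h2 ?_
      have : (i : ℝ) + 1 ≠ 0 := by positivity
      simp
      field_simp
    | zero => exact ⟨0, continuous_zero, by simp [tetraInt, areaInt], fun p => rfl⟩
    | add g₁ g₂ _ _ h₁ h₂ =>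
      obtain ⟨G₁, c₁, z₁, e₁⟩ := h₁
      obtain ⟨G₂, c₂, z₂, e₂⟩ := h₂
      refine ⟨G₁ + G₂, c₁.add c₂, ?_, fun p => by simp [e₁, e₂]⟩
      rw [tetraInt_add c₁.continuousOn c₂.continuousOn hw, z₁, z₂, add_zero]
    | smul c g _ h =>
      obtain ⟨G, cG, z, e⟩ := h
      refine ⟨c • G, cG.const_smul c, ?_, fun p => by simp [e]⟩
      rw [tetraInt_smul, z, mul_zero]
  set C := ∑ i : Fin 4, |tdet (w ∘ i.succAbove)| * volume.real triangle with hC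
  have hC0 : 0 ≤ C := Finset.sum_nonneg fun i _ => by positivity
  have bound : ∀ ε > 0, |tetraInt h w| ≤ ε * C := by
    intro ε hε
    let H : C(triangle, ℝ) := ⟨triangle.domRestrict h, continuousOn_iff_continuous_domRestrict.1 hh⟩
    have hH : H ∈ closure (S : Set C(triangle, ℝ)) := by
      have : H ∈ S.topologicalClosure := htop ▸ Algebra.mem_top
      exact this
    obtain ⟨g, hgS, hg⟩ := Metric.mem_closure_iff.1 hH ε hε
    obtain ⟨G, cG, z, e⟩ := poly g hgS
    have hgε : ∀ p ∈ triangle, |h p - G p| ≤ ε := by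
      intro p hp
      have := (ContinuousMap.dist_lt_iff hε).1 hg ⟨p, hp⟩
      rw [← e] at this
      exact this.le
    rw [← sub_zero (tetraInt h w), ← z, tetraInt, tetraInt, ← Finset.sum_sub_distrib, hC,
      Finset.mul_sum]
    refine (Finset.abs_sum_le_sum_abs _ _).trans (Finset.sum_le_sum fun i _ => ?_)
    rw [← mul_sub, abs_mul, abs_pow, abs_neg, abs_one, one_pow, one_mul, ← mul_assoc]
    exact areaInt_sub_le hh cG.continuousOn hgε fun j => hw _
  have h0 : |tetraInt h w| ≤ 0 := by
    refine le_of_forall_pos_le_add fun δ hδ => ?_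
    refine (bound (δ / (C + 1)) (by positivity)).trans ?_
    rw [zero_add, div_mul_eq_mul_div, div_le_iff₀ (by positivity)]
    nlinarith
  exact abs_nonpos_iff.1 h0

end AffineIntegral
end LagrangianCycles

end

/-! ### Superposition operators on spaces of continuous maps -/

noncomputable section

set_option linter.unusedSectionVars false
namespace LagrangianCycles

section Superposition
open MeasureTheory intervalIntegral Set Filter Topology

variable {K : Type*} [TopologicalSpace K] [CompactSpace K]
variable {E F G : Type*} [NormedAddCommGroup E] [NormedSpace ℝ E]
  [NormedAddCommGroup F] [NormedSpace ℝ F] [NormedAddCommGroup G] [NormedSpace ℝ G]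

/-- Pointwise application of a continuous family of operators, as a bilinear operation on spaces
of continuous maps. -/
def pointwiseApply : C(K, E →L[ℝ] F) →L[ℝ] C(K, E) →L[ℝ] C(K, F) :=
  LinearMap.mkContinuous₂
    (LinearMap.mk₂ ℝ (fun (A : C(K, E →L[ℝ] F)) (u : C(K, E)) =>
        (⟨fun t => A t (u t), A.continuous.clm_apply u.continuous⟩ : C(K, F)))
      (fun A B u => by ext t; simp) (fun c A u => by ext t; simp)
      (fun A u v => by ext t; simp) (fun c A u => by ext t; simp)) 1
    fun A u => by
      rw [one_mul, ContinuousMap.norm_le _ (by positivity)]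
      intro t
      exact ((A t).le_opNorm (u t)).trans
        (mul_le_mul (A.norm_coe_le_norm t) (u.norm_coe_le_norm t) (norm_nonneg _) (norm_nonneg A))

@[simp] theorem pointwiseApply_apply (A : C(K, E →L[ℝ] F)) (u : C(K, E)) (t : K) :
    pointwiseApply A u t = A t (u t) := rfl

/-- The superposition operator of a continuously differentiable map is differentiable. -/
theorem hasFDerivAt_superposition {f : C(E, F)} (f' : C(E, E →L[ℝ] F))
    (hf : ∀ x, HasFDerivAt f (f' x) x) (u : C(K, E)) :
    HasFDerivAt (fun u : C(K, E) => f.comp u) (pointwiseApply (f'.comp u)) u := by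
  rw [hasFDerivAt_iff_isLittleO_nhds_zero, Asymptotics.isLittleO_iff]
  intro ε hε
  have hcont : Continuous fun u : C(K, E) => f'.comp u := ContinuousMap.continuous_postcomp f'
  obtain ⟨δ, hδ, H⟩ := (Metric.continuous_iff (α := C(K, E)) (β := C(K, E →L[ℝ] F))).1 hcont u ε hε
  filter_upwards [Metric.ball_mem_nhds (0 : C(K, E)) hδ] with v hv
  rw [ContinuousMap.norm_le _ (by positivity)]
  intro t
  -- Continuity of `u ↦ f' ∘ u` in the sup norm bounds the variation of `f'` along these segments
  -- uniformly in `t`. The mean value inequality then gives the remainder estimate.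
  have key : ∀ z ∈ segment ℝ (u t) (u t + v t), ‖f' z - f' (u t)‖ ≤ ε := by
    intro z hz
    rw [segment_eq_image'] at hz
    obtain ⟨s, hs, rfl⟩ := hz
    have h1 : dist (u + s • v) u < δ := by
      rw [dist_eq_norm, add_sub_cancel_left, norm_smul, Real.norm_of_nonneg hs.1]
      have : ‖v‖ < δ := by simpa using hv
      nlinarith [norm_nonneg v, hs.2]
    have h2 := (ContinuousMap.dist_lt_iff hε).1 (H _ h1) t
    rw [dist_eq_norm] at h2
    simpa using h2.le
  have := (convex_segment (𝕜 := ℝ) (u t) (u t + v t)).norm_image_sub_le_of_norm_hasFDerivWithin_le'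
    (fun z hz => (hf z).hasFDerivWithinAt) key (left_mem_segment ℝ _ _) (right_mem_segment ℝ _ _)
  rw [add_sub_cancel_left] at this
  exact this.trans (mul_le_mul_of_nonneg_left (v.norm_coe_le_norm t) hε.le)

/-- The superposition operator of a `C^n` map is `C^n`. -/
theorem contDiff_superposition {E : Type u} [NormedAddCommGroup E] [NormedSpace ℝ E] (n : ℕ) :
    ∀ {F : Type u} [NormedAddCommGroup F] [NormedSpace ℝ F]
    {f : C(E, F)}, ContDiff ℝ n f → ContDiff ℝ n fun u : C(K, E) => f.comp u := by
  induction n with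
  | zero =>
    intro F _ _ f hf
    rw [Nat.cast_zero, contDiff_zero]
    exact ContinuousMap.continuous_postcomp f
  | succ n ih =>
    intro F _ _ f hf
    have hf1 := (contDiff_succ_iff_fderiv (𝕜 := ℝ) (n := n) (f := f)).1 (by exact_mod_cast hf)
    let f' : C(E, E →L[ℝ] F) := ⟨fderiv ℝ f, hf1.2.2.continuous⟩
    have hd := fun u => hasFDerivAt_superposition (K := K) (f := f) f'
      (fun x => (hf1.1 x).hasFDerivAt) u
    push_cast
    rw [contDiff_succ_iff_fderiv]
    refine ⟨fun u => (hd u).differentiableAt, by simp, ?_⟩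
    -- The derivative is a bounded linear operation applied to the superposition operator of `f'`.
    -- The latter takes values in another space, so the induction runs over all targets in one
    -- universe.
    have : (fderiv ℝ fun u : C(K, E) => f.comp u) = fun u => pointwiseApply (f'.comp u) :=
      funext fun u => (hd u).fderiv
    rw [this]
    exact (pointwiseApply (K := K) (E := E) (F := F)).contDiff.comp (ih (f := f') hf1.2.2)

end Superposition

/-! ### Flows near a stationary point, by the implicit function theorem -/

section Flow
open MeasureTheory intervalIntegral Set Filter Topology unitInterval

variable {E : Type u} [NormedAddCommGroup E] [NormedSpace ℝ E] [CompleteSpace E]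

/-- A continuous map on the unit interval, extended to the line. -/
def extendI (w : C(I, E)) : ℝ → E := IccExtend zero_le_one w

theorem continuous_extendI (w : C(I, E)) : Continuous (extendI w) := w.continuous.Icc_extend'

theorem extendI_coe (w : C(I, E)) (t : I) : extendI w t = w t := IccExtend_val _ _ _

theorem norm_extendI_le (w : C(I, E)) (t : ℝ) : ‖extendI w t‖ ≤ ‖w‖ := w.norm_coe_le_norm _

/-- Indefinite integration on the unit interval. -/
def integrate : C(I, E) →L[ℝ] C(I, E) :=
  LinearMap.mkContinuous
    { toFun := fun w => ⟨fun t => ∫ s in (0 : ℝ)..t, extendI w s,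
        (continuous_primitive (fun a b => (continuous_extendI w).intervalIntegrable a b) 0).comp
          continuous_subtype_val⟩
      map_add' := fun w z => by
        ext t
        exact integral_add ((continuous_extendI w).intervalIntegrable _ _)
          ((continuous_extendI z).intervalIntegrable _ _)
      map_smul' := fun c w => by
        ext t
        exact integral_smul c (extendI w) } 1
    fun w => by
      rw [one_mul, ContinuousMap.norm_le _ (norm_nonneg _)]
      intro t
      refine (norm_integral_le_of_norm_le_const fun s _ => norm_extendI_le w s).trans ?_
      rw [sub_zero, abs_of_nonneg t.2.1]
      exact mul_le_of_le_one_right (norm_nonneg _) t.2.2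

theorem integrate_apply (w : C(I, E)) (t : I) :
    integrate w t = ∫ s in (0 : ℝ)..t, extendI w s := rfl

theorem hasDerivAt_integrate (w : C(I, E)) {t : ℝ} (ht : t ∈ Ioo (0 : ℝ) 1) :
    HasDerivAt (extendI (integrate w)) (extendI w t) t := by
  have h := (continuous_extendI w).integral_hasStrictDerivAt 0 t
  refine h.hasDerivAt.congr_of_eventuallyEq ?_
  filter_upwards [Ioo_mem_nhds ht.1 ht.2] with s hs
  exact extendI_coe (integrate w) ⟨s, hs.1.le, hs.2.le⟩

/-- The constant maps on the unit interval. -/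
def constI : E →L[ℝ] C(I, E) :=
  LinearMap.mkContinuous
    { toFun := fun x => ContinuousMap.const I x
      map_add' := fun _ _ => rfl
      map_smul' := fun _ _ => rfl } 1
    fun x => by
      rw [one_mul, ContinuousMap.norm_le _ (norm_nonneg _)]
      exact fun t => le_rfl

@[simp] theorem constI_apply (x : E) (t : I) : constI x t = x := rfl

/-- The graph of a path, as an affine map of the path. -/
def graphI (u : C(I, E)) : C(I, ℝ × E) := ⟨fun t => (t, u t), by fun_prop⟩

/-- The linear part of `graphI`. -/
def inrI : C(I, E) →L[ℝ] C(I, ℝ × E) :=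
  LinearMap.mkContinuous
    { toFun := fun u => ⟨fun t => (0, u t), by fun_prop⟩
      map_add' := fun _ _ => by ext t <;> simp
      map_smul' := fun _ _ => by ext t <;> simp } 1
    fun u => by
      rw [one_mul, ContinuousMap.norm_le _ (norm_nonneg _)]
      intro t
      simpa using u.norm_coe_le_norm t

theorem graphI_eq (u : C(I, E)) : graphI u = inrI u + graphI 0 := by
  ext t <;> simp [graphI, inrI]

theorem hasFDerivAt_graphI (u : C(I, E)) : HasFDerivAt graphI (inrI : C(I, E) →L[ℝ] _) u := by
  have : (graphI : C(I, E) → C(I, ℝ × E)) = fun u => inrI u + graphI 0 := funext graphI_eq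
  rw [this]
  exact (inrI (E := E)).hasFDerivAt.add_const _

theorem contDiff_graphI {n : WithTop ℕ∞} : ContDiff ℝ n (graphI : C(I, E) → C(I, ℝ × E)) := by
  have : (graphI : C(I, E) → C(I, ℝ × E)) = fun u => inrI u + graphI 0 := funext graphI_eq
  rw [this]
  exact (inrI (E := E)).contDiff.add contDiff_const

/-- The operator whose zeros are the integral curves of a time-dependent field. -/
def picard (X : C(ℝ × E, E)) (p : E × C(I, E)) : C(I, E) :=
  p.2 - constI p.1 - integrate (X.comp (graphI p.2))

variable {X : C(ℝ × E, E)}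

/-- The derivative of a vector field as a continuous map. -/
def fderivCM (hX : ContDiff ℝ 2 X) : C(ℝ × E, ℝ × E →L[ℝ] E) :=
  ⟨fderiv ℝ X, hX.continuous_fderiv (by norm_num)⟩

theorem contDiff_picard (hX : ContDiff ℝ 2 X) : ContDiff ℝ 2 (picard X) := by
  have h1 : ContDiff ℝ 2 fun u : C(I, E) => X.comp (graphI u) :=
    (contDiff_superposition (K := I) 2 hX).comp contDiff_graphI
  exact (contDiff_snd.sub (constI.contDiff.comp contDiff_fst)).sub
    (integrate.contDiff.comp (h1.comp contDiff_snd))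

theorem hasFDerivAt_picard (hX : ContDiff ℝ 2 X) (p : E × C(I, E)) :
    HasFDerivAt (picard X)
      (ContinuousLinearMap.snd ℝ E C(I, E) - constI ∘L ContinuousLinearMap.fst ℝ E C(I, E) -
        integrate ∘L (pointwiseApply ((fderivCM hX).comp (graphI p.2)) ∘L inrI) ∘L
          ContinuousLinearMap.snd ℝ E C(I, E)) p := by
  have h1 : HasFDerivAt (fun u : C(I, E) => X.comp (graphI u))
      (pointwiseApply ((fderivCM hX).comp (graphI p.2)) ∘L inrI) p.2 :=
    (hasFDerivAt_superposition (fderivCM hX)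
      (fun x => (hX.differentiable (by norm_num) x).hasFDerivAt) (graphI p.2)).comp p.2
      (hasFDerivAt_graphI p.2)
  have h2 : HasFDerivAt (fun p : E × C(I, E) => X.comp (graphI p.2))
      ((pointwiseApply ((fderivCM hX).comp (graphI p.2)) ∘L inrI) ∘L
          ContinuousLinearMap.snd ℝ E C(I, E)) p := h1.comp p hasFDerivAt_snd
  exact (hasFDerivAt_snd.sub (constI.hasFDerivAt.comp p hasFDerivAt_fst)).sub
    (integrate.hasFDerivAt.comp p h2)

/-- Near a stationary point at which the linearization vanishes, a time-dependent field has a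
flow up to time one, depending in a `C^2` way on the initial value. -/
theorem exists_flow (hX : ContDiff ℝ 2 X) (h0 : ∀ t, X (t, 0) = 0)
    (h1 : ∀ t v, fderiv ℝ X (t, 0) (0, v) = 0) :
    ∃ U : E → C(I, E), ContDiffAt ℝ 2 U 0 ∧ U 0 = 0 ∧
      ∀ᶠ x in 𝓝 0, U x = constI x + integrate (X.comp (graphI (U x))) := by
  have cd : ContDiffAt ℝ 2 (picard X) (0, 0) := (contDiff_picard hX).contDiffAt
  have z : picard X (0, 0) = 0 := by
    have : X.comp (graphI 0) = 0 := by
      ext t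
      exact h0 t
    simp [picard, this]
  -- At the stationary path the integral term has zero derivative, because the linearization of the
  -- field vanishes there. The partial derivative in the path is then the identity, and the implicit
  -- function theorem yields solutions up to time one.
  have hinv : (fderiv ℝ (picard X) (0, 0) ∘L .inr ℝ E C(I, E)) = ContinuousLinearMap.id ℝ _ := by
    rw [(hasFDerivAt_picard hX (0, 0)).fderiv]
    ext v : 1
    have : pointwiseApply ((fderivCM hX).comp (graphI 0)) (inrI v) = 0 := by
      ext t
      exact h1 t (v t)
    simp [this]
  have hI : (fderiv ℝ (picard X) (0, 0) ∘L .inr ℝ E C(I, E)).IsInvertible := by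
    rw [hinv]
    exact ⟨ContinuousLinearEquiv.refl ℝ _, rfl⟩
  refine ⟨cd.implicitFunction (by norm_num) hI, cd.contDiffAt_implicitFunction _ _,
    cd.implicitFunction_apply_self _ _, ?_⟩
  filter_upwards [cd.eventually_apply_implicitFunction (by norm_num) hI] with x hx
  rw [z, picard] at hx
  simp only at hx
  rw [sub_sub, sub_eq_zero] at hx
  exact hx

/-- The derivative of the flow satisfies the variational equation. -/
theorem fderiv_flow (hX : ContDiff ℝ 2 X) {U : E → C(I, E)} {x : E}
    (hU : DifferentiableAt ℝ U x)
    (hx : ∀ᶠ x in 𝓝 x, U x = constI x + integrate (X.comp (graphI (U x)))) (v : E) :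
    fderiv ℝ U x v = constI v +
      integrate (pointwiseApply ((fderivCM hX).comp (graphI (U x))) (inrI (fderiv ℝ U x v))) := by
  have h1 : HasFDerivAt (fun u : C(I, E) => X.comp (graphI u))
      (pointwiseApply ((fderivCM hX).comp (graphI (U x))) ∘L inrI) (U x) :=
    (hasFDerivAt_superposition (fderivCM hX)
      (fun x => (hX.differentiable (by norm_num) x).hasFDerivAt) (graphI (U x))).comp (U x)
      (hasFDerivAt_graphI (U x))
  have h2 : HasFDerivAt (fun x => constI x + integrate (X.comp (graphI (U x)))) _ x :=
    constI.hasFDerivAt.add (integrate.hasFDerivAt.comp x (h1.comp x hU.hasFDerivAt))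
  have h3 := (h2.congr_of_eventuallyEq hx).fderiv
  conv_lhs => rw [h3]
  rfl

end Flow
end LagrangianCycles

end

/-! ### Cut-offs and the Poincaré lemma -/

noncomputable section

set_option linter.unusedSectionVars false
set_option maxSynthPendingDepth 4
namespace LagrangianCycles

section Moser
open MeasureTheory intervalIntegral Set Filter Topology unitInterval

/-- A map that is `C^2` near the origin and vanishes there agrees near the origin with a small
`C^2` map on the whole space. -/
theorem exists_small_extension {E F : Type*} [NormedAddCommGroup E] [InnerProductSpace ℝ E]
    [NormedAddCommGroup F] [NormedSpace ℝ F] {f : E → F}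
    (hf : ContDiffAt ℝ 2 f 0) (h0 : f 0 = 0) {ε : ℝ} (hε : 0 < ε) :
    ∃ g : E → F, ContDiff ℝ 2 g ∧ g =ᶠ[𝓝 0] f ∧ ∀ x, ‖g x‖ < ε := by
  have h1 : ∀ᶠ x in 𝓝 (0 : E), ContDiffAt ℝ 2 f x := hf.eventually (by simp)
  have h2 : ∀ᶠ x in 𝓝 (0 : E), ‖f x‖ < ε := by
    have := hf.continuousAt.norm
    rw [ContinuousAt, h0, norm_zero] at this
    exact this.eventually (gt_mem_nhds hε)
  obtain ⟨r, hr, H⟩ := Metric.eventually_nhds_iff_ball.1 (h1.and h2)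
  let χ : ContDiffBump (0 : E) := ⟨r / 3, r / 2, by positivity, by linarith⟩
  refine ⟨fun x => χ x • f x, ?_, ?_, fun x => ?_⟩
  · rw [contDiff_iff_contDiffAt]
    intro x
    by_cases hx : x ∈ Metric.ball (0 : E) r
    · exact (χ.contDiff (n := 2)).contDiffAt.smul (H x hx).1
    · have : (fun x => χ x • f x) =ᶠ[𝓝 x] fun _ => 0 := by
        have hx' : x ∈ (Metric.closedBall (0 : E) (r / 2))ᶜ := by
          simp only [Metric.mem_ball, not_lt, mem_compl_iff, Metric.mem_closedBall, not_le] at hx ⊢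
          linarith
        filter_upwards [Metric.isClosed_closedBall.isOpen_compl.mem_nhds hx'] with y hy
        rw [χ.zero_of_le_dist, zero_smul]
        simp only [mem_compl_iff, Metric.mem_closedBall, not_le] at hy
        exact hy.le
      exact contDiffAt_const.congr_of_eventuallyEq this
  · filter_upwards [χ.eventuallyEq_one] with x hx
    simp [hx]
  · rw [norm_smul, Real.norm_of_nonneg χ.nonneg]
    by_cases hx : x ∈ Metric.ball (0 : E) r
    · have := (H x hx).2
      nlinarith [χ.le_one (x := x), norm_nonneg (f x), χ.nonneg (x := x)]
    · rw [χ.zero_of_le_dist, zero_mul]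
      · exact hε
      · simp only [Metric.mem_ball, not_lt] at hx
        change r / 2 ≤ _
        linarith

variable {E : Type u} [NormedAddCommGroup E] [NormedSpace ℝ E] [CompleteSpace E]
variable {F : Type u} [NormedAddCommGroup F] [NormedSpace ℝ F] [CompleteSpace F]

/-- The rays from the origin. -/
def rayI : E →L[ℝ] C(I, E) :=
  LinearMap.mkContinuous
    { toFun := fun y => ⟨fun s => (s : ℝ) • y, by fun_prop⟩
      map_add' := fun _ _ => by ext t; simp
      map_smul' := fun c y => by ext t; exact smul_comm _ _ _ } 1
    fun y => by
      rw [one_mul, ContinuousMap.norm_le _ (norm_nonneg _)]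
      intro s
      simp only [LinearMap.coe_mk, AddHom.coe_mk, ContinuousMap.coe_mk, norm_smul]
      rw [Real.norm_of_nonneg s.2.1]
      exact mul_le_of_le_one_left (norm_nonneg _) s.2.2

@[simp] theorem rayI_apply (y : E) (s : I) : rayI y s = (s : ℝ) • y := rfl

/-- The first moment of a path. -/
def momentI : C(I, F) →L[ℝ] F :=
  LinearMap.mkContinuous
    { toFun := fun w => ∫ s in (0 : ℝ)..1, s • extendI w s
      map_add' := fun w z => by
        refine Eq.trans ?_ (intervalIntegral.integral_add
          ((continuous_id.smul (continuous_extendI w)).intervalIntegrable _ _)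
          ((continuous_id.smul (continuous_extendI z)).intervalIntegrable _ _))
        exact integral_congr fun s _ => smul_add s (extendI w s) (extendI z s)
      map_smul' := fun c w => by
        rw [RingHom.id_apply, ← intervalIntegral.integral_smul]
        exact integral_congr fun s _ => smul_comm s c (extendI w s) } 1
    fun w => by
      rw [one_mul]
      refine (intervalIntegral.norm_integral_le_of_norm_le_const (C := ‖w‖)
        fun s hs => ?_).trans (by simp)
      rw [uIoc_of_le zero_le_one] at hs
      rw [norm_smul, Real.norm_of_nonneg hs.1.le]
      exact (mul_le_of_le_one_left (norm_nonneg _) hs.2).trans (norm_extendI_le w s)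

theorem momentI_apply (w : C(I, F)) : momentI w = ∫ s in (0 : ℝ)..1, s • extendI w s := rfl

theorem clm_momentI {G : Type*} [NormedAddCommGroup G] [NormedSpace ℝ G] [CompleteSpace G]
    (L : F →L[ℝ] G) (w : C(I, F)) : L (momentI w) = ∫ s in (0 : ℝ)..1, s • L (extendI w s) := by
  rw [momentI_apply, ← L.intervalIntegral_comp_comm]
  · simp
  · exact (continuous_id.smul (continuous_extendI w)).intervalIntegrable _ _

/-- The radial average of a map. -/
def radial (S : C(E, F)) (y : E) : F := momentI (S.comp (rayI y))

/-- The radial average is a composition of continuous linear maps with a superposition operator, so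
no differentiation under the integral sign is required. -/
theorem contDiff_radial {S : C(E, F)} (hS : ContDiff ℝ 2 S) : ContDiff ℝ 2 (radial S) :=
  (momentI (F := F)).contDiff.comp ((contDiff_superposition (K := I) 2 hS).comp (rayI (E := E)).contDiff)

theorem clm_radial {G : Type*} [NormedAddCommGroup G] [NormedSpace ℝ G] [CompleteSpace G]
    (L : F →L[ℝ] G) (S : C(E, F)) (y : E) :
    L (radial S y) = ∫ s in (0 : ℝ)..1, s • L (S (s • y)) := by
  rw [radial, clm_momentI]
  refine integral_congr fun s hs => ?_
  rw [uIcc_of_le zero_le_one] at hs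
  have := extendI_coe (S.comp (rayI y)) ⟨s, hs⟩
  simp only at this
  simp only [this]
  rfl

theorem clm_fderiv_radial {G : Type*} [NormedAddCommGroup G] [NormedSpace ℝ G] [CompleteSpace G]
    (L : F →L[ℝ] G) {S : C(E, F)} (hS : ContDiff ℝ 2 S) (y a : E) :
    L (fderiv ℝ (radial S) y a) =
      ∫ s in (0 : ℝ)..1, s • L (fderiv ℝ S (s • y) (s • a)) := by
  have h1 := hasFDerivAt_superposition (K := I) (f := S)
    ⟨fderiv ℝ S, hS.continuous_fderiv (by norm_num)⟩
    (fun x => (hS.differentiable (by norm_num) x).hasFDerivAt) (rayI y)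
  have h2 : HasFDerivAt (radial S) _ y :=
    (momentI (F := F)).hasFDerivAt.comp y (h1.comp y (rayI (E := E)).hasFDerivAt)
  rw [h2.fderiv]
  change L (momentI (pointwiseApply _ (rayI a))) = _
  rw [clm_momentI]
  refine integral_congr fun s hs => ?_
  rw [uIcc_of_le zero_le_one] at hs
  set w := (pointwiseApply (ContinuousMap.comp (⟨fderiv ℝ S, hS.continuous_fderiv (by norm_num)⟩ :
    C(E, E →L[ℝ] F)) (rayI y))) (rayI a) with hw
  have := extendI_coe w ⟨s, hs⟩
  simp only at this
  simp only [this]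
  rfl

/-- The Poincaré primitive of a two-form. -/
def primitive (S : C(E, E →L[ℝ] E →L[ℝ] ℝ)) (y : E) : E →L[ℝ] ℝ := radial (F := E →L[ℝ] E →L[ℝ] ℝ) S y y

variable {S : C(E, E →L[ℝ] E →L[ℝ] ℝ)}

theorem contDiff_primitive (hS : ContDiff ℝ 2 S) : ContDiff ℝ 2 (primitive S) :=
  (contDiff_radial (F := E →L[ℝ] E →L[ℝ] ℝ) hS).clm_apply contDiff_id

theorem fderiv_primitive (hS : ContDiff ℝ 2 S) (y a : E) :
    fderiv ℝ (primitive S) y a = radial (F := E →L[ℝ] E →L[ℝ] ℝ) S y a + fderiv ℝ (radial (F := E →L[ℝ] E →L[ℝ] ℝ) S) y a y := by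
  have h := ((contDiff_radial (F := E →L[ℝ] E →L[ℝ] ℝ) hS).differentiable (by norm_num) y).hasFDerivAt.clm_apply
    (hasFDerivAt_id y)
  have h' : HasFDerivAt (primitive S) _ y := h
  rw [h'.fderiv]
  simp

/-- The exterior derivative of the Poincaré primitive of a form that is closed near the origin. -/
theorem fderiv_primitive_sub (hS : ContDiff ℝ 2 S) {r : ℝ}
    (alt : ∀ y ∈ Metric.ball (0 : E) r, ∀ a b, S y a b = -S y b a)
    (closed : ∀ y ∈ Metric.ball (0 : E) r, ∀ a b c,
      fderiv ℝ S y a b c - fderiv ℝ S y b a c + fderiv ℝ S y c a b = 0)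
    {y : E} (hy : y ∈ Metric.ball (0 : E) r) (a b : E) :
    fderiv ℝ (primitive S) y a b - fderiv ℝ (primitive S) y b a = S y a b := by
  -- Evaluation on a pair of vectors is linear and continuous, hence commutes with the integrals and
  -- reduces the identity to scalar integrals.
  let ev : E → E → (E →L[ℝ] E →L[ℝ] ℝ) →L[ℝ] ℝ := fun a b =>
    (ContinuousLinearMap.apply ℝ ℝ b) ∘L (ContinuousLinearMap.apply ℝ (E →L[ℝ] ℝ) a)
  have hev : ∀ a b (B : E →L[ℝ] E →L[ℝ] ℝ), ev a b B = B a b := fun _ _ _ => rfl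
  have cS : Continuous S := S.continuous
  have cS' : Continuous fun y => fderiv ℝ S y := hS.continuous_fderiv (by norm_num)
  have cont1 : ∀ a b, Continuous fun s : ℝ => s • S (s • y) a b := fun a b => by fun_prop
  have cont2 : ∀ a b c, Continuous fun s : ℝ => s • fderiv ℝ S (s • y) (s • a) b c :=
    fun a b c => continuous_id.smul ((((cS'.comp (continuous_id.smul continuous_const)).clm_apply
      (continuous_id.smul continuous_const)).clm_apply continuous_const).clm_apply
      continuous_const)
  rw [fderiv_primitive hS, fderiv_primitive hS]
  simp only [add_apply]
  rw [← hev, ← hev b a, ← hev y b, ← hev y a,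
    clm_radial (F := E →L[ℝ] E →L[ℝ] ℝ) (ev a b), clm_radial (F := E →L[ℝ] E →L[ℝ] ℝ) (ev b a),
    clm_fderiv_radial (F := E →L[ℝ] E →L[ℝ] ℝ) (ev y b) hS,
    clm_fderiv_radial (F := E →L[ℝ] E →L[ℝ] ℝ) (ev y a) hS]
  simp only [hev]
  rw [← intervalIntegral.integral_add ((cont1 a b).intervalIntegrable _ _) ((cont2 a y b).intervalIntegrable _ _),
    ← intervalIntegral.integral_add ((cont1 b a).intervalIntegrable _ _) ((cont2 b y a).intervalIntegrable _ _),
    ← intervalIntegral.integral_sub (((cont1 a b).fun_add (cont2 a y b)).intervalIntegrable _ _)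
      (((cont1 b a).fun_add (cont2 b y a)).intervalIntegrable _ _)]
  -- By closedness and antisymmetry the integrand of the left side is the derivative of `s ^ 2 * S
  -- (s • y) a b`, whose increment over the unit interval is `S y a b`.
  have hd : ∀ s : ℝ, HasDerivAt (fun s : ℝ => s ^ 2 * S (s • y) a b)
      (2 * s * S (s • y) a b + s ^ 2 * fderiv ℝ S (s • y) y a b) s := by
    intro s
    have h1 : HasDerivAt (fun s : ℝ => s • y) y s := by
      simpa using (hasDerivAt_id s).smul_const y
    have h2 := ((hS.differentiable (by norm_num) (s • y)).hasFDerivAt.comp_hasDerivAt s h1)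
    have h3 := (ev a b).hasFDerivAt.comp_hasDerivAt s h2
    have h4 := (hasDerivAt_pow 2 s).mul h3
    have h5 : HasDerivAt (fun s : ℝ => s ^ 2 * S (s • y) a b) _ s := h4
    exact h5.congr_deriv (by simp [hev])
  have ftc := integral_eq_sub_of_hasDerivAt (a := 0) (b := 1) (fun s _ => hd s)
    (by
      refine Continuous.intervalIntegrable ?_ _ _
      fun_prop)
  have : S y a b = (fun s : ℝ => s ^ 2 * S (s • y) a b) 1 - (fun s : ℝ => s ^ 2 * S (s • y) a b) 0 := by
    simp
  rw [this, ← ftc]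
  refine integral_congr fun s hs => ?_
  rw [uIcc_of_le zero_le_one] at hs
  have hsy : s • y ∈ Metric.ball (0 : E) r := by
    rw [mem_ball_zero_iff] at hy ⊢
    rw [norm_smul, Real.norm_of_nonneg hs.1]
    nlinarith [norm_nonneg y, hs.2]
  have c := closed _ hsy y a b
  have l := alt _ hsy b a
  simp only [map_smul, smul_apply, smul_eq_mul]
  rw [l]
  linear_combination -s ^ 2 * c

end Moser
end LagrangianCycles

end

/-! ### Moser's method -/

noncomputable section

set_option linter.unusedSectionVars false
set_option maxSynthPendingDepth 4
namespace LagrangianCycles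

section Moser
open MeasureTheory intervalIntegral Set Filter Topology unitInterval ContinuousLinearMap

variable {E : Type u} [NormedAddCommGroup E] [InnerProductSpace ℝ E] [CompleteSpace E]

/-- The time-dependent field of Moser's method for the path from `A` to `A + S`. -/
def moserField (A : E →L[ℝ] E →L[ℝ] ℝ) (S : C(E, E →L[ℝ] E →L[ℝ] ℝ)) (p : ℝ × E) : E :=
  -(deriv Real.smoothTransition p.1) •
    (A + Real.smoothTransition p.1 • S p.2).inverse (primitive S p.2)

variable {A : E →L[ℝ] E →L[ℝ] ℝ} {S : C(E, E →L[ℝ] E →L[ℝ] ℝ)}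

theorem contDiff_moserField (hS : ContDiff ℝ 2 S)
    (inv : ∀ t y, (A + Real.smoothTransition t • S y).IsInvertible) :
    ContDiff ℝ 2 (moserField A S) := by
  have hτ : ContDiff ℝ 2 Real.smoothTransition := Real.smoothTransition.contDiff (n := 2)
  have hτ' : ContDiff ℝ 2 (deriv Real.smoothTransition) := by
    have : ContDiff ℝ (2 + 1) Real.smoothTransition := Real.smoothTransition.contDiff (n := 3)
    exact (contDiff_succ_iff_deriv.1 this).2.2
  have h1 : ContDiff ℝ 2 fun p : ℝ × E => A + Real.smoothTransition p.1 • S p.2 :=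
    contDiff_const.add ((hτ.comp contDiff_fst).smul (hS.comp contDiff_snd))
  have h2 : ContDiff ℝ 2 fun p : ℝ × E => (A + Real.smoothTransition p.1 • S p.2).inverse := by
    rw [contDiff_iff_contDiffAt]
    intro p
    have h := (inv p.1 p.2).contDiffAt_map_inverse (n := 2)
    exact h.comp p h1.contDiffAt
  exact ((hτ'.comp contDiff_fst).neg).smul
    (h2.clm_apply ((contDiff_primitive hS).comp contDiff_snd))

/-- This is the equation of Moser's method: contracting the form at time `t` with the field cancels
the time derivative of the path of forms, up to an exact term. From here on the field is used mainly
through this equation and its derivative. -/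
theorem moserField_spec (inv : ∀ t y, (A + Real.smoothTransition t • S y).IsInvertible)
    (t : ℝ) (y : E) : (A + Real.smoothTransition t • S y) (moserField A S (t, y)) =
      -(deriv Real.smoothTransition t) • primitive S y := by
  rw [moserField, map_smul]
  congr 1
  exact congrArg (fun L : (E →L[ℝ] ℝ) →L[ℝ] (E →L[ℝ] ℝ) => L (primitive S y))
    (inv t y).self_comp_inverse

/-- Differentiation of an equation between a family of forms applied to a field and a one-form. -/
theorem hasFDerivAt_apply_eq {B : E → E →L[ℝ] E →L[ℝ] ℝ} {B' : E →L[ℝ] E →L[ℝ] E →L[ℝ] ℝ}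
    {X : E → E} {X' : E →L[ℝ] E} {P : E → E →L[ℝ] ℝ} {P' : E →L[ℝ] E →L[ℝ] ℝ} {y : E}
    (hB : HasFDerivAt B B' y) (hX : HasFDerivAt X X' y) (hP : HasFDerivAt P P' y)
    (h : ∀ y, B y (X y) = P y) (a b : E) : B' a (X y) b + B y (X' a) b = P' a b := by
  have h1 := hB.clm_apply hX
  have h3 := h1.unique (hP.congr_of_eventuallyEq (Eventually.of_forall h))
  have h4 := congrArg (fun L : E →L[ℝ] (E →L[ℝ] ℝ) => L a b) h3
  simp only [add_apply, comp_apply, flip_apply] at h4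
  linarith

theorem fderiv_apply_eq {s d t : ℝ} {X : ℝ × E → E} {P : E → E →L[ℝ] ℝ} {y : E}
    (hS : DifferentiableAt ℝ S y) (hX : DifferentiableAt ℝ X (t, y)) (hP : DifferentiableAt ℝ P y)
    (h : ∀ y, (A + s • S y) (X (t, y)) = -d • P y) (a b : E) :
    s * fderiv ℝ S y a (X (t, y)) b + (A + s • S y) (fderiv ℝ X (t, y) (0, a)) b =
      -d * fderiv ℝ P y a b := by
  have hP' : HasFDerivAt (fun y => -d • P y) (-d • fderiv ℝ P y) y :=
    hP.hasFDerivAt.const_smul (-d)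
  have hB : HasFDerivAt (fun y => A + s • S y) (s • fderiv ℝ S y) y :=
    (hS.hasFDerivAt.const_smul s).const_add A
  have hX' : HasFDerivAt (fun y => X (t, y)) (fderiv ℝ X (t, y) ∘L .inr ℝ ℝ E) y :=
    hX.hasFDerivAt.comp y (hasFDerivAt_prodMk_right t y)
  exact hasFDerivAt_apply_eq hB hX' hP' h a b

/-- The derivative of the equation that defines the field. -/
theorem fderiv_moserField_spec (hS : ContDiff ℝ 2 S)
    (inv : ∀ t y, (A + Real.smoothTransition t • S y).IsInvertible) (t : ℝ) (y a b : E) :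
    Real.smoothTransition t * fderiv ℝ S y a (moserField A S (t, y)) b +
      (A + Real.smoothTransition t • S y) (fderiv ℝ (moserField A S) (t, y) (0, a)) b =
      -(deriv Real.smoothTransition t) * fderiv ℝ (primitive S) y a b :=
  fderiv_apply_eq (hS.differentiable (by norm_num) y)
    ((contDiff_moserField hS inv).differentiable (by norm_num) (t, y))
    ((contDiff_primitive hS).differentiable (by norm_num) y) (moserField_spec inv t) a b

theorem primitive_zero : primitive S 0 = 0 := by
  simp [primitive]

theorem moserField_zero (t : ℝ) : moserField A S (t, 0) = 0 := by
  simp [moserField, primitive_zero]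

theorem radial_zero {F : Type u} [NormedAddCommGroup F] [NormedSpace ℝ F] [CompleteSpace F]
    {S : C(E, F)} (h : S 0 = 0) : radial S 0 = 0 := by
  have := clm_radial (ContinuousLinearMap.id ℝ F) S 0
  simpa [h] using this

/-- As `S` vanishes at the origin, its primitive vanishes there together with its derivative.
Differentiating the defining equation and inverting `A` gives the claim, which is the hypothesis of
`exists_flow`. -/
theorem fderiv_moserField_zero (hS : ContDiff ℝ 2 S) (h0 : S 0 = 0)
    (inv : ∀ t y, (A + Real.smoothTransition t • S y).IsInvertible) (t : ℝ) (v : E) :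
    fderiv ℝ (moserField A S) (t, 0) (0, v) = 0 := by
  have h1 : fderiv ℝ (primitive S) 0 v = 0 := by
    rw [fderiv_primitive hS, map_zero, add_zero,
      radial_zero (F := E →L[ℝ] E →L[ℝ] ℝ) h0]
    rfl
  have h2 : A (fderiv ℝ (moserField A S) (t, 0) (0, v)) = 0 := by
    ext b
    have := fderiv_moserField_spec hS inv t 0 v b
    simpa [moserField_zero, h0, h1] using this
  have h3 : A.IsInvertible := by simpa [h0] using inv t 0
  obtain ⟨e, rfl⟩ := h3
  exact e.injective (by simpa using h2)

/-- **Moser's trick**: a closed nondegenerate two-form can be made constant near a point. -/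
theorem exists_moser [FiniteDimensional ℝ E] {Ω : E → E →L[ℝ] E →L[ℝ] ℝ} (hΩ : ContDiffAt ℝ 2 Ω 0)
    (alt : ∀ᶠ y in 𝓝 0, ∀ a b, Ω y a b = -Ω y b a)
    (closed : ∀ᶠ y in 𝓝 0, ∀ a b c,
      fderiv ℝ Ω y a b c - fderiv ℝ Ω y b a c + fderiv ℝ Ω y c a b = 0)
    (inv : (Ω 0).IsInvertible) :
    ∃ φ : E → E, ContDiffAt ℝ 2 φ 0 ∧ φ 0 = 0 ∧ fderiv ℝ φ 0 = .id ℝ E ∧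
      ∀ᶠ x in 𝓝 0, ∀ v w, Ω (φ x) (fderiv ℝ φ x v) (fderiv ℝ φ x w) = Ω 0 v w := by
  set A := Ω 0 with hA
  -- a uniform neighbourhood of invertible forms
  obtain ⟨ε, hε, hinv⟩ : ∃ ε > 0, ∀ B : E →L[ℝ] E →L[ℝ] ℝ, ‖B‖ < ε → (A + B).IsInvertible := by
    obtain ⟨e, he⟩ := inv
    obtain ⟨ε, hε, h⟩ := Metric.mem_nhds_iff.1 e.nhds
    refine ⟨ε, hε, fun B hB => ?_⟩
    have : A + B ∈ Metric.ball (e : E →L[ℝ] E →L[ℝ] ℝ) ε := by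
      rw [← he, mem_ball_iff_norm, add_sub_cancel_left]
      exact hB
    obtain ⟨e', he'⟩ := h this
    exact ⟨e', he'⟩
  -- Cutting off makes the perturbation small on the whole space, so the forms `A + τ S` with `τ` in
  -- the unit interval are all invertible and the field is defined globally. Near the origin nothing
  -- changes.
  obtain ⟨S', hS, hSΩ, hSε⟩ := exists_small_extension (f := fun y => Ω y - A)
    (hΩ.sub contDiffAt_const) (sub_self _) hε
  let S : C(E, E →L[ℝ] E →L[ℝ] ℝ) := ⟨S', hS.continuous⟩
  replace hS : ContDiff ℝ 2 S := hS
  replace hSΩ : ⇑S =ᶠ[𝓝 0] fun y => Ω y - A := hSΩ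
  have hinv' : ∀ t y, (A + Real.smoothTransition t • S y).IsInvertible := by
    intro t y
    apply hinv
    rw [norm_smul, Real.norm_of_nonneg (Real.smoothTransition.nonneg t)]
    exact (mul_le_of_le_one_left (norm_nonneg _) (Real.smoothTransition.le_one t)).trans_lt (hSε y)
  have hS0 : S 0 = 0 := by rw [hSΩ.eq_of_nhds, hA, sub_self]
  obtain ⟨r, hr, H⟩ := Metric.eventually_nhds_iff_ball.1
    ((alt.and closed).and (hSΩ.eventuallyEq_nhds))
  have hSΩ' : ∀ y ∈ Metric.ball (0 : E) r, S y = Ω y - A := fun y hy => (H y hy).2.eq_of_nhds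
  have hdS : ∀ y ∈ Metric.ball (0 : E) r, fderiv ℝ S y = fderiv ℝ Ω y := fun y hy => by
    rw [(H y hy).2.fderiv_eq, fderiv_sub_const]
  have altA : ∀ a b, A a b = -A b a := (H 0 (Metric.mem_ball_self hr)).1.1
  have altS : ∀ y ∈ Metric.ball (0 : E) r, ∀ a b, S y a b = -S y b a := by
    intro y hy a b
    rw [hSΩ' y hy]
    simp only [sub_apply]
    rw [(H y hy).1.1 a b, altA a b]
    ring
  have closedS : ∀ y ∈ Metric.ball (0 : E) r, ∀ a b c,
      fderiv ℝ S y a b c - fderiv ℝ S y b a c + fderiv ℝ S y c a b = 0 := by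
    intro y hy
    rw [hdS y hy]
    exact (H y hy).1.2
  let X : C(ℝ × E, E) := ⟨moserField A S, (contDiff_moserField hS hinv').continuous⟩
  have hX : ContDiff ℝ 2 X := contDiff_moserField hS hinv'
  obtain ⟨U, cU, U0, hU⟩ := exists_flow hX (fun t => moserField_zero t)
    (fun t v => fderiv_moserField_zero hS hS0 hinv' t v)
  have hdiff : ∀ᶠ x in 𝓝 0, DifferentiableAt ℝ U x := by
    filter_upwards [cU.eventually (by simp)] with x hx
    exact hx.differentiableAt (by norm_num)
  let ev : C(I, E) →L[ℝ] E := ContinuousMap.evalCLM ℝ (1 : I)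
  have hφ : ∀ x, DifferentiableAt ℝ U x → ∀ v,
      fderiv ℝ (fun x => U x 1) x v = fderiv ℝ U x v 1 := by
    intro x hx v
    have : HasFDerivAt (fun x => ev (U x)) (ev ∘L fderiv ℝ U x) x :=
      ev.hasFDerivAt.comp x hx.hasFDerivAt
    exact congrArg (fun L : E →L[ℝ] E => L v) this.fderiv
  refine ⟨fun x => U x 1, ev.contDiff.contDiffAt.comp 0 cU, by simp [U0], ?_, ?_⟩
  · ext1 v
    rw [hφ 0 hdiff.self_of_nhds, fderiv_flow hX hdiff.self_of_nhds hU]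
    have : pointwiseApply ((fderivCM hX).comp (graphI (U 0))) (inrI (fderiv ℝ U 0 v)) = 0 := by
      ext t
      rw [U0]
      exact fderiv_moserField_zero hS hS0 hinv' t _
    rw [this]
    simp
  · have small : ∀ᶠ x in 𝓝 0, ∀ t, U x t ∈ Metric.ball (0 : E) r := by
      have h1 : ∀ᶠ x in 𝓝 0, ‖U x‖ < r := by
        have := cU.continuousAt.norm
        rw [ContinuousAt, U0, norm_zero] at this
        exact this.eventually (gt_mem_nhds hr)
      filter_upwards [h1] with x hx t
      rw [mem_ball_zero_iff]
      exact ((U x).norm_coe_le_norm t).trans_lt hx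
    filter_upwards [hdiff, hU.eventually_nhds, small] with x hx hUx hsm v w
    rw [hφ x hx, hφ x hx]
    set V := fderiv ℝ U x v with hV
    set W := fderiv ℝ U x w with hW
    have eV := fderiv_flow hX hx hUx v
    have eW := fderiv_flow hX hx hUx w
    rw [← hV] at eV
    rw [← hW] at eW
    have dU : ∀ t ∈ Ioo (0 : ℝ) 1, HasDerivAt (extendI (U x)) (moserField A S (t, extendI (U x) t)) t := by
      intro t ht
      have h := (hasDerivAt_integrate (X.comp (graphI (U x))) ht).const_add x
      have ht' : t ∈ Icc (0 : ℝ) 1 := Ioo_subset_Icc_self ht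
      have e1 : extendI (X.comp (graphI (U x))) t = moserField A S (t, extendI (U x) t) := by
        rw [show t = ((⟨t, ht'⟩ : I) : ℝ) from rfl, extendI_coe, extendI_coe]
        rfl
      rw [e1] at h
      refine h.congr_of_eventuallyEq (Eventually.of_forall fun s => ?_)
      conv_lhs => rw [hUx.self_of_nhds]
      rfl
    have dV : ∀ v, ∀ t ∈ Ioo (0 : ℝ) 1, HasDerivAt (extendI (fderiv ℝ U x v))
        (fderiv ℝ (moserField A S) (t, extendI (U x) t) (0, extendI (fderiv ℝ U x v) t)) t := by
      intro v t ht
      have eV := fderiv_flow hX hx hUx v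
      have h := (hasDerivAt_integrate (pointwiseApply ((fderivCM hX).comp (graphI (U x)))
        (inrI (fderiv ℝ U x v))) ht).const_add v
      have ht' : t ∈ Icc (0 : ℝ) 1 := Ioo_subset_Icc_self ht
      have e1 : extendI (pointwiseApply ((fderivCM hX).comp (graphI (U x)))
          (inrI (fderiv ℝ U x v))) t =
          fderiv ℝ (moserField A S) (t, extendI (U x) t) (0, extendI (fderiv ℝ U x v) t) := by
        rw [show t = ((⟨t, ht'⟩ : I) : ℝ) from rfl, extendI_coe, extendI_coe, extendI_coe]
        rfl
      rw [e1] at h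
      refine h.congr_of_eventuallyEq (Eventually.of_forall fun s => ?_)
      conv_lhs => rw [eV]
      rfl
    -- `Q t` is the pullback by the flow of the form at time `t`, evaluated on `v` and `w`. Its
    -- derivative vanishes on the open interval, so the values at the two ends agree.
    let Q : ℝ → ℝ := fun t => (A + Real.smoothTransition t • S (extendI (U x) t))
      (extendI V t) (extendI W t)
    have cQ : Continuous Q := by
      have h1 := continuous_extendI (U x)
      have h2 := continuous_extendI V
      have h3 := continuous_extendI W
      exact ((continuous_const.add (Real.smoothTransition.continuous.smul
        (S.continuous.comp h1))).clm_apply h2).clm_apply h3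
    have dQ : ∀ t ∈ Ioo (0 : ℝ) 1, HasDerivAt Q 0 t := by
      intro t ht
      have hτ : HasDerivAt Real.smoothTransition (deriv Real.smoothTransition t) t :=
        ((Real.smoothTransition.contDiff (n := 1)).differentiable (by norm_num) t).hasDerivAt
      have hy : extendI (U x) t ∈ Metric.ball (0 : E) r := hsm _
      set y := extendI (U x) t with hyd
      have h1 := (hS.differentiable (by norm_num) y).hasFDerivAt.comp_hasDerivAt t (dU t ht)
      have h2 := (hτ.smul h1).const_add A
      have h3 := (h2.clm_apply (dV v t ht)).clm_apply (dV w t ht)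
      refine HasDerivAt.congr_deriv (f := Q) h3 ?_
      rw [← hV, ← hW, ← hyd]
      set V' := extendI V t
      set W' := extendI W t
      have f1 := fderiv_moserField_spec hS hinv' t y V' W'
      have f2 := fderiv_moserField_spec hS hinv' t y W' V'
      have f3 := fderiv_primitive_sub hS altS closedS hy V' W'
      have f4 := closedS y hy (moserField A S (t, y)) V' W'
      have f5 := altA V' (fderiv ℝ (moserField A S) (t, y) (0, W'))
      have f6 := altS y hy V' (fderiv ℝ (moserField A S) (t, y) (0, W'))
      simp at f1 f2 ⊢
      rw [f5, f6]
      -- The derivative of the defining equation, antisymmetrized (`f1 - f2`), is combined with `dP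
      -- = S` for the primitive (`f3`) and the closedness of `S` (`f4`). This is Cartan's formula in
      -- coordinates.
      linear_combination f1 - f2 - deriv Real.smoothTransition t * f3 + Real.smoothTransition t * f4
    have hconst : Q 1 = Q 0 := by
      obtain ⟨c, -, hc⟩ := exists_hasDerivAt_eq_slope Q (fun _ => 0) one_pos cQ.continuousOn dQ
      simp only [sub_zero, div_one] at hc
      linarith
    have at0 : ∀ v, extendI (fderiv ℝ U x v) 0 = v := by
      intro v
      rw [show (0 : ℝ) = ((0 : I) : ℝ) from rfl, extendI_coe, fderiv_flow hX hx hUx v]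
      simp [integrate_apply]
    have at1 : ∀ u : C(I, E), extendI u 1 = u 1 := fun u => extendI_coe u 1
    simp only [Q, hV, hW, at0, at1, Real.smoothTransition.zero, Real.smoothTransition.one, zero_smul,
      add_zero, one_smul] at hconst
    rw [hSΩ' _ (hsm 1)] at hconst
    simpa using hconst

end Moser
end LagrangianCycles

end

/-! ### Linear symplectic algebra -/

noncomputable section

set_option linter.unusedSectionVars false
set_option maxSynthPendingDepth 4
namespace LagrangianCycles

/-- The model space. -/
abbrev E4 : Type := EuclideanSpace ℝ (Fin 4)

/-- The standard symplectic form `dx₀ ∧ dx₁ + dx₂ ∧ dx₃`. -/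
def omega0 (u v : E4) : ℝ := u 0 * v 1 - u 1 * v 0 + (u 2 * v 3 - u 3 * v 2)

theorem omega0_smul_left (c : ℝ) (u v : E4) : omega0 (c • u) v = c * omega0 u v := by
  simp only [omega0, PiLp.smul_apply, smul_eq_mul]
  ring

theorem omega0_smul_right (c : ℝ) (u v : E4) : omega0 u (c • v) = c * omega0 u v := by
  simp only [omega0, PiLp.smul_apply, smul_eq_mul]
  ring

theorem omega0_self (u : E4) : omega0 u u = 0 := by
  simp only [omega0]
  ring

theorem omega0_swap (u v : E4) : omega0 v u = -omega0 u v := by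
  simp only [omega0]
  ring

theorem eq_zero_of_omega0 {u : E4} (h : ∀ v, omega0 u v = 0) : u = 0 := by
  have h0 := h !₂[0, 1, 0, 0]
  have h1 := h !₂[1, 0, 0, 0]
  have h2 := h !₂[0, 0, 0, 1]
  have h3 := h !₂[0, 0, 1, 0]
  simp [omega0] at h0 h1 h2 h3
  ext i
  fin_cases i <;> simp [h0, h1, h2, h3]

section SymplecticBasis

variable {B : E4 →L[ℝ] E4 →L[ℝ] ℝ}

/-- Every linear symplectic form on the model space has a symplectic basis, with a prescribed first
vector. -/
theorem exists_symplectic_equiv (alt : ∀ u v, B u v = -B v u)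
    (nondeg : ∀ u, (∀ v, B u v = 0) → u = 0) {e₁ : E4} (he₁ : e₁ ≠ 0) :
    ∃ L : E4 ≃L[ℝ] E4, (∀ u v, B (L u) (L v) = omega0 u v) ∧ L (EuclideanSpace.single 0 1) = e₁ := by
  have self : ∀ u, B u u = 0 := fun u => by linarith [alt u u]
  have partner : ∀ u : E4, u ≠ 0 → ∃ v, B u v = 1 := by
    intro u hu
    by_contra! h
    refine hu (nondeg u fun v => ?_)
    by_contra hv
    exact h ((B u v)⁻¹ • v) (by rw [map_smul, smul_eq_mul, inv_mul_cancel₀ hv])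
  obtain ⟨f₁, h1⟩ := partner e₁ he₁
  -- Two linear conditions in dimension four leave a nonzero vector orthogonal to the first
  -- symplectic pair.
  have hker : ((B e₁).prod (B f₁) : E4 →ₗ[ℝ] ℝ × ℝ).ker ≠ ⊥ :=
    LinearMap.ker_ne_bot_of_finrank_lt (by simp)
  obtain ⟨e₂, he₂, hne⟩ := Submodule.exists_mem_ne_zero_of_ne_bot hker
  have he₂' : B e₁ e₂ = 0 ∧ B f₁ e₂ = 0 := by simpa using he₂
  obtain ⟨g, hg⟩ := partner e₂ hne
  -- The correction makes the partner of `e₂` orthogonal to `e₁` and `f₁`; it does not change the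
  -- pairing with `e₂`, which is orthogonal to both.
  set f₂ := g + B f₁ g • e₁ - B e₁ g • f₁ with hf₂
  have a1 : B e₁ f₂ = 0 := by simp [hf₂, h1, self]
  have a2 : B f₁ f₂ = 0 := by simp [hf₂, alt f₁ e₁, h1, self]
  have a3 : B e₂ f₂ = 1 := by simp [hf₂, alt e₂ e₁, alt e₂ f₁, he₂', hg]
  let l : E4 →ₗ[ℝ] E4 :=
    { toFun := fun v => v 0 • e₁ + v 1 • f₁ + v 2 • e₂ + v 3 • f₂
      map_add' := fun v w => by simp only [PiLp.add_apply]; module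
      map_smul' := fun c v => by
        simp only [PiLp.smul_apply, smul_eq_mul, RingHom.id_apply]; module }
  have hl : ∀ u v, B (l u) (l v) = omega0 u v := by
    intro u v
    simp only [l, LinearMap.coe_mk, AddHom.coe_mk, map_add, map_smul, add_apply,
      smul_apply, smul_eq_mul, self, h1, a1, a2, a3, he₂'.1, he₂'.2, alt f₁ e₁,
      alt e₂ e₁, alt e₂ f₁, alt f₂ e₁, alt f₂ f₁, alt f₂ e₂, omega0]
    ring
  have inj : Function.Injective l := by
    rw [injective_iff_map_eq_zero]
    intro u hu
    exact eq_zero_of_omega0 fun v => by rw [← hl, hu]; simp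
  refine ⟨(LinearEquiv.ofInjectiveEndo l inj).toContinuousLinearEquiv, hl, ?_⟩
  change l _ = e₁
  simp [l]

end SymplecticBasis

/-! ### Darboux charts of class `C^2` -/

section Darboux
open Set Filter Topology

variable {N : Type u} [TopologicalSpace N] [ChartedSpace E4 N]

/-- A symplectic chart of class `C^2` onto a ball. -/
structure DarbouxChart (ω : SymplecticForm N) where
  /-- The underlying homeomorphism. -/
  chart : OpenPartialHomeomorph N E4
  /-- The radius of the target. -/
  radius : ℝ
  target_eq : chart.target = Metric.ball 0 radius
  contMDiffOn : ContMDiffOn (𝓡 4) 𝓘(ℝ, E4) 2 chart chart.source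
  contMDiffOn_symm : ContMDiffOn 𝓘(ℝ, E4) (𝓡 4) 2 chart.symm chart.target
  symplectic : ∀ y ∈ chart.target, ∀ v w : E4,
    (ω.form (chart.symm y)).compContinuousLinearMap (mfderiv 𝓘(ℝ, E4) (𝓡 4) chart.symm y) ![v, w] =
      omega0 v w

/-- Alternating forms of degree two as bilinear maps. -/
def altToBilin : (E4 [⋀^Fin 2]→L[ℝ] ℝ) →L[ℝ] (E4 →L[ℝ] E4 →L[ℝ] ℝ) :=
  (ContinuousLinearMap.compL ℝ E4 (E4 [×1]→L[ℝ] ℝ) (E4 →L[ℝ] ℝ)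
      (continuousMultilinearCurryFin1 ℝ E4 ℝ).toContinuousLinearEquiv.toContinuousLinearMap) ∘L
    (continuousMultilinearCurryLeftEquiv ℝ
      (fun _ : Fin 2 => E4) ℝ).toContinuousLinearEquiv.toContinuousLinearMap ∘L
    ContinuousAlternatingMap.toContinuousMultilinearMapCLM ℝ

theorem altToBilin_apply (f : E4 [⋀^Fin 2]→L[ℝ] ℝ) (u v : E4) : altToBilin f u v = f ![u, v] := by
  change f (Fin.cons u (Fin.snoc 0 v)) = f ![u, v]
  congr 1
  ext i : 1
  fin_cases i <;> rfl

variable [IsManifold (𝓡 4) ((⊤ : ℕ∞) : WithTop ℕ∞) N]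

/-- **Darboux's theorem**: there are arbitrarily small symplectic charts around every point. -/
theorem exists_darbouxChart (ω : SymplecticForm N) (x : N) {U : Set N} (hU : U ∈ 𝓝 x) :
    ∃ D : DarbouxChart ω, x ∈ D.chart.source ∧ D.chart.source ⊆ U ∧ D.chart x = 0 := by
  set e := extChartAt (𝓡 4) x with he
  set y₀ := e x with hy₀
  have hopen : IsOpen e.target := isOpen_extChartAt_target x
  have hy₀t : y₀ ∈ e.target := mem_extChartAt_target x
  -- The form in chart coordinates, translated so that the given point is the origin, and read as a
  -- bilinear map.
  let Ω : E4 → E4 →L[ℝ] E4 →L[ℝ] ℝ := fun y => altToBilin (ω.form.inChart x (y₀ + y))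
  have hΩ_apply : ∀ y u v, Ω y u v = ω.form.inChart x (y₀ + y) ![u, v] := fun y u v =>
    altToBilin_apply _ _ _
  have hshift : ∀ᶠ y in 𝓝 (0 : E4), y₀ + y ∈ e.target := by
    have : ContinuousAt (fun y : E4 => y₀ + y) 0 := by fun_prop
    exact this.eventually_mem (by rw [add_zero]; exact hopen.mem_nhds hy₀t)
  have cd : ∀ y, y₀ + y ∈ e.target → ContDiffAt ℝ 2 (fun y => ω.form.inChart x (y₀ + y)) y := by
    intro y hy
    have h1 : ContDiffAt ℝ 2 (ω.form.inChart x) (y₀ + y) :=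
      ((ω.smooth x).contDiffAt (hopen.mem_nhds hy)).of_le (WithTop.coe_le_coe.2 le_top)
    exact h1.comp y (by fun_prop)
  have cdΩ : ∀ y, y₀ + y ∈ e.target → ContDiffAt ℝ 2 Ω y := fun y hy =>
    altToBilin.contDiff.contDiffAt.comp y (cd y hy)
  have alt : ∀ y u v, Ω y u v = -Ω y v u := by
    intro y u v
    rw [hΩ_apply, hΩ_apply]
    have h := (ω.form.inChart x (y₀ + y)).toAlternatingMap.map_swap ![v, u] (i := 0) (j := 1)
      (by decide)
    have h' : ![v, u] ∘ Equiv.swap (0 : Fin 2) 1 = ![u, v] := by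
      ext i : 1
      fin_cases i <;> rfl
    rwa [h'] at h
  have closed : ∀ᶠ y in 𝓝 0, ∀ a b c,
      fderiv ℝ Ω y a b c - fderiv ℝ Ω y b a c + fderiv ℝ Ω y c a b = 0 := by
    filter_upwards [hshift] with y hy a b c
    have hd : DifferentiableAt ℝ (fun y => ω.form.inChart x (y₀ + y)) y :=
      (cd y hy).differentiableAt (by norm_num)
    have hΩd : DifferentiableAt ℝ Ω y := (cdΩ y hy).differentiableAt (by norm_num)
    have h1 : extDeriv (fun y => ω.form.inChart x (y₀ + y)) y = 0 := by
      have := ω.closed x (y₀ + y) hy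
      rw [extDeriv] at this ⊢
      rw [← this]
      congr 1
      rw [fderiv_comp_add_left]
    have h2 := extDeriv_apply hd ![a, b, c]
    rw [h1] at h2
    have h3 : ∀ a b c, fderiv ℝ (fun y => ω.form.inChart x (y₀ + y) ![b, c]) y a =
        fderiv ℝ Ω y a b c := by
      intro a b c
      have e1 : (fun y => ω.form.inChart x (y₀ + y) ![b, c]) = fun y => Ω y b c :=
        funext fun y => (hΩ_apply y b c).symm
      have h4 := (hΩd.hasFDerivAt.clm_apply (hasFDerivAt_const b y)).clm_apply
        (hasFDerivAt_const c y)
      rw [e1, h4.fderiv]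
      simp
    have r0 : (0 : Fin 3).removeNth ![a, b, c] = ![b, c] := by
      ext i : 1
      fin_cases i <;> rfl
    have r1 : (1 : Fin 3).removeNth ![a, b, c] = ![a, c] := by
      ext i : 1
      fin_cases i <;> rfl
    have r2 : (2 : Fin 3).removeNth ![a, b, c] = ![a, b] := by
      ext i : 1
      fin_cases i <;> rfl
    rw [Fin.sum_univ_three, r0, r1, r2, h3, h3, h3] at h2
    simp at h2
    linarith
  have hsurj : Function.Surjective (mfderiv 𝓘(ℝ, E4) (𝓡 4) e.symm y₀) := by
    have := isInvertible_mfderivWithin_extChartAt_symm (I := 𝓡 4) hy₀t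
    rw [modelWithCornersSelf_coe, range_id, mfderivWithin_univ] at this
    obtain ⟨g, hg⟩ := this
    rw [he, ← hg]
    exact g.surjective
  have hinj : Function.Injective (mfderiv 𝓘(ℝ, E4) (𝓡 4) e.symm y₀) := by
    have := isInvertible_mfderivWithin_extChartAt_symm (I := 𝓡 4) hy₀t
    rw [modelWithCornersSelf_coe, range_id, mfderivWithin_univ] at this
    obtain ⟨g, hg⟩ := this
    rw [he, ← hg]
    exact g.injective
  have nondeg : ∀ u, (∀ v, Ω 0 u v = 0) → u = 0 := by
    intro u hu
    have h1 : mfderiv 𝓘(ℝ, E4) (𝓡 4) e.symm y₀ u = 0 := by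
      refine ω.nondegenerate (e.symm y₀) _ fun w => ?_
      obtain ⟨w', rfl⟩ := hsurj w
      have := (hΩ_apply 0 u w').symm.trans (hu w')
      rw [add_zero] at this
      rw [← this]
      change _ = ω.form (e.symm y₀) _
      congr 1
      ext i : 1
      fin_cases i <;> rfl
    exact hinj (h1.trans (map_zero _).symm)
  have inv : (Ω 0).IsInvertible := by
    have inj : Function.Injective (Ω 0 : E4 →ₗ[ℝ] (E4 →L[ℝ] ℝ)) := by
      rw [injective_iff_map_eq_zero]
      intro u hu
      refine nondeg u fun v => ?_
      exact congrArg (fun l : E4 →L[ℝ] ℝ => l v) hu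
    have hfr : Module.finrank ℝ E4 = Module.finrank ℝ (E4 →L[ℝ] ℝ) := by
      rw [← (LinearMap.toContinuousLinearMap (𝕜 := ℝ) (E := E4) (F' := ℝ)).finrank_eq]
      exact (Subspace.dual_finrank_eq (K := ℝ) (V := E4)).symm
    let g := LinearEquiv.ofInjectiveOfFinrankEq (Ω 0 : E4 →ₗ[ℝ] (E4 →L[ℝ] ℝ)) inj hfr
    exact ⟨g.toContinuousLinearEquiv, rfl⟩
  obtain ⟨e₁, he₁⟩ := exists_ne (0 : E4)
  obtain ⟨L, hL, -⟩ := exists_symplectic_equiv (alt 0) nondeg he₁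
  obtain ⟨φ, cφ, φ0, dφ, hφ⟩ := exists_moser (cdΩ 0 (by rwa [add_zero]))
    (Eventually.of_forall alt) closed inv
  -- The map `φ` makes the form constant and has derivative the identity at the origin, and `L`
  -- brings that constant form to `omega0`. Thus `ψ` is a local diffeomorphism, and following it by
  -- the inverse chart gives the inverse of the Darboux chart.
  let ψ : E4 → E4 := fun y => y₀ + φ (L y)
  have ψ0 : ψ 0 = y₀ := by simp [ψ, φ0]
  have cφ' : ∀ᶠ y in 𝓝 (0 : E4), ContDiffAt ℝ 2 φ y := cφ.eventually (by simp)
  have hL0 : Tendsto L (𝓝 0) (𝓝 0) := by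
    have := L.continuous.continuousAt (x := 0)
    rwa [ContinuousAt, map_zero] at this
  have cψ' : ∀ᶠ y in 𝓝 (0 : E4), ContDiffAt ℝ 2 ψ y ∧
      fderiv ℝ ψ y = fderiv ℝ φ (L y) ∘L (L : E4 →L[ℝ] E4) := by
    filter_upwards [hL0.eventually cφ'] with y hy
    refine ⟨contDiffAt_const.add (hy.comp y L.contDiff.contDiffAt), ?_⟩
    exact (((hy.differentiableAt (by norm_num)).hasFDerivAt.comp y
      L.hasFDerivAt).const_add y₀).fderiv
  have cψ : ContDiffAt ℝ 2 ψ 0 := cψ'.self_of_nhds.1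
  have dψ : HasFDerivAt ψ (L : E4 →L[ℝ] E4) 0 := by
    have := (cψ.differentiableAt (by norm_num)).hasFDerivAt
    rwa [cψ'.self_of_nhds.2, map_zero, dφ, ContinuousLinearMap.id_comp] at this
  let P := cψ.toOpenPartialHomeomorph ψ dψ (by norm_num)
  have hP : ⇑P = ψ := rfl
  have hP0 : (0 : E4) ∈ P.source := cψ.mem_toOpenPartialHomeomorph_source dψ (by norm_num)
  have cP : ContDiffAt ℝ 2 P.symm (ψ 0) := cψ.to_localInverse dψ (by norm_num)
  have hct : e.target = (chartAt E4 x).target := by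
    simp only [he, mfld_simps]
  set c := chartAt E4 x with hc
  have hψt : Tendsto ψ (𝓝 0) (𝓝 y₀) := by
    have := cψ.continuousAt
    rwa [ContinuousAt, ψ0] at this
  have hsymmU : ∀ᶠ z in 𝓝 y₀, c.symm z ∈ U := by
    have h1 : ContinuousAt c.symm y₀ := c.symm.continuousAt (show y₀ ∈ c.target by rwa [← hct])
    refine h1.eventually_mem ?_
    have : c.symm y₀ = x := c.left_inv (mem_chart_source E4 x)
    rwa [this]
  -- One ball on which all requirements hold: regularity of `ψ` and its local inverse, values in the
  -- chart and in `U`, and the normal form of `Ω`.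
  obtain ⟨r, hr, H⟩ := Metric.eventually_nhds_iff_ball.1
    ((((cψ'.and (P.open_source.mem_nhds hP0)).and (hψt.eventually (hopen.mem_nhds hy₀t))).and
      ((cψ.continuousAt.eventually (cP.eventually (by simp))).and (hψt.eventually hsymmU))).and
      (hL0.eventually hφ))
  let Q := (P.restrOpen (Metric.ball 0 r) Metric.isOpen_ball).trans c.symm
  have hQ : ∀ y, Q y = c.symm (ψ y) := fun y => rfl
  have hQs : Q.source = Metric.ball 0 r := by
    ext y
    simp only [Q, OpenPartialHomeomorph.trans_source, OpenPartialHomeomorph.restrOpen_source,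
      OpenPartialHomeomorph.symm_source, mem_inter_iff, mem_preimage]
    refine ⟨fun h => h.1.2, fun hy => ⟨⟨(H y hy).1.1.1.2, hy⟩, ?_⟩⟩
    rw [← hct]
    exact (H y hy).1.1.2
  have hQsymm : ∀ z, Q.symm z = P.symm (c z) := fun z => rfl
  have : IsManifold (𝓡 4) 2 N := IsManifold.of_le (n := ((⊤ : ℕ∞) : WithTop ℕ∞))
    (WithTop.coe_le_coe.2 le_top)
  have smooth_symm : ∀ y ∈ Metric.ball (0 : E4) r,
      ContMDiffAt 𝓘(ℝ, E4) (𝓡 4) 2 c.symm (ψ y) := fun y hy =>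
    (contMDiffOn_chart_symm (x := x)).contMDiffAt
      (c.open_target.mem_nhds (by rw [← hct]; exact (H y hy).1.1.2))
  have hQ0 : Q 0 = x := by
    rw [hQ, ψ0]
    exact c.left_inv (mem_chart_source E4 x)
  have h0r : (0 : E4) ∈ Q.source := by
    rw [hQs]
    exact Metric.mem_ball_self hr
  refine ⟨⟨Q.symm, r, hQs, ?_, ?_, ?_⟩, ?_, ?_, ?_⟩
  · intro z hz
    have hz' : z ∈ Q.target := hz
    obtain ⟨y, hy, rfl⟩ : ∃ y ∈ Q.source, Q y = z := ⟨Q.symm z, Q.map_target hz', Q.right_inv hz'⟩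
    rw [hQs] at hy
    have ht : ψ y ∈ c.target := by rw [← hct]; exact (H y hy).1.1.2
    have h1 : ContMDiffAt (𝓡 4) 𝓘(ℝ, E4) 2 c (Q y) :=
      (contMDiffOn_chart (x := x)).contMDiffAt (c.open_source.mem_nhds (c.map_target ht))
    have h2 : ContMDiffAt 𝓘(ℝ, E4) 𝓘(ℝ, E4) 2 P.symm (c (Q y)) := by
      rw [hQ, c.right_inv ht]
      exact (H y hy).1.2.1.contMDiffAt
    exact (h2.comp (Q y) h1).contMDiffWithinAt
  · intro y hy
    replace hy : y ∈ Metric.ball (0 : E4) r := by rw [← hQs]; exact hy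
    exact ((smooth_symm y hy).comp y (H y hy).1.1.1.1.1.contMDiffAt).contMDiffWithinAt
  · intro y hy v w
    replace hy : y ∈ Metric.ball (0 : E4) r := by rw [← hQs]; exact hy
    have hm : ∀ v : E4, mfderiv 𝓘(ℝ, E4) (𝓡 4) Q.symm.symm y v =
        mfderiv 𝓘(ℝ, E4) (𝓡 4) c.symm (ψ y) (fderiv ℝ ψ y v) := by
      intro v
      have h1 := ((smooth_symm y hy).mdifferentiableAt (by norm_num)).hasMFDerivAt
      have h2 := ((H y hy).1.1.1.1.1.differentiableAt (by norm_num)).hasFDerivAt.hasMFDerivAt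
      exact DFunLike.congr_fun (HasMFDerivAt.comp y h1 h2).mfderiv v
    have h1 := (H y hy).2 (L v) (L w)
    rw [hL] at h1
    rw [← h1, hΩ_apply]
    have h2 := (H y hy).1.1.1.1.2
    change (ω.form (c.symm (ψ y))) _ = (ω.form (c.symm (ψ y))) _
    congr 1
    ext i : 1
    fin_cases i
    · exact (hm v).trans (by rw [h2]; rfl)
    · exact (hm w).trans (by rw [h2]; rfl)
  · change x ∈ Q.target
    rw [← hQ0]
    exact Q.map_source h0r
  · intro z hz
    have hz' : z ∈ Q.target := hz
    obtain ⟨y, hy, rfl⟩ : ∃ y ∈ Q.source, Q y = z := ⟨Q.symm z, Q.map_target hz', Q.right_inv hz'⟩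
    rw [hQs] at hy
    exact (H y hy).1.2.2
  · change Q.symm x = 0
    rw [← hQ0]
    exact Q.left_inv h0r

end Darboux
end LagrangianCycles

end

/-! ### Two-simplices read in Darboux charts -/

noncomputable section

set_option linter.unusedSectionVars false
set_option maxSynthPendingDepth 4
namespace LagrangianCycles

section Planar
open Set Filter Topology

theorem planar_of_mem {N : Type u} [TopologicalSpace N] (σ : SingularTwoSimplex N) {p : ℝ × ℝ}
    (hp : p ∈ triangle) : σ.planar p = σ (trianglePoint p hp) := dif_pos hp

theorem comb_trianglePoint {F : Type*} [NormedAddCommGroup F] [NormedSpace ℝ F] (v : Tup F 2)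
    {p : ℝ × ℝ} (hp : p ∈ triangle) : comb v (trianglePoint p hp) = plane v p := by
  rw [comb_apply, plane]
  change ∑ i : Fin 3, (![1 - p.1 - p.2, p.1, p.2] i) • v i = _
  simp only [Fin.sum_univ_three, Matrix.cons_val]
  module

theorem planar_affSimplex {N : Type u} [TopologicalSpace N] {F : Type*} [NormedAddCommGroup F]
    [NormedSpace ℝ F] {G : F → N} {K : Set F} (hG : ContinuousOn G K) (hK : Convex ℝ K)
    {v : Tup F 2} (hv : v ∈ tupIn K 2) {p : ℝ × ℝ} (hp : p ∈ triangle) :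
    SingularTwoSimplex.planar (affSimplex G v) p = G (plane v p) := by
  rw [planar_of_mem _ hp, affSimplex_apply hG hK hv, comb_trianglePoint]

theorem alternating_apply_plane (A : (ℝ × ℝ) [⋀^Fin 2]→L[ℝ] ℝ) (u v : ℝ × ℝ) :
    A ![u, v] = (u.1 * v.2 - v.1 * u.2) * A ![(1, 0), (0, 1)] := by
  have upd : ∀ c z : ℝ × ℝ, Function.update ![0, c] 0 z = ![z, c] := fun c z => by
    ext i : 1
    fin_cases i <;> rfl
  have add0 : ∀ a b c : ℝ × ℝ, A ![a + b, c] = A ![a, c] + A ![b, c] := fun a b c => by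
    have := A.toMultilinearMap.map_update_add ![0, c] 0 a b
    rwa [upd, upd, upd] at this
  have smul0 : ∀ (r : ℝ) (a c : ℝ × ℝ), A ![r • a, c] = r * A ![a, c] := fun r a c => by
    have := A.toMultilinearMap.map_update_smul ![0, c] 0 r a
    rwa [upd, upd] at this
  have swap : ∀ a b : ℝ × ℝ, A ![a, b] = -A ![b, a] := fun a b => by
    have h := A.toAlternatingMap.map_swap ![b, a] (i := 0) (j := 1) (by decide)
    have h' : ![b, a] ∘ Equiv.swap (0 : Fin 2) 1 = ![a, b] := by
      ext i : 1
      fin_cases i <;> rfl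
    rwa [h'] at h
  have dec : ∀ w : ℝ × ℝ, w = w.1 • ((1, 0) : ℝ × ℝ) + w.2 • ((0, 1) : ℝ × ℝ) := fun w => by
    ext <;> simp
  have self : ∀ a : ℝ × ℝ, A ![a, a] = 0 := fun a => by linarith [swap a a]
  have lin : ∀ w c : ℝ × ℝ, A ![w, c] = w.1 * A ![(1, 0), c] + w.2 * A ![(0, 1), c] := fun w c => by
    conv_lhs => rw [dec w]
    rw [add0, smul0, smul0]
  rw [lin u v, swap (1, 0) v, swap (0, 1) v, lin v (1, 0), lin v (0, 1), self, self,
    swap (0, 1) (1, 0)]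
  ring

theorem alternating_eq_zero {A : (ℝ × ℝ) [⋀^Fin 2]→L[ℝ] ℝ} (h : A ![(1, 0), (0, 1)] = 0) :
    A = 0 := by
  ext w
  have : w = ![w 0, w 1] := by
    ext i : 1
    fin_cases i <;> rfl
  rw [this, alternating_apply_plane, h, mul_zero]
  rfl

variable {N : Type u} [TopologicalSpace N] [ChartedSpace E4 N] {ω : SymplecticForm N}

/-- A singular two-simplex read in a chart. -/
def readIn (D : DarbouxChart ω) (σ : SingularTwoSimplex N) (p : ℝ × ℝ) : E4 := D.chart (σ.planar p)

theorem contDiffWithinAt_readIn (D : DarbouxChart ω) {σ : SingularTwoSimplex N} (hσ : σ.IsC1)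
    {p : ℝ × ℝ} (hp : p ∈ triangle) (hD : σ.planar p ∈ D.chart.source) :
    ContDiffWithinAt ℝ 1 (readIn D σ) triangle p := by
  rw [← contMDiffWithinAt_iff_contDiffWithinAt]
  have h1 : ContMDiffAt (𝓡 4) 𝓘(ℝ, E4) 1 D.chart (σ.planar p) :=
    (D.contMDiffOn.contMDiffAt (D.chart.open_source.mem_nhds hD)).of_le (by norm_num)
  exact h1.comp_contMDiffWithinAt p (hσ p hp)

theorem pullback_eq (D : DarbouxChart ω) {σ : SingularTwoSimplex N} (hσ : σ.IsC1)
    {p : ℝ × ℝ} (hp : p ∈ triangle) (hD : σ.planar p ∈ D.chart.source) (u v : ℝ × ℝ) :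
    σ.pullback ω.form p ![u, v] = omega0 (fderivWithin ℝ (readIn D σ) triangle p u)
      (fderivWithin ℝ (readIn D σ) triangle p v) := by
  have ht : readIn D σ p ∈ D.chart.target := D.chart.map_source hD
  have h1 := ((contDiffWithinAt_readIn D hσ hp hD).differentiableWithinAt
    (by norm_num)).hasFDerivWithinAt.hasMFDerivWithinAt
  have h2 : HasMFDerivAt 𝓘(ℝ, E4) (𝓡 4) D.chart.symm (readIn D σ p)
      (mfderiv 𝓘(ℝ, E4) (𝓡 4) D.chart.symm (readIn D σ p)) :=
    ((D.contMDiffOn_symm.contMDiffAt (D.chart.open_target.mem_nhds ht)).mdifferentiableAt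
      (by norm_num)).hasMFDerivAt
  have h3 := h2.comp_hasMFDerivWithinAt p h1
  have heq : σ.planar =ᶠ[𝓝[triangle] p] D.chart.symm ∘ readIn D σ := by
    have := (hσ p hp).continuousWithinAt.eventually_mem (D.chart.open_source.mem_nhds hD)
    filter_upwards [this] with q hq
    exact (D.chart.left_inv hq).symm
  have hval : D.chart.symm (readIn D σ p) = σ.planar p := D.chart.left_inv hD
  have h4 := (h3.congr_of_eventuallyEq heq hval.symm).mfderivWithin
    (uniqueDiffOn_triangle p hp).uniqueMDiffWithinAt
  have h5 := D.symplectic _ ht (fderivWithin ℝ (readIn D σ) triangle p u)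
    (fderivWithin ℝ (readIn D σ) triangle p v)
  rw [← h5]
  -- The two forms are based at points that are equal only propositionally. The equality is
  -- eliminated first, so that only the images of the vectors in the model space have to be
  -- compared.
  have gen : ∀ (x y : N) (hxy : x = y) (L : (ℝ × ℝ) →L[ℝ] TangentSpace (𝓡 4) y)
      (L' : (ℝ × ℝ) →L[ℝ] TangentSpace (𝓡 4) x)
      (w : Fin 2 → ℝ × ℝ), (∀ i, (L (w i) : E4) = (L' (w i) : E4)) →
      (ω.form y).compContinuousLinearMap L w = (ω.form x).compContinuousLinearMap L' w := by
    rintro x y rfl L L' w h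
    change ω.form x _ = ω.form x _
    congr 1
    exact funext h
  refine (gen _ _ hval _ (mfderiv 𝓘(ℝ, E4) (𝓡 4) D.chart.symm (readIn D σ p) ∘L
    fderivWithin ℝ (readIn D σ) triangle p) ![u, v] ?_).trans ?_
  · intro i
    exact DFunLike.congr_fun h4 _
  · change ω.form _ _ = ω.form _ _
    congr 1
    ext i : 1
    fin_cases i <;> rfl

theorem isLagrangian_iff (D : DarbouxChart ω) {σ : SingularTwoSimplex N} (hσ : σ.IsC1)
    (hD : σ ∈ simpIn D.chart.source 2) :
    σ.IsLagrangian ω.form ↔ ∀ p ∈ triangle,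
      omega0 (fderivWithin ℝ (readIn D σ) triangle p (1, 0))
        (fderivWithin ℝ (readIn D σ) triangle p (0, 1)) = 0 := by
  have mem : ∀ p ∈ triangle, σ.planar p ∈ D.chart.source := fun p hp => by
    rw [planar_of_mem _ hp]
    exact hD ⟨_, rfl⟩
  constructor
  · intro h p hp
    rw [← pullback_eq D hσ hp (mem p hp), h.2 p hp]
    rfl
  · intro h
    exact ⟨hσ, fun p hp => alternating_eq_zero ((pullback_eq D hσ hp (mem p hp) _ _).trans (h p hp))⟩

/-- A simplex that is a `C^1` map in a chart is `C^1`. -/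
theorem isC1_of_readIn (D : DarbouxChart ω) {σ : SingularTwoSimplex N} {f : ℝ × ℝ → E4}
    (hf : ContDiffOn ℝ 1 f triangle) (hft : MapsTo f triangle D.chart.target)
    (h : ∀ p ∈ triangle, σ.planar p = D.chart.symm (f p)) : σ.IsC1 := by
  have h1 : ContMDiffOn 𝓘(ℝ, ℝ × ℝ) (𝓡 4) 1 (D.chart.symm ∘ f) triangle :=
    (D.contMDiffOn_symm.of_le (by norm_num)).comp hf.contMDiffOn hft
  exact h1.congr h

theorem readIn_eqOn (D : DarbouxChart ω) {σ : SingularTwoSimplex N} {f : ℝ × ℝ → E4}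
    (hft : MapsTo f triangle D.chart.target)
    (h : ∀ p ∈ triangle, σ.planar p = D.chart.symm (f p)) : EqOn (readIn D σ) f triangle :=
  fun p hp => by rw [readIn, h p hp, D.chart.right_inv (hft hp)]

/-- Reparametrization of a simplex by an affine map of the triangle into itself. -/
theorem isC1_reparam {σ τ : SingularTwoSimplex N} (hσ : σ.IsC1) {v : Tup (ℝ × ℝ) 2}
    (hv : v ∈ tupIn triangle 2) (h : ∀ p ∈ triangle, τ.planar p = σ.planar (plane v p)) :
    τ.IsC1 := by
  have h1 : ContMDiffOn 𝓘(ℝ, ℝ × ℝ) (𝓡 4) 1 (σ.planar ∘ plane v) triangle :=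
    ContMDiffOn.comp hσ (contDiff_plane v).contMDiff.contMDiffOn
      fun p hp => plane_mem convex_triangle hv hp
  exact h1.congr h

theorem pullback_reparam {σ τ : SingularTwoSimplex N} (hσ : σ.IsC1) {v : Tup (ℝ × ℝ) 2}
    (hv : v ∈ tupIn triangle 2) (h : ∀ p ∈ triangle, τ.planar p = σ.planar (plane v p))
    {p : ℝ × ℝ} (hp : p ∈ triangle) :
    τ.pullback ω.form p ![(1, 0), (0, 1)] =
      σ.pullback ω.form (plane v p) ![(1, 0), (0, 1)] * tdet v := by
  have hq := plane_mem convex_triangle hv hp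
  have h1 := ((hσ _ hq).mdifferentiableWithinAt (by norm_num)).hasMFDerivWithinAt
  have h2 := (hasFDerivAt_plane v p).hasFDerivWithinAt (s := triangle) |>.hasMFDerivWithinAt
  have h3 := h1.comp p h2 fun q hq => plane_mem convex_triangle hv hq
  have h4 := (h3.congr_of_eventuallyEq (eventually_mem_nhdsWithin.mono h) (h p hp)).mfderivWithin (uniqueDiffOn_triangle p hp).uniqueMDiffWithinAt
  have e1 := alternating_apply_plane (σ.pullback ω.form (plane v p)) (v 1 - v 0) (v 2 - v 0)
  rw [mul_comm, tdet, ← e1]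
  have gen : ∀ (x y : N) (hxy : x = y) (L : (ℝ × ℝ) →L[ℝ] TangentSpace (𝓡 4) y)
      (L' : (ℝ × ℝ) →L[ℝ] TangentSpace (𝓡 4) x)
      (w w' : Fin 2 → ℝ × ℝ), (∀ i, (L (w i) : E4) = (L' (w' i) : E4)) →
      (ω.form y).compContinuousLinearMap L w = (ω.form x).compContinuousLinearMap L' w' := by
    rintro x y rfl L L' w w' h
    change ω.form x _ = ω.form x _
    congr 1
    exact funext h
  refine gen _ _ (h p hp).symm _ _ _ _ fun i => ?_
  refine (DFunLike.congr_fun h4 _).trans ?_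
  change mfderivWithin _ _ _ _ _ _ = _
  congr 1
  fin_cases i
  · change (1 : ℝ) • (v 1 - v 0) + (0 : ℝ) • (v 2 - v 0) = v 1 - v 0
    simp
  · change (0 : ℝ) • (v 1 - v 0) + (1 : ℝ) • (v 2 - v 0) = v 2 - v 0
    simp

variable [IsManifold (𝓡 4) ((⊤ : ℕ∞) : WithTop ℕ∞) N]

/-- The density of the pullback of a symplectic form is continuous. -/
theorem continuousOn_pullback (ω : SymplecticForm N) {σ : SingularTwoSimplex N} (hσ : σ.IsC1) :
    ContinuousOn (fun p => σ.pullback ω.form p ![(1, 0), (0, 1)]) triangle := by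
  intro p hp
  obtain ⟨D, hD, -⟩ := exists_darbouxChart ω (σ.planar p) univ_mem
  have h1 : ContDiffWithinAt ℝ 0 (fderivWithin ℝ (readIn D σ) triangle) triangle p :=
    (contDiffWithinAt_readIn D hσ hp hD).fderivWithin_right uniqueDiffOn_triangle (by norm_num) hp
  have h2 := h1.continuousWithinAt
  have h3 : ContinuousWithinAt (fun p => omega0 (fderivWithin ℝ (readIn D σ) triangle p (1, 0))
      (fderivWithin ℝ (readIn D σ) triangle p (0, 1))) triangle p := by
    have hc : Continuous fun L : ℝ × ℝ →L[ℝ] E4 => omega0 (L (1, 0)) (L (0, 1)) := by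
      unfold omega0
      fun_prop
    exact hc.continuousAt.comp_continuousWithinAt h2
  refine h3.congr_of_eventuallyEq ?_ (pullback_eq D hσ hp hD _ _)
  have := (hσ p hp).continuousWithinAt.eventually_mem (D.chart.open_source.mem_nhds hD)
  filter_upwards [this, self_mem_nhdsWithin] with q hq hq'
  exact pullback_eq D hσ hq' hq _ _

end Planar
end LagrangianCycles

end

/-! ### Stokes' formula in a Darboux chart -/

noncomputable section

set_option linter.unusedSectionVars false
set_option maxSynthPendingDepth 4
namespace LagrangianCycles

section Stokes
open Set Filter Topology MeasureTheory

theorem ambient_face_two {N : Type u} [TopologicalSpace N] (σ : SingularTwoSimplex N) {t : ℝ}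
    (ht : t ∈ Icc (0 : ℝ) 1) :
    ambient (Simp.face (n := 1) 0 σ) ![1 - t, t] = σ.planar (1 - t, t) ∧
    ambient (Simp.face (n := 1) 1 σ) ![1 - t, t] = σ.planar (0, t) ∧
    ambient (Simp.face (n := 1) 2 σ) ![1 - t, t] = σ.planar (t, 0) := by
  have hx : ![1 - t, t] ∈ stdSimplex ℝ (Fin 2) := by
    refine ⟨fun i => ?_, by simp⟩
    fin_cases i
    · exact sub_nonneg.2 ht.2
    · exact ht.1
  have hpl : ∀ p : ℝ × ℝ, p ∈ triangle → σ.planar p = ambient (n := 2) σ ![1 - p.1 - p.2, p.1, p.2] :=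
    fun p hp => by
      rw [planar_of_mem _ hp]
      exact (ambient_coe (n := 2) σ (trianglePoint p hp)).symm
  have hlin : ∀ i : Fin 3, FunOnFinite.linearMap ℝ ℝ i.succAbove ![1 - t, t] =
      (1 - t) • stdTup 2 (i.succAbove 0) + t • stdTup 2 (i.succAbove 1) := by
    intro i
    rw [← comb_stdTup (n := 2) (FunOnFinite.linearMap ℝ ℝ i.succAbove ![1 - t, t]),
      comb_funOnFinite, comb_apply]
    simp [Fin.sum_univ_two]
  refine ⟨?_, ?_, ?_⟩
  · rw [ambient_face σ _ hx, hpl _ ⟨by simp [ht.2], ht.1, by simp⟩, Function.comp_apply, hlin]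
    congr 1
    ext j
    fin_cases j <;> simp [stdTup]
  · rw [ambient_face σ _ hx, hpl _ ⟨le_rfl, ht.1, by simpa using ht.2⟩, Function.comp_apply, hlin]
    congr 1
    ext j
    fin_cases j <;> simp [stdTup]
  · rw [ambient_face σ _ hx, hpl _ ⟨ht.1, le_rfl, by simpa using ht.2⟩, Function.comp_apply, hlin]
    have e : Fin.succAbove (2 : Fin 3) (1 : Fin 2) = 1 := rfl
    congr 1
    ext j
    fin_cases j <;> simp [stdTup, e]

/-- The integral of `x₀ dx₁ + x₂ dx₃` along a curve. -/
def action (g : ℝ → E4) : ℝ :=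
  ∫ t in (0 : ℝ)..1, (g t 0 * deriv (fun s => g s 1) t + g t 2 * deriv (fun s => g s 3) t)

/-- The derivative in `action` is two-sided, so its values at the end points depend on the curve off
the interval. Comparison on the open interval is enough. -/
theorem integral_congr_Ioo {f g : ℝ → ℝ} (h : ∀ t ∈ Ioo (0 : ℝ) 1, f t = g t) :
    ∫ t in (0 : ℝ)..1, f t = ∫ t in (0 : ℝ)..1, g t := by
  rw [intervalIntegral.integral_of_le zero_le_one, intervalIntegral.integral_of_le zero_le_one,
    integral_Ioc_eq_integral_Ioo, integral_Ioc_eq_integral_Ioo]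
  exact setIntegral_congr_fun measurableSet_Ioo h

theorem action_congr {g g' : ℝ → E4} (h : ∀ t ∈ Icc (0 : ℝ) 1, g t = g' t) :
    action g = action g' := by
  refine integral_congr_Ioo fun t ht => ?_
  have : g =ᶠ[𝓝 t] g' := by
    filter_upwards [Icc_mem_nhds ht.1 ht.2] with s hs using h s hs
  have e : ∀ j, deriv (fun s => g s j) t = deriv (fun s => g' s j) t := fun j =>
    Filter.EventuallyEq.deriv_eq (by filter_upwards [this] with s hs; rw [hs])
  rw [h t (Ioo_subset_Icc_self ht), e, e]

theorem contDiffOn_coord {f : ℝ × ℝ → E4} (hf : ContDiffOn ℝ 1 f triangle) (j : Fin 4) :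
    ContDiffOn ℝ 1 (fun p => f p j) triangle :=
  (EuclideanSpace.proj (𝕜 := ℝ) j).contDiff.comp_contDiffOn hf

theorem fderivWithin_coord {f : ℝ × ℝ → E4} (hf : ContDiffOn ℝ 1 f triangle) (j : Fin 4)
    {p : ℝ × ℝ} (hp : p ∈ triangle) (u : ℝ × ℝ) :
    fderivWithin ℝ (fun p => f p j) triangle p u = fderivWithin ℝ f triangle p u j := by
  have h := (EuclideanSpace.proj (𝕜 := ℝ) j : E4 →L[ℝ] ℝ).hasFDerivAt.comp_hasFDerivWithinAt p
    (hf.differentiableOn one_ne_zero p hp).hasFDerivWithinAt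
  exact DFunLike.congr_fun (h.fderivWithin (uniqueDiffOn_triangle p hp)) u

theorem action_comp {f : ℝ × ℝ → E4} (hf : ContDiffOn ℝ 1 f triangle) {ℓ : ℝ → ℝ × ℝ} {d : ℝ × ℝ}
    (hℓ : ∀ t, HasDerivAt ℓ d t) (hm : ∀ t ∈ Icc (0 : ℝ) 1, ℓ t ∈ triangle) :
    action (fun t => f (ℓ t)) =
      (∫ t in (0 : ℝ)..1, f (ℓ t) 0 * fderivWithin ℝ (fun p => f p 1) triangle (ℓ t) d) +
        ∫ t in (0 : ℝ)..1, f (ℓ t) 2 * fderivWithin ℝ (fun p => f p 3) triangle (ℓ t) d := by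
  have cℓ : ContinuousOn ℓ (Icc 0 1) := fun t _ => (hℓ t).continuousAt.continuousWithinAt
  have cont : ∀ i j : Fin 4, IntervalIntegrable
      (fun t => f (ℓ t) i * fderivWithin ℝ (fun p => f p j) triangle (ℓ t) d) volume 0 1 := by
    intro i j
    refine ContinuousOn.intervalIntegrable ?_
    rw [uIcc_of_le zero_le_one]
    exact ((contDiffOn_coord hf i).continuousOn.comp cℓ hm).mul
      (((continuousOn_fderivWithin_triangle (contDiffOn_coord hf j)).comp cℓ hm).clm_apply
        continuousOn_const)
  rw [← intervalIntegral.integral_add (cont 0 1) (cont 2 3)]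
  refine integral_congr_Ioo fun t ht => ?_
  have hd : ∀ j, deriv (fun s => f (ℓ s) j) t = fderivWithin ℝ (fun p => f p j) triangle (ℓ t) d := by
    intro j
    have h1 := ((contDiffOn_coord hf j).differentiableOn one_ne_zero _
      (hm t (Ioo_subset_Icc_self ht))).hasFDerivWithinAt
    have h2 := h1.comp_hasDerivWithinAt t (hℓ t).hasDerivWithinAt hm
    exact (h2.hasDerivAt (Icc_mem_nhds ht.1 ht.2)).deriv
  rw [hd, hd]

/-- **Stokes' formula** on the triangle for the standard symplectic form. -/
theorem stokes_triangle {f : ℝ × ℝ → E4} (hf : ContDiffOn ℝ 1 f triangle) :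
    ∫ p in triangle, omega0 (fderivWithin ℝ f triangle p (1, 0)) (fderivWithin ℝ f triangle p (0, 1)) =
      action (fun t => f (1 - t, t)) - action (fun t => f (0, t)) + action (fun t => f (t, 0)) := by
  have c := fun j => continuousOn_fderivWithin_triangle (contDiffOn_coord hf j)
  have int : ∀ i j : Fin 4, IntegrableOn (fun p => fderivWithin ℝ (fun p => f p i) triangle p (1, 0) *
      fderivWithin ℝ (fun p => f p j) triangle p (0, 1) -
      fderivWithin ℝ (fun p => f p i) triangle p (0, 1) *
        fderivWithin ℝ (fun p => f p j) triangle p (1, 0)) triangle := fun i j =>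
    ContinuousOn.integrableOn_compact isCompact_triangle
      ((((c i).clm_apply continuousOn_const).mul ((c j).clm_apply continuousOn_const)).sub
        (((c i).clm_apply continuousOn_const).mul ((c j).clm_apply continuousOn_const)))
  have h1 : ∫ p in triangle, omega0 (fderivWithin ℝ f triangle p (1, 0))
      (fderivWithin ℝ f triangle p (0, 1)) =
      ∫ p in triangle, ((fderivWithin ℝ (fun p => f p 0) triangle p (1, 0) *
      fderivWithin ℝ (fun p => f p 1) triangle p (0, 1) -
      fderivWithin ℝ (fun p => f p 0) triangle p (0, 1) *
        fderivWithin ℝ (fun p => f p 1) triangle p (1, 0)) +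
      (fderivWithin ℝ (fun p => f p 2) triangle p (1, 0) *
      fderivWithin ℝ (fun p => f p 3) triangle p (0, 1) -
      fderivWithin ℝ (fun p => f p 2) triangle p (0, 1) *
        fderivWithin ℝ (fun p => f p 3) triangle p (1, 0))) := by
    refine setIntegral_congr_fun isCompact_triangle.measurableSet fun p hp => ?_
    simp only [fderivWithin_coord hf _ hp, omega0]
    ring
  rw [h1, integral_add (int 0 1) (int 2 3),
    -- The form is `dx₀ ∧ dx₁ + dx₂ ∧ dx₃`, so Green's formula is applied to each of the two pairs
    -- of coordinates.
    green_triangle (contDiffOn_coord hf 0) (contDiffOn_coord hf 1),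
    green_triangle (contDiffOn_coord hf 2) (contDiffOn_coord hf 3),
    action_comp hf (ℓ := fun t => (1 - t, t)) (d := (-1, 1))
      (fun t => ((hasDerivAt_id t).const_sub 1).prodMk (hasDerivAt_id t))
      (fun t ht => ⟨by simp [ht.2], ht.1, by simp⟩),
    action_comp hf (ℓ := fun t => (0, t)) (d := (0, 1))
      (fun t => (hasDerivAt_const t 0).prodMk (hasDerivAt_id t))
      (fun t ht => ⟨le_rfl, ht.1, by simpa using ht.2⟩),
    action_comp hf (ℓ := fun t => (t, 0)) (d := (1, 0))
      (fun t => (hasDerivAt_id t).prodMk (hasDerivAt_const t 0))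
      (fun t ht => ⟨ht.1, le_rfl, by simpa using ht.2⟩)]
  ring

variable {N : Type u} [TopologicalSpace N] [ChartedSpace E4 N] {ω : SymplecticForm N}

/-- The action of a singular one-simplex read in a chart. -/
def edgeAction (D : DarbouxChart ω) : (Simp N 1 →₀ ℤ) →+ ℝ :=
  extend fun e => action fun t => D.chart (ambient e ![1 - t, t])

/-- Integration of the symplectic form over chains. -/
def area (ω : SymplecticForm N) : (Simp N 2 →₀ ℤ) →+ ℝ :=
  extend (SingularTwoSimplex.integral ω.form)

theorem integral_eq_area (c : TwoChain N) : c.integral ω = area ω c := by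
  simp only [TwoChain.integral, area, extend, Finsupp.liftAddHom_apply]
  refine Finsupp.sum_congr fun σ _ => ?_
  rw [zmultiplesHom_apply, zsmul_eq_mul]

/-- The `C^1` two-simplices. -/
def c1Simp (N : Type u) [TopologicalSpace N] [ChartedSpace E4 N] : Set (Simp N 2) :=
  {σ | SingularTwoSimplex.IsC1 σ}

theorem integral_eq_stokes (D : DarbouxChart ω) {σ : SingularTwoSimplex N} (hσ : σ.IsC1)
    (hD : σ ∈ simpIn D.chart.source 2) : σ.integral ω.form =
      action (fun t => readIn D σ (1 - t, t)) - action (fun t => readIn D σ (0, t)) +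
        action (fun t => readIn D σ (t, 0)) := by
  have mem : ∀ p ∈ triangle, σ.planar p ∈ D.chart.source := fun p hp => by
    rw [planar_of_mem _ hp]
    exact hD ⟨_, rfl⟩
  rw [← stokes_triangle fun p hp => contDiffWithinAt_readIn D hσ hp (mem p hp)]
  exact setIntegral_congr_fun isCompact_triangle.measurableSet fun p hp =>
    pullback_eq D hσ hp (mem p hp) _ _

/-- **Stokes' formula** in a Darboux chart. -/
theorem area_eq_edgeAction (D : DarbouxChart ω) {c : Simp N 2 →₀ ℤ}
    (hc : c ∈ chainsIn (c1Simp N ∩ simpIn D.chart.source 2)) :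
    area ω c = edgeAction D (bd 1 c) := by
  refine eqOn_chainsIn (f := area ω) (g := (edgeAction D).comp (bd 1)) (fun σ hσ => ?_) hc
  rw [area, extend_single, one_smul, integral_eq_stokes D hσ.1 hσ.2, AddMonoidHom.comp_apply,
    bd_single, Fin.sum_univ_three]
  have h0 : action (fun t => D.chart (ambient (Simp.face (n := 1) 0 σ) ![1 - t, t])) =
      action (fun t => readIn D σ (1 - t, t)) :=
    action_congr fun t ht => by rw [(ambient_face_two σ ht).1, readIn]
  have h1 : action (fun t => D.chart (ambient (Simp.face (n := 1) 1 σ) ![1 - t, t])) =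
      action (fun t => readIn D σ (0, t)) :=
    action_congr fun t ht => by rw [(ambient_face_two σ ht).2.1, readIn]
  have h2 : action (fun t => D.chart (ambient (Simp.face (n := 1) 2 σ) ![1 - t, t])) =
      action (fun t => readIn D σ (t, 0)) :=
    action_congr fun t ht => by rw [(ambient_face_two σ ht).2.2, readIn]
  simp only [map_add, map_zsmul, edgeAction, extend_single, h0, h1, h2]
  simp
  ring

end Stokes

/-! ### Invariance of the area under subdivision -/

section Subdivision
open Set Filter Topology MeasureTheory

variable {N : Type u} [TopologicalSpace N] [ChartedSpace E4 N] {ω : SymplecticForm N}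

/-- The plane coordinates of the standard simplex. -/
def planeCoord : (Fin 3 → ℝ) →ₗ[ℝ] ℝ × ℝ := (LinearMap.proj 1).prod (LinearMap.proj 2)

theorem planeCoord_mem {x : Fin 3 → ℝ} (hx : x ∈ stdSimplex ℝ (Fin 3)) : planeCoord x ∈ triangle := by
  refine ⟨hx.1 1, hx.1 2, ?_⟩
  have h := hx.2
  rw [Fin.sum_univ_three] at h
  have := hx.1 0
  change x 1 + x 2 ≤ 1
  linarith

theorem ambient_eq_planar (σ : SingularTwoSimplex N) {x : Fin 3 → ℝ} (hx : x ∈ stdSimplex ℝ (Fin 3)) :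
    ambient (n := 2) σ x = σ.planar (planeCoord x) := by
  rw [planar_of_mem _ (planeCoord_mem hx), ambient_of_mem _ hx]
  congr 1
  apply Subtype.ext
  have h := hx.2
  rw [Fin.sum_univ_three] at h
  ext i
  fin_cases i
  · exact (by linarith : x 0 = 1 - x 1 - x 2)
  · rfl
  · rfl

theorem planeCoord_comp_mem {n : ℕ} {v : Tup (Fin 3 → ℝ) n}
    (hv : v ∈ tupIn (stdSimplex ℝ (Fin 3)) n) : planeCoord ∘ v ∈ tupIn triangle n :=
  fun i => planeCoord_mem (hv i)

theorem planar_affSimplex_ambient (σ : SingularTwoSimplex N) {v : Tup (Fin 3 → ℝ) 2}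
    (hv : v ∈ tupIn (stdSimplex ℝ (Fin 3)) 2) {p : ℝ × ℝ} (hp : p ∈ triangle) :
    SingularTwoSimplex.planar (affSimplex (ambient (n := 2) σ) v) p =
      σ.planar (plane (planeCoord ∘ v) p) := by
  rw [planar_affSimplex (continuousOn_ambient (n := 2) σ) (convex_stdSimplex ℝ _) hv hp,
    ambient_eq_planar σ (plane_mem (convex_stdSimplex ℝ _) hv hp)]
  congr 1

theorem isC1_affSimplex_ambient {σ : SingularTwoSimplex N} (hσ : σ.IsC1) {v : Tup (Fin 3 → ℝ) 2}
    (hv : v ∈ tupIn (stdSimplex ℝ (Fin 3)) 2) :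
    SingularTwoSimplex.IsC1 (affSimplex (ambient (n := 2) σ) v) :=
  isC1_reparam hσ (planeCoord_comp_mem hv) fun _ hp => planar_affSimplex_ambient σ hv hp

theorem subdiv_mem_c1 (k : ℕ) {c : Simp N 2 →₀ ℤ} (hc : c ∈ chainsIn (c1Simp N)) :
    subdiv k 2 c ∈ chainsIn (c1Simp N) := by
  refine map_mem_of_chainsIn _ _ (fun σ hσ => ?_) hc
  rw [subdiv, natOp, extend_single, one_smul]
  exact map_mem_of_chainsIn (push (ambient σ)) _ (fun v hv => by
    rw [push_single]
    exact single_mem_chainsIn (isC1_affSimplex_ambient hσ hv) 1)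
    (SdIter_mem (convex_stdSimplex ℝ _) k (single_stdTup_mem 2))

variable [IsManifold (𝓡 4) ((⊤ : ℕ∞) : WithTop ℕ∞) N]

/-- The area of a subdivided `C^1` cycle. -/
theorem area_subdiv (ω : SymplecticForm N) (k : ℕ) {c : Simp N 2 →₀ ℤ}
    (hc : c ∈ chainsIn (c1Simp N)) (h : bd 1 c = 0) : area ω (subdiv k 2 c) = area ω c := by
  -- The homotopy between a chain and its subdivision consists of restrictions of `σ` to affine
  -- tetrahedra in a triangle. These are degenerate, so `tetraInt_eq_zero`, for the continuous
  -- density of the pullback, shows that their boundaries have no area.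
  have key : area ω (bd 2 (subdivT k 2 c)) = 0 := by
    refine map_mem_of_chainsIn ((area ω).comp ((bd 2).comp (subdivT k 2))) ⊥ (fun σ hσ => ?_) hc
    rw [AddSubgroup.mem_bot, AddMonoidHom.comp_apply, AddMonoidHom.comp_apply, subdivT, natOp,
      extend_single, one_smul]
    refine map_mem_of_chainsIn ((area ω).comp ((bd 2).comp (push (ambient σ)))) ⊥ (fun w hw => ?_)
      (SdTIter_mem (convex_stdSimplex ℝ _) k (single_stdTup_mem 2))
    rw [AddSubgroup.mem_bot, AddMonoidHom.comp_apply, AddMonoidHom.comp_apply,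
      bd_push (continuousOn_ambient σ) (convex_stdSimplex ℝ _) (single_mem_chainsIn hw 1), tbd_single]
    have hi : ∀ i : Fin 4, SingularTwoSimplex.integral ω.form
        (affSimplex (ambient (n := 2) σ) (w ∘ i.succAbove)) =
        areaInt (fun p => SingularTwoSimplex.pullback ω.form σ p ![(1, 0), (0, 1)])
          ((planeCoord ∘ w) ∘ i.succAbove) := by
      intro i
      have hv : w ∘ i.succAbove ∈ tupIn (stdSimplex ℝ (Fin 3)) 2 := fun j => hw _
      exact setIntegral_congr_fun isCompact_triangle.measurableSet fun p hp =>
        pullback_reparam hσ (planeCoord_comp_mem hv)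
          (fun _ hp => planar_affSimplex_ambient σ hv hp) hp
    rw [← tetraInt_eq_zero (continuousOn_pullback ω hσ) (planeCoord_comp_mem hw), tetraInt]
    simp only [map_sum, map_zsmul, push_single, area, extend_single, hi, one_smul, zsmul_eq_mul]
    simp
  rw [bd_subdivT, h, map_zero, sub_zero, map_sub] at key
  linarith

end Subdivision
end LagrangianCycles

end

/-! ### Arcs modulo affine edges and boundaries of lagrangian chains -/

noncomputable section

set_option linter.unusedSectionVars false
set_option maxSynthPendingDepth 4
namespace LagrangianCycles

section Curves
open Set Filter Topology

variable {N : Type u} [TopologicalSpace N] [ChartedSpace E4 N] {ω : SymplecticForm N}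

variable {F : Type*} [NormedAddCommGroup F] [NormedSpace ℝ F] {K : Set F} {h : F → E4}

theorem affSimplex_mem_simpIn (D : DarbouxChart ω) (hK : Convex ℝ K) (hh : ContinuousOn h K)
    (hb : MapsTo h K D.chart.target) {n : ℕ} {v : Tup F n} (hv : v ∈ tupIn K n) :
    affSimplex (D.chart.symm ∘ h) v ∈ simpIn D.chart.source n := by
  rintro _ ⟨x, rfl⟩
  rw [affSimplex_apply (D.chart.continuousOn_symm.comp hh hb) hK hv]
  exact D.chart.map_target (hb (comb_mem hK hv x.2))

theorem planar_affSimplex_symm (D : DarbouxChart ω) (hK : Convex ℝ K) (hh : ContinuousOn h K)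
    (hb : MapsTo h K D.chart.target) {v : Tup F 2} (hv : v ∈ tupIn K 2) {p : ℝ × ℝ}
    (hp : p ∈ triangle) : SingularTwoSimplex.planar (affSimplex (D.chart.symm ∘ h) v) p =
      D.chart.symm (h (plane v p)) :=
  planar_affSimplex (D.chart.continuousOn_symm.comp hh hb) hK hv hp

theorem contDiffOn_comp_plane (hK : Convex ℝ K) (hh : ContDiffOn ℝ 1 h K) {v : Tup F 2}
    (hv : v ∈ tupIn K 2) : ContDiffOn ℝ 1 (fun p => h (plane v p)) triangle :=
  hh.comp (contDiff_plane v).contDiffOn fun _ hp => plane_mem hK hv hp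

/-- Affine simplices in a `C^1` parametrized family are `C^1`. -/
theorem isC1_affSimplex (D : DarbouxChart ω) (hK : Convex ℝ K) (hh : ContDiffOn ℝ 1 h K)
    (hb : MapsTo h K D.chart.target) {v : Tup F 2} (hv : v ∈ tupIn K 2) :
    SingularTwoSimplex.IsC1 (affSimplex (D.chart.symm ∘ h) v) :=
  isC1_of_readIn D (contDiffOn_comp_plane hK hh hv) (fun _ hp => hb (plane_mem hK hv hp))
    fun _ hp => planar_affSimplex_symm D hK hh.continuousOn hb hv hp

/-- The lagrangian simplices in a chart. -/
def lagIn (D : DarbouxChart ω) : Set (Simp N 2) :=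
  {σ | SingularTwoSimplex.IsLagrangian ω.form σ ∧ σ ∈ simpIn D.chart.source 2}

/-- By the chain rule the coordinate vectors of the triangle are sent to the derivatives of `h`
along two edges of the affine simplex. The single condition `hl` thus covers isotropic triangles,
pieces of curves and strips. -/
theorem affSimplex_mem_lagIn (D : DarbouxChart ω) (hK : Convex ℝ K)
    (hh : ∀ q ∈ K, ContDiffAt ℝ 1 h q) (hb : MapsTo h K D.chart.target) {v : Tup F 2}
    (hv : v ∈ tupIn K 2)
    (hl : ∀ q ∈ K, omega0 (fderiv ℝ h q (v 1 - v 0)) (fderiv ℝ h q (v 2 - v 0)) = 0) :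
    affSimplex (D.chart.symm ∘ h) v ∈ lagIn D := by
  have hh' : ContDiffOn ℝ 1 h K := fun q hq => (hh q hq).contDiffWithinAt
  have hD := affSimplex_mem_simpIn D hK hh'.continuousOn hb hv
  have h1 := isC1_affSimplex D hK hh' hb hv
  refine ⟨(isLagrangian_iff D h1 hD).2 fun p hp => ?_, hD⟩
  have heq : EqOn (readIn D (affSimplex (D.chart.symm ∘ h) v)) (fun p => h (plane v p)) triangle :=
    readIn_eqOn D (fun _ hp => hb (plane_mem hK hv hp))
      fun _ hp => planar_affSimplex_symm D hK hh'.continuousOn hb hv hp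
  have hq := plane_mem hK hv hp
  have hd := (((hh _ hq).differentiableAt (by norm_num)).hasFDerivAt.comp p (hasFDerivAt_plane v p))
  rw [fderivWithin_congr heq (heq hp)]
  have e := hd.hasFDerivWithinAt.fderivWithin (uniqueDiffOn_triangle p hp)
  rw [Function.comp_def] at e
  rw [e]
  simpa using hl _ hq

/-- The one-chains in a chart that are sums of affine edges and boundaries of lagrangian chains. -/
def lagEdges (D : DarbouxChart ω) : AddSubgroup (Simp N 1 →₀ ℤ) :=
  (chainsIn (lagIn D)).map (bd 1) ⊔ (chainsIn (tupIn D.chart.target 1)).map (push D.chart.symm)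

theorem bd_mem_lagEdges (D : DarbouxChart ω) {c : Simp N 2 →₀ ℤ} (hc : c ∈ chainsIn (lagIn D)) :
    bd 1 c ∈ lagEdges D := AddSubgroup.mem_sup_left ⟨c, hc, rfl⟩

theorem push_mem_lagEdges (D : DarbouxChart ω) {c : Tup E4 1 →₀ ℤ}
    (hc : c ∈ chainsIn (tupIn D.chart.target 1)) : push D.chart.symm c ∈ lagEdges D :=
  AddSubgroup.mem_sup_right ⟨c, hc, rfl⟩

theorem convex_target (D : DarbouxChart ω) : Convex ℝ D.chart.target := by
  rw [D.target_eq]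
  exact convex_ball _ _

theorem tbd_one_single {F : Type*} [AddCommGroup F] [Module ℝ F] (v : Tup F 2) : tbd 1 (Finsupp.single v 1) =
    Finsupp.single ![v 1, v 2] 1 - Finsupp.single ![v 0, v 2] 1 + Finsupp.single ![v 0, v 1] (1 : ℤ) := by
  rw [tbd_single, Fin.sum_univ_three]
  have e : ∀ (i : Fin 3), v ∘ i.succAbove = ![v (i.succAbove 0), v (i.succAbove 1)] := fun i => by
    ext j : 1
    fin_cases j <;> rfl
  have e2 : Fin.succAbove (2 : Fin 3) (1 : Fin 2) = 1 := rfl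
  simp only [e, e2]
  simp
  abel

/-- The singular edge given by the part of a curve over an interval. -/
def arc (D : DarbouxChart ω) (γ : ℝ → E4) (a b : ℝ) : Simp N 1 →₀ ℤ :=
  Finsupp.single (affSimplex (D.chart.symm ∘ γ) ![a, b]) 1

theorem arc_eq_push (D : DarbouxChart ω) (γ : ℝ → E4) (a b : ℝ) :
    arc D γ a b = push (D.chart.symm ∘ γ) (Finsupp.single ![a, b] 1) := by
  rw [push_single, arc]

theorem triple_mem {F : Type*} {K : Set F} {a b c : F} (ha : a ∈ K) (hb : b ∈ K) (hc : c ∈ K) :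
    (![a, b, c] : Tup F 2) ∈ tupIn K 2 := fun i => by fin_cases i <;> assumption

theorem pair_mem {F : Type*} {K : Set F} {a b : F} (ha : a ∈ K) (hb : b ∈ K) :
    (![a, b] : Tup F 1) ∈ tupIn K 1 := fun i => by fin_cases i <;> assumption

/-- The part of a smooth curve over the concatenation of two intervals. -/
theorem arc_add_mem (D : DarbouxChart ω) {γ : ℝ → E4} {I : Set ℝ} (hI : Convex ℝ I)
    (hγ : ∀ t ∈ I, ContDiffAt ℝ 1 γ t) (hb : MapsTo γ I D.chart.target) {a b c : ℝ} (ha : a ∈ I)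
    (hb' : b ∈ I) (hc : c ∈ I) : arc D γ a b + arc D γ b c - arc D γ a c ∈ lagEdges D := by
  have hv := triple_mem ha hb' hc
  -- The two-simplex with vertices `a`, `b`, `c` on the line is mapped into a curve. Its tangent
  -- vectors are parallel, so it is lagrangian, and its boundary is the required combination of
  -- arcs.
  have h1 := affSimplex_mem_lagIn D hI hγ hb hv fun q _ => by
    have : ∀ x : ℝ, fderiv ℝ γ q x = x • fderiv ℝ γ q 1 := fun x => by
      rw [← map_smul, smul_eq_mul, mul_one]
    rw [this, this (_ - _), omega0_smul_left, omega0_smul_right, omega0_self]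
    ring
  have h2 := bd_mem_lagEdges D (single_mem_chainsIn h1 1)
  have hc : ContinuousOn γ I := fun t ht => (hγ t ht).continuousAt.continuousWithinAt
  rw [← push_single, bd_push (D.chart.continuousOn_symm.comp hc hb) hI (single_mem_chainsIn hv 1),
    tbd_one_single, map_add, map_sub, ← arc_eq_push, ← arc_eq_push, ← arc_eq_push] at h2
  convert h2 using 1
  simp
  abel

theorem comb_pair {F : Type*} [NormedAddCommGroup F] [NormedSpace ℝ F] (a b : F) (z : Fin 2 → ℝ) :
    comb (n := 1) ![a, b] z = z 0 • a + z 1 • b := by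
  rw [comb_apply, Fin.sum_univ_two]
  rfl

/-- An arc of an affine curve is an affine edge. -/
theorem arc_lineMap_mem (D : DarbouxChart ω) {γ : ℝ → E4} {a b : ℝ} (x y : E4)
    (h : ∀ t ∈ uIcc a b, γ t = x + t • y) (hm : MapsTo γ (uIcc a b) D.chart.target) :
    arc D γ a b ∈ lagEdges D := by
  have hc : ContinuousOn γ (uIcc a b) := ContinuousOn.congr (by fun_prop) h
  have e : affSimplex (D.chart.symm ∘ γ) ![a, b] = affSimplex D.chart.symm ![γ a, γ b] := by
    have h0 : (![a, b] : Tup ℝ 1) ∈ tupIn (uIcc a b) 1 := pair_mem left_mem_uIcc right_mem_uIcc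
    ext z
    refine (affSimplex_apply (D.chart.continuousOn_symm.comp hc hm) (convex_uIcc a b) h0 z).trans ?_
    rw [affSimplex_apply D.chart.continuousOn_symm (convex_target D)
        (pair_mem (hm left_mem_uIcc) (hm right_mem_uIcc)), Function.comp_apply,
      h (comb ![a, b] z) (comb_mem (convex_uIcc a b) h0 z.2)]
    obtain ⟨z, -, hz⟩ := z
    rw [Fin.sum_univ_two] at hz
    change D.chart.symm (x + comb ![a, b] z • y) = D.chart.symm (comb ![γ a, γ b] z)
    rw [comb_pair, comb_pair, h a left_mem_uIcc, h b right_mem_uIcc, smul_eq_mul, smul_eq_mul]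
    have : x = (z 0 + z 1) • x := by rw [hz, one_smul]
    congr 1
    conv_lhs => rw [this]
    module
  rw [arc, e, ← push_single]
  exact push_mem_lagEdges D (single_mem_chainsIn (pair_mem (hm left_mem_uIcc) (hm right_mem_uIcc)) 1)

theorem arc_refl_mem (D : DarbouxChart ω) {γ : ℝ → E4} {a : ℝ} (ha : γ a ∈ D.chart.target) :
    arc D γ a a ∈ lagEdges D :=
  arc_lineMap_mem D (γ a) 0 (fun t ht => by
    rw [uIcc_self, mem_singleton_iff] at ht
    simp [ht]) fun t ht => by
    rw [uIcc_self, mem_singleton_iff] at ht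
    rwa [ht]

theorem arc_congr (D : DarbouxChart ω) {γ γ' : ℝ → E4} {a b : ℝ} (h : EqOn γ γ' (uIcc a b))
    (hc : ContinuousOn γ (uIcc a b)) (hm : MapsTo γ (uIcc a b) D.chart.target) :
    arc D γ a b = arc D γ' a b := by
  rw [arc, arc, affSimplex_congr (G' := D.chart.symm ∘ γ') (D.chart.continuousOn_symm.comp hc hm)
    (convex_uIcc a b) (fun t ht => congrArg D.chart.symm (h ht))
    (pair_mem left_mem_uIcc right_mem_uIcc)]

end Curves
end LagrangianCycles

end

/-! ### Strips of segments between two curves -/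

noncomputable section

set_option linter.unusedSectionVars false
set_option maxSynthPendingDepth 4
namespace LagrangianCycles

section Sweep
open Set Filter Topology

theorem affSimplex_eq {N F F' : Type*} [TopologicalSpace N] [NormedAddCommGroup F] [NormedSpace ℝ F]
    [NormedAddCommGroup F'] [NormedSpace ℝ F'] {G : F → N} {G' : F' → N} {K : Set F} {K' : Set F'}
    (hG : ContinuousOn G K) (hK : Convex ℝ K) (hG' : ContinuousOn G' K') (hK' : Convex ℝ K')
    {v w : F} {v' w' : F'} (hv : v ∈ K) (hw : w ∈ K) (hv' : v' ∈ K') (hw' : w' ∈ K')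
    (h : ∀ a b : ℝ, 0 ≤ a → 0 ≤ b → a + b = 1 → G (a • v + b • w) = G' (a • v' + b • w')) :
    affSimplex (n := 1) G ![v, w] = affSimplex (n := 1) G' ![v', w'] := by
  ext z
  rw [affSimplex_apply hG hK (pair_mem hv hw), affSimplex_apply hG' hK' (pair_mem hv' hw')]
  obtain ⟨z, hz0, hz⟩ := z
  rw [Fin.sum_univ_two] at hz
  change G (comb ![v, w] z) = G' (comb ![v', w'] z)
  rw [comb_pair, comb_pair, h _ _ (hz0 0) (hz0 1) hz]

/-- The square over an interval, cut into two triangles. -/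
def squareTup (t₀ t : ℝ) : Tup (ℝ × ℝ) 2 →₀ ℤ :=
  Finsupp.single ![(0, t₀), (1, t₀), (1, t)] 1 - Finsupp.single ![(0, t₀), (0, t), (1, t)] 1

theorem tbd_squareTup (t₀ t : ℝ) : tbd 1 (squareTup t₀ t) =
    Finsupp.single ![((0 : ℝ), t₀), (1, t₀)] 1 + Finsupp.single ![((1 : ℝ), t₀), (1, t)] 1 -
      Finsupp.single ![((0 : ℝ), t), (1, t)] 1 - Finsupp.single ![((0 : ℝ), t₀), (0, t)] 1 := by
  rw [squareTup, map_sub, tbd_one_single, tbd_one_single]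
  simp only [Matrix.cons_val]
  abel

theorem squareTup_mem (t₀ t : ℝ) :
    squareTup t₀ t ∈ chainsIn (tupIn (Icc (0 : ℝ) 1 ×ˢ uIcc t₀ t) 2) := by
  have h0 : (0 : ℝ) ∈ Icc (0 : ℝ) 1 := by simp
  have h1 : (1 : ℝ) ∈ Icc (0 : ℝ) 1 := by simp
  refine sub_mem (single_mem_chainsIn (triple_mem ?_ ?_ ?_) 1)
    (single_mem_chainsIn (triple_mem ?_ ?_ ?_) 1) <;> exact ⟨by assumption, by simp⟩

theorem convex_square (t₀ t : ℝ) : Convex ℝ (Icc (0 : ℝ) 1 ×ˢ uIcc t₀ t) :=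
  (convex_Icc 0 1).prod (convex_uIcc t₀ t)

/-- The straight homotopy between two curves. -/
def homotopy (a a₁ : ℝ → E4) (q : ℝ × ℝ) : E4 := a q.2 + q.1 • (a₁ q.2 - a q.2)

variable {N : Type u} [TopologicalSpace N] [ChartedSpace E4 N] {ω : SymplecticForm N}

theorem mapsTo_homotopy (D : DarbouxChart ω) {a a₁ : ℝ → E4} {I : Set ℝ}
    (hb : MapsTo a I D.chart.target) (hb₁ : MapsTo a₁ I D.chart.target) :
    MapsTo (homotopy a a₁) (Icc (0 : ℝ) 1 ×ˢ I) D.chart.target := fun q hq => by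
  have := (convex_target D).add_smul_sub_mem (hb hq.2) (hb₁ hq.2) hq.1
  exact this

/-- The boundary of the simplices of a straight homotopy between two curves. -/
theorem bd_push_homotopy (D : DarbouxChart ω) {a a₁ : ℝ → E4} {t₀ t : ℝ}
    (ha : ContinuousOn a (uIcc t₀ t)) (ha₁ : ContinuousOn a₁ (uIcc t₀ t))
    (hb : MapsTo a (uIcc t₀ t) D.chart.target) (hb₁ : MapsTo a₁ (uIcc t₀ t) D.chart.target) :
    bd 1 (push (D.chart.symm ∘ homotopy a a₁) (squareTup t₀ t)) =
      push D.chart.symm (Finsupp.single ![a t₀, a₁ t₀] 1) + arc D a₁ t₀ t -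
        push D.chart.symm (Finsupp.single ![a t, a₁ t] 1) - arc D a t₀ t := by
  have hc : ContinuousOn (homotopy a a₁) (Icc (0 : ℝ) 1 ×ˢ uIcc t₀ t) := by
    have e : MapsTo (Prod.snd : ℝ × ℝ → ℝ) (Icc (0 : ℝ) 1 ×ˢ uIcc t₀ t) (uIcc t₀ t) := fun q hq => hq.2
    unfold homotopy
    have h1 := ha.comp continuousOn_snd e
    have h2 := ha₁.comp continuousOn_snd e
    exact h1.add (continuousOn_fst.smul (h2.sub h1))
  have hG := D.chart.continuousOn_symm.comp hc (mapsTo_homotopy D hb hb₁)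
  have hK := convex_square t₀ t
  have h0 : (0 : ℝ) ∈ Icc (0 : ℝ) 1 := by simp
  have h1 : (1 : ℝ) ∈ Icc (0 : ℝ) 1 := by simp
  have i0 : t₀ ∈ uIcc t₀ t := left_mem_uIcc
  have i1 : t ∈ uIcc t₀ t := right_mem_uIcc
  have radial : ∀ τ ∈ uIcc t₀ t, affSimplex (D.chart.symm ∘ homotopy a a₁) ![(0, τ), (1, τ)] =
      affSimplex (n := 1) D.chart.symm ![a τ, a₁ τ] := fun τ hτ => by
    refine affSimplex_eq hG hK D.chart.continuousOn_symm (convex_target D) ⟨h0, hτ⟩ ⟨h1, hτ⟩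
      (hb hτ) (hb₁ hτ) fun r s _ _ hrs => ?_
    have e : r * τ + s * τ = τ := by rw [← add_mul, hrs, one_mul]
    have e' : r • a τ = a τ - s • a τ := by
      rw [eq_sub_iff_add_eq, ← add_smul, hrs, one_smul]
    simp [homotopy, e, e', smul_sub]
    congr 1
    abel
  have side : ∀ (s : ℝ), s ∈ Icc (0 : ℝ) 1 → ∀ b : ℝ → E4, ContinuousOn b (uIcc t₀ t) →
      MapsTo b (uIcc t₀ t) D.chart.target → (∀ τ, homotopy a a₁ (s, τ) = b τ) →
      affSimplex (D.chart.symm ∘ homotopy a a₁) ![(s, t₀), (s, t)] =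
      affSimplex (n := 1) (D.chart.symm ∘ b) ![t₀, t] := fun s hs b hbc hbm hh => by
    refine affSimplex_eq hG hK (D.chart.continuousOn_symm.comp hbc hbm) (convex_uIcc t₀ t) ⟨hs, i0⟩
      ⟨hs, i1⟩ i0 i1 fun r r' _ _ hr => ?_
    have e : r * s + r' * s = s := by rw [← add_mul, hr, one_mul]
    simp [e, hh]
  rw [bd_push hG hK (squareTup_mem t₀ t), tbd_squareTup]
  simp only [map_sub, map_add, push_single, arc, radial t₀ i0, radial t i1,
    side 0 h0 a ha hb fun τ => by simp [homotopy],
    side 1 h1 a₁ ha₁ hb₁ fun τ => by simp [homotopy]]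

theorem fderiv_homotopy_apply {a a₁ : ℝ → E4} {q : ℝ × ℝ} (ha : DifferentiableAt ℝ a q.2)
    (ha₁ : DifferentiableAt ℝ a₁ q.2) (v : ℝ × ℝ) : fderiv ℝ (homotopy a a₁) q v =
      v.1 • (a₁ q.2 - a q.2) + v.2 • (deriv a q.2 + q.1 • (deriv a₁ q.2 - deriv a q.2)) := by
  have h1 := ha.hasDerivAt.hasFDerivAt.comp q (hasFDerivAt_snd (𝕜 := ℝ))
  have h2 := ha₁.hasDerivAt.hasFDerivAt.comp q (hasFDerivAt_snd (𝕜 := ℝ))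
  have h3 := h1.add ((hasFDerivAt_fst (𝕜 := ℝ) (p := q)).smul (h2.sub h1))
  have h4 := h3.fderiv
  have e : fderiv ℝ (homotopy a a₁) q v = _ := DFunLike.congr_fun h4 v
  rw [e]
  simp
  module

/-- Two curves that are joined by a lagrangian strip of segments. -/
theorem sweep_mem (D : DarbouxChart ω) {a a₁ : ℝ → E4} {t₀ t : ℝ}
    (ha : ∀ τ ∈ uIcc t₀ t, ContDiffAt ℝ 1 a τ) (ha₁ : ∀ τ ∈ uIcc t₀ t, ContDiffAt ℝ 1 a₁ τ)
    (hb : MapsTo a (uIcc t₀ t) D.chart.target) (hb₁ : MapsTo a₁ (uIcc t₀ t) D.chart.target)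
    (h : ∀ τ ∈ uIcc t₀ t, omega0 (a₁ τ - a τ) (deriv a τ) = 0)
    (h₁ : ∀ τ ∈ uIcc t₀ t, omega0 (a₁ τ - a τ) (deriv a₁ τ) = 0) (hm : arc D a₁ t₀ t ∈ lagEdges D) :
    arc D a t₀ t ∈ lagEdges D := by
  have key := bd_push_homotopy D (fun τ hτ => (ha τ hτ).continuousAt.continuousWithinAt)
    (fun τ hτ => (ha₁ τ hτ).continuousAt.continuousWithinAt) hb hb₁
  have hd : ∀ q ∈ Icc (0 : ℝ) 1 ×ˢ uIcc t₀ t, ContDiffAt ℝ 1 (homotopy a a₁) q := fun q hq => by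
    have h1 : ContDiffAt ℝ 1 (fun q : ℝ × ℝ => a q.2) q := (ha _ hq.2).comp q contDiffAt_snd
    have h2 : ContDiffAt ℝ 1 (fun q : ℝ × ℝ => a₁ q.2) q := (ha₁ _ hq.2).comp q contDiffAt_snd
    exact h1.add (contDiffAt_fst.smul (h2.sub h1))
  have hl : push (D.chart.symm ∘ homotopy a a₁) (squareTup t₀ t) ∈ chainsIn (lagIn D) := by
    refine map_mem_of_chainsIn _ _ (fun v hv => ?_) (squareTup_mem t₀ t)
    rw [push_single]
    refine single_mem_chainsIn (affSimplex_mem_lagIn D (convex_square t₀ t) hd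
      (mapsTo_homotopy D hb hb₁) hv fun q hq => ?_) 1
    have d := (ha _ hq.2).differentiableAt (by norm_num)
    have d₁ := (ha₁ _ hq.2).differentiableAt (by norm_num)
    rw [fderiv_homotopy_apply d d₁, fderiv_homotopy_apply d d₁]
    have e1 := h _ hq.2
    have e2 := h₁ _ hq.2
    simp only [omega0, PiLp.add_apply, PiLp.sub_apply, PiLp.smul_apply, smul_eq_mul] at e1 e2 ⊢
    -- On a strip the form pairs the direction of the segments with the velocity, which interpolates
    -- linearly between those of the two curves. The first factor is the determinant of the plane
    -- vectors.
    linear_combination (((v 1 - v 0).1 * (v 2 - v 0).2 - (v 1 - v 0).2 * (v 2 - v 0).1) *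
      ((1 - q.1) * e1 + q.1 * e2))
  have h2 := bd_mem_lagEdges D hl
  rw [key] at h2
  have e1 := push_mem_lagEdges D (single_mem_chainsIn
    (pair_mem (hb left_mem_uIcc) (hb₁ left_mem_uIcc)) 1)
  have e2 := push_mem_lagEdges D (single_mem_chainsIn
    (pair_mem (hb right_mem_uIcc) (hb₁ right_mem_uIcc)) 1)
  have := sub_mem (sub_mem (add_mem e1 hm) e2) h2
  convert this using 1
  abel

end Sweep
end LagrangianCycles

end

/-! ### Straightening regular arcs through lagrangian strips -/

noncomputable section

set_option linter.unusedSectionVars false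
set_option maxSynthPendingDepth 4
namespace LagrangianCycles

section Straightening
open Set Filter Topology

/-- The standard symplectic form as a bilinear map. -/
def omegaB : E4 →L[ℝ] E4 →L[ℝ] ℝ :=
  let π := fun i : Fin 4 => (EuclideanSpace.proj i : E4 →L[ℝ] ℝ)
  (π 0).smulRight (π 1) - (π 1).smulRight (π 0) + ((π 2).smulRight (π 3) - (π 3).smulRight (π 2))

theorem omegaB_apply (u v : E4) : omegaB u v = omega0 u v := by
  simp [omegaB, omega0]

theorem deriv_coord {a : ℝ → E4} {t : ℝ} (h : DifferentiableAt ℝ a t) (j : Fin 4) :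
    deriv a t j = deriv (fun s => a s j) t :=
  ((EuclideanSpace.proj j : E4 →L[ℝ] ℝ).hasFDerivAt.comp_hasDerivAt t h.hasDerivAt).deriv.symm

variable {N : Type u} [TopologicalSpace N] [ChartedSpace E4 N] {ω : SymplecticForm N}

theorem sweep_comp_mem (D : DarbouxChart ω) {L : E4 ≃L[ℝ] E4}
    (hL : ∀ u v, omega0 (L u) (L v) = omega0 u v) {a a₁ : ℝ → E4} {t₀ t : ℝ}
    (ha : ∀ τ ∈ uIcc t₀ t, ContDiffAt ℝ 1 a τ) (ha₁ : ∀ τ ∈ uIcc t₀ t, ContDiffAt ℝ 1 a₁ τ)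
    (hb : MapsTo (L ∘ a) (uIcc t₀ t) D.chart.target)
    (hb₁ : MapsTo (L ∘ a₁) (uIcc t₀ t) D.chart.target)
    (h : ∀ τ ∈ uIcc t₀ t, omega0 (a₁ τ - a τ) (deriv a τ) = 0)
    (h₁ : ∀ τ ∈ uIcc t₀ t, omega0 (a₁ τ - a τ) (deriv a₁ τ) = 0)
    (hm : arc D (L ∘ a₁) t₀ t ∈ lagEdges D) : arc D (L ∘ a) t₀ t ∈ lagEdges D := by
  have hd : ∀ {b : ℝ → E4} {τ : ℝ}, ContDiffAt ℝ 1 b τ → deriv (L ∘ b) τ = L (deriv b τ) :=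
    fun hb => (L.hasFDerivAt.comp_hasDerivAt _
      (hb.differentiableAt (by norm_num)).hasDerivAt).deriv
  refine sweep_mem D (fun τ hτ => L.contDiff.contDiffAt.comp τ (ha τ hτ))
    (fun τ hτ => L.contDiff.contDiffAt.comp τ (ha₁ τ hτ)) hb hb₁ (fun τ hτ => ?_) (fun τ hτ => ?_) hm
  · rw [hd (ha τ hτ), Function.comp_apply, Function.comp_apply, ← map_sub, hL, h τ hτ]
  · rw [hd (ha₁ τ hτ), Function.comp_apply, Function.comp_apply, ← map_sub, hL, h₁ τ hτ]

theorem contDiffAt_vec {x y z w : ℝ → ℝ} {t : ℝ} (hx : ContDiffAt ℝ 1 x t) (hy : ContDiffAt ℝ 1 y t)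
    (hz : ContDiffAt ℝ 1 z t) (hw : ContDiffAt ℝ 1 w t) :
    ContDiffAt ℝ 1 (fun s => (!₂[x s, y s, z s, w s] : E4)) t := by
  rw [contDiffAt_euclidean]
  intro i
  fin_cases i
  · exact hx
  · exact hy
  · exact hz
  · exact hw

/-- A short arc of a curve whose first coordinate has nonzero speed is joined by lagrangian strips
to a point. -/
theorem eventually_arc_mem_of_coord (D : DarbouxChart ω) {L : E4 ≃L[ℝ] E4}
    (hL : ∀ u v, omega0 (L u) (L v) = omega0 u v) {g : ℝ → E4} (hg : ContDiff ℝ 2 g) {t₀ : ℝ}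
    (h0 : deriv (fun t => g t 0) t₀ ≠ 0) (hm : L (g t₀) ∈ D.chart.target) :
    ∀ᶠ t in 𝓝 t₀, arc D (L ∘ g) t₀ t ∈ lagEdges D := by
  have hgi : ∀ i, ContDiff ℝ 2 fun t => g t i := fun i => contDiff_euclidean.1 hg i
  set x₁ := fun t => g t 0 with hx₁
  set y₁ := fun t => g t 1 with hy₁
  set x₂ := fun t => g t 2 with hx₂
  set y₂ := fun t => g t 3 with hy₂
  have cx₁ : ContDiff ℝ 2 x₁ := hgi 0
  have cy₁ : ContDiff ℝ 2 y₁ := hgi 1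
  have cx₂ : ContDiff ℝ 2 x₂ := hgi 2
  have cy₂ : ContDiff ℝ 2 y₂ := hgi 3
  have c1 : ∀ {f : ℝ → ℝ}, ContDiff ℝ 2 f → ContDiff ℝ 1 f := fun h => h.of_le (by norm_num)
  have cd : ∀ {f : ℝ → ℝ}, ContDiff ℝ 2 f → ContDiff ℝ 1 (deriv f) := fun h =>
    (contDiff_succ_iff_deriv.1 (show ContDiff ℝ (1 + 1) _ from h)).2.2
  have dd : ∀ {f : ℝ → ℝ}, ContDiff ℝ 2 f → ∀ t, HasDerivAt f (deriv f t) t := fun h t =>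
    (h.contDiffAt.differentiableAt (by norm_num)).hasDerivAt
  have geq : ∀ t, g t = !₂[x₁ t, y₁ t, x₂ t, y₂ t] := fun t => by
    ext i
    fin_cases i <;> rfl
  -- The value `β` differs from `y₂ t₀` because `p` is obtained by division by `y₂ - β`; it is close
  -- to `y₂ t₀` so that the third curve starts inside the chart.
  obtain ⟨β, hβ, hβm⟩ : ∃ β, β ≠ y₂ t₀ ∧ L !₂[x₁ t₀, y₁ t₀, x₂ t₀, β] ∈ D.chart.target := by
    have h1 : Continuous fun β : ℝ => L !₂[x₁ t₀, y₁ t₀, x₂ t₀, β] := by fun_prop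
    have h2 := h1.continuousAt.eventually_mem (x := y₂ t₀)
      (D.chart.open_target.mem_nhds (by rwa [← geq]))
    obtain ⟨β, hβ⟩ := ((h2.filter_mono nhdsWithin_le_nhds).and
      (self_mem_nhdsWithin (s := {y₂ t₀}ᶜ))).exists
    exact ⟨β, hβ.2, hβ.1⟩
  set η := y₁ t₀ with hη
  set f : ℝ → ℝ := fun τ => x₂ τ * deriv y₂ τ - (y₁ τ - η) * deriv x₁ τ with hf
  have cf : ContDiff ℝ 1 f :=
    ((c1 cx₂).mul (cd cy₂)).sub (((c1 cy₁).sub contDiff_const).mul (cd cx₁))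
  set w : ℝ → ℝ := fun t => ∫ τ in t₀..t, f τ with hw
  have dw : ∀ t, HasDerivAt w (f t) t := fun t => cf.continuous.integral_hasStrictDerivAt t₀ t |>.hasDerivAt
  have cw : ContDiff ℝ 1 w := by
    rw [contDiff_one_iff_deriv]
    refine ⟨fun t => (dw t).differentiableAt, ?_⟩
    rw [show deriv w = f from funext fun t => (dw t).deriv]
    exact cf.continuous
  -- The function `p` solves `((y₂ - β) p)' = x₂ y₂' - (y₁ - η) x₁'`, which is the condition that
  -- the second strip be lagrangian. The constant `k` gives `p t₀ = x₂ t₀`, so that `g₁` starts at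
  -- `g t₀`.
  set k := (y₂ t₀ - β) * x₂ t₀ with hk
  set p : ℝ → ℝ := fun t => (k + w t) / (y₂ t - β) with hp
  set c : ℝ → ℝ := fun t => p t - x₂ t with hc
  set m : ℝ → ℝ := fun t => deriv y₂ t / deriv x₁ t with hm'
  -- The first strip moves along `(0, c m, c, 0)`; the slope `m = y₂' / x₁'` makes it lagrangian for
  -- every `c`, and is `C^1` because the curve is `C^2`. The second strip moves the coordinates `y₁`
  -- and `y₂` to constants. The resulting `g₂` lies in an affine lagrangian plane, where it
  -- contracts to a point.
  set g₁ : ℝ → E4 := fun t => !₂[x₁ t, y₁ t + c t * m t, p t, y₂ t] with hg₁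
  set g₂ : ℝ → E4 := fun t => !₂[x₁ t, η, p t, β] with hg₂
  have w0 : w t₀ = 0 := by simp [hw]
  have p0 : p t₀ = x₂ t₀ := by
    simp only [hp, w0, hk, add_zero]
    rw [mul_div_assoc, mul_comm, div_mul_cancel₀ _ (sub_ne_zero.2 hβ.symm)]
  have cp : ∀ {t}, y₂ t ≠ β → ContDiffAt ℝ 1 p t := fun ht =>
    (contDiff_const.add cw).contDiffAt.div ((c1 cy₂).sub contDiff_const).contDiffAt (sub_ne_zero.2 ht)
  have cg₁ : ∀ {t}, y₂ t ≠ β → deriv x₁ t ≠ 0 → ContDiffAt ℝ 1 g₁ t := fun ht ht' =>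
    contDiffAt_vec (c1 cx₁).contDiffAt ((c1 cy₁).contDiffAt.add (((cp ht).sub (c1 cx₂).contDiffAt).mul
      ((cd cy₂).contDiffAt.div (cd cx₁).contDiffAt ht'))) (cp ht) (c1 cy₂).contDiffAt
  have cg₂ : ∀ {t}, y₂ t ≠ β → ContDiffAt ℝ 1 g₂ t := fun ht =>
    contDiffAt_vec (c1 cx₁).contDiffAt contDiffAt_const (cp ht) contDiffAt_const
  have g₁0 : g₁ t₀ = g t₀ := by
    rw [geq]
    simp [hg₁, p0, hc]
  have g₂0 : g₂ t₀ = !₂[x₁ t₀, y₁ t₀, x₂ t₀, β] := by simp only [hg₂, p0, hη]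
  have ev : ∀ᶠ t in 𝓝 t₀, y₂ t ≠ β ∧ deriv x₁ t ≠ 0 ∧ L (g t) ∈ D.chart.target ∧
      L (g₁ t) ∈ D.chart.target ∧ L (g₂ t) ∈ D.chart.target := by
    refine (cy₂.continuous.continuousAt.eventually_ne hβ.symm).and
      (((cd cx₁).continuous.continuousAt.eventually_ne h0).and ?_)
    have hv : ∀ {b : ℝ → E4}, ContinuousAt b t₀ → L (b t₀) ∈ D.chart.target →
        ∀ᶠ t in 𝓝 t₀, L (b t) ∈ D.chart.target := fun {b} hb hb' =>
      (ContinuousAt.comp (f := b) L.continuous.continuousAt hb).eventually_mem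
        (D.chart.open_target.mem_nhds hb')
    exact (hv hg.continuous.continuousAt hm).and
      ((hv (cg₁ hβ.symm h0).continuousAt (by rwa [g₁0])).and
        (hv (cg₂ hβ.symm).continuousAt (by rwa [g₂0])))
  obtain ⟨ε, hε, H⟩ := Metric.eventually_nhds_iff_ball.1 ev
  refine Metric.eventually_nhds_iff_ball.2 ⟨ε, hε, fun t ht => ?_⟩
  have sub : uIcc t₀ t ⊆ Metric.ball t₀ ε :=
    (convex_ball t₀ ε).ordConnected.uIcc_subset (Metric.mem_ball_self hε) ht
  replace H : ∀ τ ∈ uIcc t₀ t, _ := fun τ hτ => H τ (sub hτ)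
  have dp : ∀ τ ∈ uIcc t₀ t, HasDerivAt p ((f τ - p τ * deriv y₂ τ) / (y₂ τ - β)) τ := fun τ hτ => by
    have hne := sub_ne_zero.2 (H τ hτ).1
    have := ((dw τ).const_add k).div ((dd cy₂ τ).sub_const β) hne
    refine this.congr_deriv ?_
    change _ = (f τ - (k + w τ) / (y₂ τ - β) * deriv y₂ τ) / (y₂ τ - β)
    field_simp
  have mg : ∀ τ ∈ uIcc t₀ t, ContDiffAt ℝ 1 g τ := fun τ _ => (hg.of_le (by norm_num)).contDiffAt
  have mg₁ : ∀ τ ∈ uIcc t₀ t, ContDiffAt ℝ 1 g₁ τ := fun τ hτ => cg₁ (H τ hτ).1 (H τ hτ).2.1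
  have mg₂ : ∀ τ ∈ uIcc t₀ t, ContDiffAt ℝ 1 g₂ τ := fun τ hτ => cg₂ (H τ hτ).1
  have bg : MapsTo (L ∘ g) (uIcc t₀ t) D.chart.target := fun τ hτ => (H τ hτ).2.2.1
  have bg₁ : MapsTo (L ∘ g₁) (uIcc t₀ t) D.chart.target := fun τ hτ => (H τ hτ).2.2.2.1
  have bg₂ : MapsTo (L ∘ g₂) (uIcc t₀ t) D.chart.target := fun τ hτ => (H τ hτ).2.2.2.2
  have dg : ∀ {b : ℝ → E4} {τ}, ContDiffAt ℝ 1 b τ → ∀ j, deriv b τ j = deriv (fun s => b s j) τ :=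
    fun hb j => deriv_coord (hb.differentiableAt (by norm_num)) j
  have key : ∀ τ ∈ uIcc t₀ t, (y₁ τ + c τ * m τ - η) * deriv x₁ τ + (y₂ τ - β) * deriv p τ = 0 := by
    intro τ hτ
    have h1 := sub_ne_zero.2 (H τ hτ).1
    have h2 := (H τ hτ).2.1
    rw [(dp τ hτ).deriv, mul_div_cancel₀ _ h1]
    simp only [hm', hc, hf]
    field_simp
    ring
  refine sweep_comp_mem D hL mg mg₁ bg bg₁ ?_ ?_ (sweep_comp_mem D hL mg₁ mg₂ bg₁ bg₂ ?_ ?_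
    (sweep_comp_mem D hL (a₁ := fun _ => g₂ t₀) mg₂ (fun _ _ => contDiffAt_const) bg₂
      (fun τ _ => bg₂ left_mem_uIcc) ?_ ?_ ?_))
  · intro τ hτ
    have h2 := (H τ hτ).2.1
    simp only [omega0, dg (mg τ hτ), PiLp.sub_apply]
    have e0 : g₁ τ 0 - g τ 0 = 0 := sub_self (x₁ τ)
    have e1 : g₁ τ 1 - g τ 1 = c τ * m τ := add_sub_cancel_left (y₁ τ) _
    have e2 : g₁ τ 2 - g τ 2 = c τ := rfl
    have e3 : g₁ τ 3 - g τ 3 = 0 := sub_self (y₂ τ)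
    rw [e0, e1, e2, e3]
    change _ - c τ * m τ * deriv x₁ τ + (c τ * deriv y₂ τ - _) = 0
    simp only [hm']
    field_simp
    ring
  · intro τ hτ
    have h2 := (H τ hτ).2.1
    simp only [omega0, dg (mg₁ τ hτ), PiLp.sub_apply]
    have e0 : g₁ τ 0 - g τ 0 = 0 := sub_self (x₁ τ)
    have e1 : g₁ τ 1 - g τ 1 = c τ * m τ := add_sub_cancel_left (y₁ τ) _
    have e2 : g₁ τ 2 - g τ 2 = c τ := rfl
    have e3 : g₁ τ 3 - g τ 3 = 0 := sub_self (y₂ τ)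
    rw [e0, e1, e2, e3]
    change _ - c τ * m τ * deriv x₁ τ + (c τ * deriv y₂ τ - _) = 0
    simp only [hm']
    field_simp
    ring
  · intro τ hτ
    simp only [omega0, dg (mg₁ τ hτ), PiLp.sub_apply]
    have e0 : g₂ τ 0 - g₁ τ 0 = 0 := sub_self (x₁ τ)
    have e1 : g₂ τ 1 - g₁ τ 1 = η - (y₁ τ + c τ * m τ) := rfl
    have e2 : g₂ τ 2 - g₁ τ 2 = 0 := sub_self (p τ)
    have e3 : g₂ τ 3 - g₁ τ 3 = β - y₂ τ := rfl
    rw [e0, e1, e2, e3]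
    change 0 * _ - _ * deriv x₁ τ + (0 * _ - _ * deriv p τ) = 0
    linear_combination key τ hτ
  · intro τ hτ
    simp only [omega0, dg (mg₂ τ hτ), PiLp.sub_apply]
    have e0 : g₂ τ 0 - g₁ τ 0 = 0 := sub_self (x₁ τ)
    have e1 : g₂ τ 1 - g₁ τ 1 = η - (y₁ τ + c τ * m τ) := rfl
    have e2 : g₂ τ 2 - g₁ τ 2 = 0 := sub_self (p τ)
    have e3 : g₂ τ 3 - g₁ τ 3 = β - y₂ τ := rfl
    rw [e0, e1, e2, e3]
    change 0 * _ - _ * deriv x₁ τ + (0 * _ - _ * deriv p τ) = 0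
    linear_combination key τ hτ
  · intro τ hτ
    simp only [omega0, dg (mg₂ τ hτ), PiLp.sub_apply]
    have e1 : g₂ t₀ 1 - g₂ τ 1 = 0 := sub_self η
    have e3 : g₂ t₀ 3 - g₂ τ 3 = 0 := sub_self β
    have d1 : deriv (fun s => g₂ s 1) τ = 0 := deriv_const τ η
    have d3 : deriv (fun s => g₂ s 3) τ = 0 := deriv_const τ β
    rw [e1, e3, d1, d3]
    ring
  · intro τ hτ
    simp [omega0]
  · refine arc_lineMap_mem D (L (g₂ t₀)) 0 (fun τ _ => by simp) fun τ _ => bg₂ left_mem_uIcc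

/-- Short arcs of regular curves are joined by lagrangian strips to affine edges. -/
theorem eventually_arc_mem (D : DarbouxChart ω) {γ : ℝ → E4} {t₀ : ℝ} (hγ : ContDiffAt ℝ 2 γ t₀)
    (h0 : deriv γ t₀ ≠ 0) (hm : γ t₀ ∈ D.chart.target) :
    ∀ᶠ t in 𝓝 t₀, arc D γ t₀ t ∈ lagEdges D := by
  obtain ⟨L, hL, hLe⟩ := exists_symplectic_equiv (B := omegaB)
    (fun u v => by rw [omegaB_apply, omegaB_apply, omega0_swap])
    (fun u h => eq_zero_of_omega0 fun v => by rw [← omegaB_apply, h]) h0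
  have hf : ContDiffAt ℝ 2 (fun s => γ (t₀ + s) - γ t₀) 0 := by
    have : ContDiffAt ℝ 2 γ (t₀ + 0) := by rwa [add_zero]
    exact (this.comp 0 (by fun_prop : ContDiffAt ℝ 2 (fun s : ℝ => t₀ + s) 0)).sub contDiffAt_const
  -- The curve is `C^2` only near `t₀`; it is replaced by a globally `C^2` curve with the same germ.
  -- Taking its velocity as first vector of the symplectic basis `L` gives the first coordinate
  -- speed one.
  obtain ⟨φ, hφ, hφe, -⟩ := exists_small_extension hf (by simp) one_pos
  set γ' : ℝ → E4 := fun t => γ t₀ + φ (t - t₀) with hγ'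
  have cγ' : ContDiff ℝ 2 γ' := contDiff_const.add (hφ.comp (by fun_prop))
  have heq : γ' =ᶠ[𝓝 t₀] γ := by
    have h1 : Tendsto (fun t => t - t₀) (𝓝 t₀) (𝓝 0) := by
      have : ContinuousAt (fun t : ℝ => t - t₀) t₀ := by fun_prop
      rwa [ContinuousAt, sub_self] at this
    filter_upwards [h1.eventually hφe] with t ht
    simp [hγ', ht]
  have cg : ContDiff ℝ 2 (L.symm ∘ γ') := L.symm.contDiff.comp cγ'
  have hLg : L ∘ (L.symm ∘ γ') = γ' := by
    funext t
    simp
  have h1 := eventually_arc_mem_of_coord D (L := L) (fun u v => by rw [← omegaB_apply, hL]) cg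
    (t₀ := t₀) (by
      rw [← deriv_coord (cg.contDiffAt.differentiableAt (by norm_num)),
        (L.symm.hasFDerivAt.comp_hasDerivAt t₀
          (cγ'.contDiffAt.differentiableAt (by norm_num)).hasDerivAt).deriv, heq.deriv_eq, ← hLe]
      simp) (by simpa [heq.eq_of_nhds] using hm)
  rw [hLg] at h1
  obtain ⟨ε, hε, H⟩ := Metric.eventually_nhds_iff_ball.1
    (h1.and (heq.and (cγ'.continuous.continuousAt.eventually_mem (D.chart.open_target.mem_nhds
      (by rwa [heq.eq_of_nhds])))))
  refine Metric.eventually_nhds_iff_ball.2 ⟨ε, hε, fun t ht => ?_⟩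
  have sub : uIcc t₀ t ⊆ Metric.ball t₀ ε :=
    (convex_ball t₀ ε).ordConnected.uIcc_subset (Metric.mem_ball_self hε) ht
  rw [← arc_congr D (fun τ hτ => (H τ (sub hτ)).2.1) cγ'.continuous.continuousOn
    fun τ hτ => (H τ (sub hτ)).2.2]
  exact (H t ht).1

/-- Arcs of regular curves are joined by lagrangian strips to affine edges. -/
theorem arc_mem (D : DarbouxChart ω) {γ : ℝ → E4} (hγ : ∀ t ∈ Icc (0 : ℝ) 1, ContDiffAt ℝ 2 γ t)
    (h0 : ∀ t ∈ Icc (0 : ℝ) 1, deriv γ t ≠ 0) (hm : MapsTo γ (Icc 0 1) D.chart.target) :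
    arc D γ 0 1 ∈ lagEdges D := by
  have hγ1 : ∀ t ∈ Icc (0 : ℝ) 1, ContDiffAt ℝ 1 γ t := fun t ht => (hγ t ht).of_le (by norm_num)
  -- The class of the initial arc modulo `lagEdges D` is locally constant in its end point, by the
  -- statement for short arcs and the concatenation of arcs. It vanishes at `0`, hence at `1` by
  -- connectedness.
  let φ : Icc (0 : ℝ) 1 → (Simp N 1 →₀ ℤ) ⧸ lagEdges D := fun t => QuotientAddGroup.mk (arc D γ 0 t)
  have hφ : IsLocallyConstant φ := by
    rw [IsLocallyConstant.iff_eventually_eq]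
    intro t
    have h1 := continuous_subtype_val.continuousAt.eventually
      (eventually_arc_mem D (hγ t t.2) (h0 t t.2) (hm t.2))
    filter_upwards [h1] with s hs
    refine (QuotientAddGroup.eq.2 ?_ : φ t = φ s).symm
    have h2 := arc_add_mem D (convex_Icc 0 1) hγ1 hm (left_mem_Icc.2 zero_le_one) t.2 s.2
    have := sub_mem hs h2
    convert this using 1
    abel
  have h1 := hφ.apply_eq_of_preconnectedSpace ⟨1, right_mem_Icc.2 zero_le_one⟩
    ⟨0, left_mem_Icc.2 zero_le_one⟩
  have h2 : φ ⟨0, left_mem_Icc.2 zero_le_one⟩ = 0 :=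
    (QuotientAddGroup.eq_zero_iff _).2 (arc_refl_mem D (hm (left_mem_Icc.2 zero_le_one)))
  rw [h2] at h1
  exact (QuotientAddGroup.eq_zero_iff _).1 h1

end Straightening
end LagrangianCycles

end

/-! ### Rigidity of cocycles that vanish on isotropic triangles -/

noncomputable section

set_option linter.unusedSectionVars false
set_option maxSynthPendingDepth 4
namespace LagrangianCycles

section Rigidity
open Set

/-- A map on the line that is additive near the origin agrees there with a homomorphism. -/
theorem exists_hom_extension {G : Type*} [AddCommGroup G] {F : ℝ → G} {ε : ℝ} (hε : 0 < ε)
    (h : ∀ a b, |a| ≤ ε → |b| ≤ ε → |a + b| ≤ ε → F (a + b) = F a + F b) :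
    ∃ Φ : ℝ →+ G, ∀ a, |a| ≤ ε → Φ a = F a := by
  have F0 : F 0 = 0 := by
    have := h 0 0 (by simpa using hε.le) (by simpa using hε.le) (by simpa using hε.le)
    simpa using this
  have mul : ∀ (n : ℕ) (a : ℝ), |n * a| ≤ ε → F (n * a) = n • F a := by
    intro n
    induction n with
    | zero => intro a _; simp [F0]
    | succ n ih =>
      intro a ha
      rw [abs_mul, Nat.abs_cast] at ha
      push_cast at ha ⊢
      have h1 : (n : ℝ) * |a| ≤ ε := by nlinarith [abs_nonneg a]
      have h2 : |a| ≤ ε := by nlinarith [abs_nonneg a, mul_nonneg (Nat.cast_nonneg (α := ℝ) n) (abs_nonneg a)]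
      have h3 : |(n : ℝ) * a| ≤ ε := by rwa [abs_mul, Nat.abs_cast]
      rw [add_mul, one_mul, h _ _ h3 h2 (by
        rw [show (n : ℝ) * a + a = (n + 1) * a by ring, abs_mul]
        rwa [abs_of_pos (by positivity : (0 : ℝ) < n + 1)]), ih a h3, succ_nsmul]
  -- The extension is `n • F (a / n)` for large `n`; two admissible denominators are compared
  -- through their product.
  have wd : ∀ (a : ℝ) (n m : ℕ), 0 < n → 0 < m → |a / n| ≤ ε → |a / m| ≤ ε →
      n • F (a / n) = m • F (a / m) := by
    intro a n m hn hm h1 h2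
    have hn' : (n : ℝ) ≠ 0 := by positivity
    have hm' : (m : ℝ) ≠ 0 := by positivity
    have e1 : a / n = m * (a / (n * m)) := by field_simp
    have e2 : a / m = n * (a / (n * m)) := by field_simp
    rw [e1, mul m _ (by rwa [← e1]), e2, mul n _ (by rwa [← e2]), smul_smul, smul_smul, mul_comm]
  have bound : ∀ (a : ℝ) (n : ℕ), |a| / ε ≤ n → 0 < n → |a / n| ≤ ε := by
    intro a n h1 h2
    rw [abs_div, Nat.abs_cast, div_le_iff₀ (by positivity)]
    rw [div_le_iff₀ hε] at h1
    linarith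
  obtain ⟨ν, ν0, ν1⟩ : ∃ ν : ℝ → ℕ, (∀ a, 0 < ν a) ∧ ∀ a, |a| / ε ≤ ν a :=
    ⟨fun a => ⌈|a| / ε⌉₊ + 1, fun a => Nat.succ_pos _,
      fun a => (Nat.le_ceil _).trans (by push_cast; linarith)⟩
  have hν : ∀ a n, ν a ≤ n → |a / n| ≤ ε := fun a n hn =>
    bound a n ((ν1 a).trans (Nat.cast_le.2 hn)) ((ν0 a).trans_le hn)
  refine ⟨⟨⟨fun a => ν a • F (a / ν a), ?_⟩, fun a b => ?_⟩, fun a ha => ?_⟩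
  · simp [F0]
  · obtain ⟨n, l1, l2, l3⟩ : ∃ n, ν a ≤ n ∧ ν b ≤ n ∧ ν (a + b) ≤ n :=
      ⟨ν a + ν b + ν (a + b), by omega, by omega, by omega⟩
    have hn : 0 < n := (ν0 a).trans_le l1
    change ν (a + b) • F ((a + b) / ν (a + b)) = ν a • F (a / ν a) + ν b • F (b / ν b)
    rw [wd (a + b) _ n (ν0 _) hn (hν _ _ le_rfl) (hν _ _ l3),
      wd a _ n (ν0 _) hn (hν _ _ le_rfl) (hν _ _ l1),
      wd b _ n (ν0 _) hn (hν _ _ le_rfl) (hν _ _ l2), ← smul_add, add_div,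
      h _ _ (hν _ _ l1) (hν _ _ l2) (by rw [← add_div]; exact hν _ _ l3)]
  · change ν a • F (a / ν a) = F a
    rw [wd a _ 1 (ν0 _) one_pos (hν _ _ le_rfl) (by simpa using ha)]
    simp

/-- The open cube. -/
def cube (ρ : ℝ) : Set E4 := {x | ∀ i, |x i| < ρ}

theorem mem_cube {ρ a b c d : ℝ} (ha : |a| < ρ) (hb : |b| < ρ) (hc : |c| < ρ) (hd : |d| < ρ) :
    (!₂[a, b, c, d] : E4) ∈ cube ρ := fun i => by
  fin_cases i
  · exact ha
  · exact hb
  · exact hc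
  · exact hd

variable {G : Type*} [AddCommGroup G] {ρ : ℝ} {f : E4 → E4 → E4 → G}

/-- Twice the area of the projection of a triangle to the first coordinate plane. -/
def det₁ (p q r : E4) : ℝ := (q 0 - p 0) * (r 1 - p 1) - (q 1 - p 1) * (r 0 - p 0)

/-- Twice the area of the projection of a triangle to the second coordinate plane. -/
def det₂ (p q r : E4) : ℝ := (q 2 - p 2) * (r 3 - p 3) - (q 3 - p 3) * (r 2 - p 2)

theorem omega0_eq_det (p q r : E4) : omega0 (q - p) (r - p) = det₁ p q r + det₂ p q r := by
  simp only [omega0, det₁, det₂, PiLp.sub_apply]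

/-- The point with the first two coordinates of one point and the last two of another. -/
def mix (p q : E4) : E4 := !₂[p 0, p 1, q 2, q 3]

theorem mix_mem {p q : E4} (hp : p ∈ cube ρ) (hq : q ∈ cube ρ) : mix p q ∈ cube ρ :=
  mem_cube (hp 0) (hp 1) (hq 2) (hq 3)

@[simp] theorem mix_apply_zero (p q : E4) : mix p q 0 = p 0 := rfl
@[simp] theorem mix_apply_one (p q : E4) : mix p q 1 = p 1 := rfl
@[simp] theorem mix_apply_two (p q : E4) : mix p q 2 = q 2 := rfl
@[simp] theorem mix_apply_three (p q : E4) : mix p q 3 = q 3 := rfl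

@[simp] theorem mix_mix_left (p q r : E4) : mix (mix p q) r = mix p r := rfl
@[simp] theorem mix_mix_right (p q r : E4) : mix p (mix q r) = mix p r := rfl

theorem zero_mem_cube (hρ : 0 < ρ) : (0 : E4) ∈ cube ρ := fun i => by simpa using hρ

/-- An alternating cocycle of triangles in the cube that vanishes on isotropic triangles. -/
structure IsotropicCocycle (ρ : ℝ) (f : E4 → E4 → E4 → G) : Prop where
  cocycle : ∀ a ∈ cube ρ, ∀ b ∈ cube ρ, ∀ c ∈ cube ρ, ∀ d ∈ cube ρ,
    f b c d - f a c d + f a b d - f a b c = 0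
  vanish : ∀ a ∈ cube ρ, ∀ b ∈ cube ρ, ∀ c ∈ cube ρ, det₁ a b c + det₂ a b c = 0 → f a b c = 0

namespace IsotropicCocycle

/-- The cocycle relation for the degenerate tetrahedron `p`, `q`, `r`, `q`, two of whose faces have
a repeated vertex. -/
theorem swap (H : IsotropicCocycle ρ f) {p q r : E4} (hp : p ∈ cube ρ) (hq : q ∈ cube ρ) (hr : r ∈ cube ρ) :
    f p r q = -f p q r := by
  have h1 := H.cocycle p hp q hq r hr q hq
  have h2 := H.vanish q hq r hr q hq (by simp only [det₁, det₂]; ring)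
  have h3 := H.vanish p hp q hq q hq (by simp only [det₁, det₂]; ring)
  rw [h2, h3] at h1
  rw [eq_neg_iff_add_eq_zero, ← neg_eq_zero, ← h1]
  abel

/-- The cocycle on a triangle with a vertex at the origin splits into planar parts. -/
theorem split_zero (H : IsotropicCocycle ρ f) (hρ : 0 < ρ) {p q : E4} (hp : p ∈ cube ρ) (hq : q ∈ cube ρ) :
    f 0 p q = f 0 (mix p 0) (mix q 0) + f 0 (mix 0 p) (mix 0 q) := by
  have h0 := zero_mem_cube hρ
  have v : ∀ {a b c : E4}, a ∈ cube ρ → b ∈ cube ρ → c ∈ cube ρ →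
      det₁ a b c + det₂ a b c = 0 → f a b c = 0 := fun ha hb hc h => H.vanish _ ha _ hb _ hc h
  have hp1 := mix_mem hp h0
  have hq1 := mix_mem hq h0
  have hp2 := mix_mem h0 hp
  have hq2 := mix_mem h0 hq
  have hm := mix_mem hp hq
  -- Six tetrahedra, built from `p`, `q`, their planar projections and `mix p q`, lead from the
  -- triangle `0`, `p`, `q` to its two projections. The ten auxiliary faces `v1` to `v10` that have
  -- to disappear are isotropic.
  have s1 := H.cocycle _ h0 _ hp1 _ hp _ hq
  have s2 := H.cocycle _ h0 _ hp1 _ hq1 _ hq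
  have s3 := H.cocycle _ hp1 _ hp _ hm _ hq
  have s4 := H.cocycle _ h0 _ hp1 _ hp _ hm
  have s5 := H.cocycle _ h0 _ hp2 _ hp _ hm
  have s6 := H.cocycle _ h0 _ hp2 _ hq2 _ hm
  have v1 := v h0 hp1 hp (by simp [det₁, det₂]; ring)
  have v2 := v hp1 hq1 hq (by simp [det₁, det₂]; try ring)
  have v3 := v h0 hq1 hq (by simp [det₁, det₂]; ring)
  have v4 := v hp hm hq (by simp [det₁, det₂]; ring)
  have v5 := v hp1 hm hq (by simp [det₁, det₂]; try ring)
  have v6 := v h0 hp1 hm (by simp [det₁, det₂]; ring)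
  have v7 := v hp2 hp hm (by simp [det₁, det₂]; try ring)
  have v8 := v h0 hp2 hp (by simp [det₁, det₂]; ring)
  have v9 := v hp2 hq2 hm (by simp [det₁, det₂]; try ring)
  have v10 := v h0 hq2 hm (by simp [det₁, det₂]; ring)
  rw [v1] at s1
  rw [v2, v3] at s2
  rw [v4, v5] at s3
  rw [v1, v6] at s4
  rw [v7, v8] at s5
  rw [v9, v10] at s6
  have aux : ∀ {g a b a' d e x y : G}, a - g + b - 0 = 0 → 0 - 0 + b - x = 0 → 0 - 0 + a - a' = 0 →
      a' - d + 0 - 0 = 0 → 0 - d + e - 0 = 0 → 0 - 0 + e - y = 0 → g = x + y := by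
    intros
    grind
  exact aux s1 s2 s3 s4 s5 s6

/-- Coning from the origin reduces to `split_zero`, applied to the three triangles over the edges;
the projections are then put together again by the cocycle relation. -/
theorem split (H : IsotropicCocycle ρ f) (hρ : 0 < ρ) {p q r : E4} (hp : p ∈ cube ρ) (hq : q ∈ cube ρ) (hr : r ∈ cube ρ) :
    f p q r = f (mix p 0) (mix q 0) (mix r 0) + f (mix 0 p) (mix 0 q) (mix 0 r) := by
  have h0 := zero_mem_cube hρ
  have c0 := H.cocycle _ h0 _ hp _ hq _ hr
  have c1 := H.cocycle _ h0 _ (mix_mem hp h0) _ (mix_mem hq h0) _ (mix_mem hr h0)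
  have c2 := H.cocycle _ h0 _ (mix_mem h0 hp) _ (mix_mem h0 hq) _ (mix_mem h0 hr)
  rw [H.split_zero hρ hq hr, H.split_zero hρ hp hr, H.split_zero hρ hp hq] at c0
  have aux : ∀ {f a b c a' b' c' x y : G}, f - (a + a') + (b + b') - (c + c') = 0 →
      x - a + b - c = 0 → y - a' + b' - c' = 0 → f = x + y := by
    intros
    grind
  exact aux c0 c1 c2

/-- The triangle whose projections are the two given ones has symplectic area the sum of their
areas. If that is zero, the triangle is isotropic, and its value splits into the two summands. -/
theorem add_eq_zero (H : IsotropicCocycle ρ f) (hρ : 0 < ρ) {p q r p' q' r' : E4} (hp : p ∈ cube ρ) (hq : q ∈ cube ρ)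
    (hr : r ∈ cube ρ) (hp' : p' ∈ cube ρ) (hq' : q' ∈ cube ρ) (hr' : r' ∈ cube ρ)
    (h : det₁ p q r + det₂ p' q' r' = 0) :
    f (mix p 0) (mix q 0) (mix r 0) + f (mix 0 p') (mix 0 q') (mix 0 r') = 0 := by
  have h1 := H.split hρ (mix_mem hp hp') (mix_mem hq hq') (mix_mem hr hr')
  simp only [mix_mix_left, mix_mix_right] at h1
  rw [← h1]
  exact H.vanish _ (mix_mem hp hp') _ (mix_mem hq hq') _ (mix_mem hr hr') h

/-- Both triangles are compared with the same triangle in the first plane, the reflected copy of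
`p`, `q`, `r`, which has the opposite area. -/
theorem congr_det (H : IsotropicCocycle ρ f) (hρ : 0 < ρ) {p q r p' q' r' : E4} (hp : p ∈ cube ρ) (hq : q ∈ cube ρ)
    (hr : r ∈ cube ρ) (hp' : p' ∈ cube ρ) (hq' : q' ∈ cube ρ) (hr' : r' ∈ cube ρ)
    (h : det₂ p q r = det₂ p' q' r') :
    f (mix 0 p) (mix 0 q) (mix 0 r) = f (mix 0 p') (mix 0 q') (mix 0 r') := by
  have hm : ∀ {x : E4}, x ∈ cube ρ → (!₂[x 2, -x 3, 0, 0] : E4) ∈ cube ρ := fun hx =>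
    mem_cube (hx 2) (by rw [abs_neg]; exact hx 3) (by simpa) (by simpa)
  have e : det₁ !₂[p 2, -p 3, 0, 0] !₂[q 2, -q 3, 0, 0] !₂[r 2, -r 3, 0, 0] + det₂ p q r = 0 := by
    simp [det₁, det₂]
    ring
  have h1 := H.add_eq_zero hρ (hm hp) (hm hq) (hm hr) hp hq hr e
  have h2 := H.add_eq_zero hρ (hm hp) (hm hq) (hm hr) hp' hq' hr' (by rw [← h, e])
  exact add_left_cancel (h1.trans h2.symm)

end IsotropicCocycle

/-- **Rigidity**: a cocycle of triangles that vanishes on isotropic triangles is a function of the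
symplectic area of small triangles. -/
theorem IsotropicCocycle.exists_hom (H : IsotropicCocycle ρ f) (hρ : 0 < ρ) :
    ∃ Φ : ℝ →+ G, ∀ p ∈ Metric.ball (0 : E4) (ρ / 8), ∀ q ∈ Metric.ball (0 : E4) (ρ / 8),
      ∀ r ∈ Metric.ball (0 : E4) (ρ / 8), f p q r = Φ (omega0 (q - p) (r - p)) := by
  have h0 := zero_mem_cube hρ
  -- The triangle `0`, `C`, `R a` is a model of area `a`. Both legs must be shorter than `ρ` for
  -- `|a| ≤ ρ ^ 2 / 2`, which requires `ρ / 2 < c < ρ`.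
  set c : ℝ := 3 * ρ / 4 with hc
  have hc0 : 0 < c := by positivity
  set C : E4 := !₂[0, 0, c, 0] with hC
  set R : ℝ → E4 := fun a => !₂[0, 0, 0, a / c] with hR
  have mC : C ∈ cube ρ := mem_cube (by simpa) (by simpa) (by rw [abs_of_pos hc0]; linarith) (by simpa)
  have mR : ∀ {a}, |a| ≤ ρ ^ 2 / 2 → R a ∈ cube ρ := fun ha => mem_cube (by simpa) (by simpa)
    (by simpa) (by
      rw [abs_div, abs_of_pos hc0, div_lt_iff₀ hc0]
      nlinarith)
  have m0 : mix 0 (0 : E4) = 0 := by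
    ext i
    fin_cases i <;> rfl
  have mixC : mix 0 C = C := by
    ext i
    fin_cases i <;> rfl
  have mixR : ∀ a, mix 0 (R a) = R a := fun a => by
    ext i
    fin_cases i <;> rfl
  have dR : ∀ a, det₂ 0 C (R a) = a := fun a => by
    have : det₂ 0 C (R a) = c * (a / c) := by simp [det₂, hC, hR]
    rw [this]
    field_simp
  set F : ℝ → G := fun a => f 0 C (R a) with hF
  have hF2 : ∀ {p q r}, p ∈ cube ρ → q ∈ cube ρ → r ∈ cube ρ → |det₂ p q r| ≤ ρ ^ 2 / 2 →
      f (mix 0 p) (mix 0 q) (mix 0 r) = F (det₂ p q r) := fun hp hq hr hd => by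
    rw [H.congr_det hρ hp hq hr h0 mC (mR hd) (dR _).symm, m0, mixC, mixR]
  have hneg : ∀ {a}, |a| ≤ ρ ^ 2 / 2 → F (-a) = -F a := fun {a} ha => by
    have h1 := H.swap h0 mC (mR ha)
    have e : det₂ 0 (R a) C = -a := by
      have : det₂ 0 (R a) C = -det₂ 0 C (R a) := by
        simp only [det₂]
        ring
      rw [this, dR]
    have h2 := hF2 h0 (mR ha) mC (by rwa [e, abs_neg])
    rw [m0, mixC, mixR, e] at h2
    rw [← h2, h1]
  have hF1 : ∀ {p q r}, p ∈ cube ρ → q ∈ cube ρ → r ∈ cube ρ → |det₁ p q r| ≤ ρ ^ 2 / 2 →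
      f (mix p 0) (mix q 0) (mix r 0) = F (det₁ p q r) := fun hp hq hr hd => by
    have hd' : |-det₁ _ _ _| ≤ ρ ^ 2 / 2 := (abs_neg _).trans_le hd
    have h1 := H.add_eq_zero hρ hp hq hr h0 mC (mR hd') (by rw [dR]; ring)
    rw [m0, mixC, mixR] at h1
    rw [eq_neg_of_add_eq_zero_left h1]
    change -F _ = _
    rw [hneg hd, neg_neg]
  have hadd : ∀ a b, |a| ≤ ρ ^ 2 / 2 → |b| ≤ ρ ^ 2 / 2 → |a + b| ≤ ρ ^ 2 / 2 →
      F (a + b) = F a + F b := by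
    intro a b ha hb hab
    -- The points `0`, `R a`, `R (a + b)` are collinear, so one face of this tetrahedron drops out
    -- and the other three express additivity.
    have h1 := H.cocycle _ h0 _ mC _ (mR ha) _ (mR hab)
    have h2 := H.vanish _ h0 _ (mR ha) _ (mR hab) (by simp [det₁, det₂, hR])
    have e : det₂ C (R a) (R (a + b)) = -b := by
      have : det₂ C (R a) (R (a + b)) = -(c * (b / c)) := by
        simp [det₂, hC, hR]
        ring
      rw [this]
      field_simp
    have h3 := hF2 mC (mR ha) (mR hab) (by rwa [e, abs_neg])
    rw [mixC, mixR, mixR, e, hneg hb] at h3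
    rw [h2, h3] at h1
    change -F b - 0 + F (a + b) - F a = 0 at h1
    rw [← sub_eq_zero, ← h1]
    abel
  obtain ⟨Φ, hΦ⟩ := exists_hom_extension (by positivity : 0 < ρ ^ 2 / 2) hadd
  refine ⟨Φ, fun p hp q hq r hr => ?_⟩
  have hs : ∀ x ∈ Metric.ball (0 : E4) (ρ / 8), ∀ i, |x i| < ρ / 8 := fun x hx i => by
    rw [mem_ball_zero_iff] at hx
    exact (PiLp.norm_apply_le x i).trans_lt hx
  have hs' : ∀ x ∈ Metric.ball (0 : E4) (ρ / 8), x ∈ cube ρ := fun x hx i =>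
    (hs x hx i).trans (by linarith)
  -- Coordinates below `ρ / 8` give differences at most `ρ / 4` and determinants at most `2 * (ρ /
  -- 4) ^ 2`, well inside the range where `F` is defined and additive.
  have hd : ∀ i j : Fin 4, |(q i - p i) * (r j - p j) - (q j - p j) * (r i - p i)| ≤ ρ ^ 2 / 8 := by
    intro i j
    have b : ∀ x ∈ Metric.ball (0 : E4) (ρ / 8), ∀ k, |x k - p k| ≤ ρ / 4 := fun x hx k => by
      have h1 := abs_lt.1 (hs x hx k)
      have h2 := abs_lt.1 (hs p hp k)
      rw [abs_le]
      constructor <;> linarith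
    have b2 : ∀ k l, |(q k - p k) * (r l - p l)| ≤ (ρ / 4) * (ρ / 4) := fun k l => by
      rw [abs_mul]
      exact mul_le_mul (b q hq k) (b r hr l) (abs_nonneg _) (by positivity)
    have h1 := b2 i j
    have h2 := b2 j i
    have h3 := abs_sub ((q i - p i) * (r j - p j)) ((q j - p j) * (r i - p i))
    nlinarith
  have d1 : |det₁ p q r| ≤ ρ ^ 2 / 8 := hd 0 1
  have d2 : |det₂ p q r| ≤ ρ ^ 2 / 8 := hd 2 3
  have hpos : 0 ≤ ρ ^ 2 := by positivity
  have d3 : |det₁ p q r + det₂ p q r| ≤ ρ ^ 2 / 2 := (abs_add_le _ _).trans (by linarith)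
  rw [H.split hρ (hs' p hp) (hs' q hq) (hs' r hr),
    hF1 (hs' p hp) (hs' q hq) (hs' r hr) (by linarith),
    hF2 (hs' p hp) (hs' q hq) (hs' r hr) (by linarith), omega0_eq_det, hΦ _ d3,
    hadd _ _ (by linarith) (by linarith) d3]

end Rigidity
end LagrangianCycles

end

/-! ### Chains modulo lagrangian simplices, and rigid charts -/

noncomputable section

set_option linter.unusedSectionVars false
set_option maxSynthPendingDepth 4
namespace LagrangianCycles

section Classes
open Set Filter Topology MeasureTheory

variable {N : Type u} [TopologicalSpace N] [ChartedSpace E4 N]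

/-- The chains generated by lagrangian simplices and boundaries. -/
def relations (ω : SymplecticForm N) : AddSubgroup (Simp N 2 →₀ ℤ) :=
  chainsIn {σ | SingularTwoSimplex.IsLagrangian ω.form σ} ⊔ (bd 2).range

/-- Two-chains up to lagrangian simplices and boundaries. -/
abbrev LagQuotient (ω : SymplecticForm N) : Type u := (Simp N 2 →₀ ℤ) ⧸ relations ω

/-- The class of a two-chain up to lagrangian simplices and boundaries. -/
def lagClass (ω : SymplecticForm N) : (Simp N 2 →₀ ℤ) →+ LagQuotient ω :=
  QuotientAddGroup.mk' (relations ω)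

variable {ω : SymplecticForm N}

theorem lagClass_eq_zero {c : Simp N 2 →₀ ℤ} : lagClass ω c = 0 ↔ c ∈ relations ω :=
  QuotientAddGroup.eq_zero_iff c

theorem lagClass_bd (b : Simp N 3 →₀ ℤ) : lagClass ω (bd 2 b) = 0 :=
  lagClass_eq_zero.2 (AddSubgroup.mem_sup_right ⟨b, rfl⟩)

theorem lagClass_lagIn (D : DarbouxChart ω) {c : Simp N 2 →₀ ℤ} (hc : c ∈ chainsIn (lagIn D)) :
    lagClass ω c = 0 :=
  lagClass_eq_zero.2 (AddSubgroup.mem_sup_left (chainsIn_mono (fun _ h => h.1) hc))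

theorem area_eq_zero_of_isLagrangian {c : Simp N 2 →₀ ℤ}
    (hc : c ∈ chainsIn {σ | SingularTwoSimplex.IsLagrangian ω.form σ}) : area ω c = 0 := by
  refine map_mem_of_chainsIn (area ω) ⊥ (fun σ hσ => ?_) hc
  rw [AddSubgroup.mem_bot, area, extend_single, one_smul, SingularTwoSimplex.integral]
  refine setIntegral_eq_zero_of_forall_eq_zero fun p hp => ?_
  rw [hσ.2 p hp]
  rfl

theorem area_lagIn (D : DarbouxChart ω) {c : Simp N 2 →₀ ℤ} (hc : c ∈ chainsIn (lagIn D)) :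
    area ω c = 0 :=
  area_eq_zero_of_isLagrangian (chainsIn_mono (fun _ h => h.1) hc)

theorem affSimplex_symm_c1 (D : DarbouxChart ω) {v : Tup E4 2} (hv : v ∈ tupIn D.chart.target 2) :
    affSimplex D.chart.symm v ∈ c1Simp N ∩ simpIn D.chart.source 2 :=
  ⟨isC1_affSimplex D (h := id) (convex_target D) contDiffOn_id (mapsTo_id _) hv,
    affSimplex_mem_simpIn D (h := id) (convex_target D) continuousOn_id (mapsTo_id _) hv⟩

/-- The area of the standard triangle. -/
def triangleArea : ℝ := volume.real triangle

theorem triangleArea_pos : 0 < triangleArea := by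
  refine ENNReal.toReal_pos (ne_of_gt ?_) isCompact_triangle.measure_lt_top.ne
  have h1 : Ioo (0 : ℝ) (1 / 2) ×ˢ Ioo (0 : ℝ) (1 / 2) ⊆ triangle := fun p hp =>
    ⟨hp.1.1.le, hp.2.1.le, by linarith [hp.1.2, hp.2.2]⟩
  refine lt_of_lt_of_le ?_ (measure_mono h1)
  exact (isOpen_Ioo.prod isOpen_Ioo).measure_pos volume ⟨(1 / 4, 1 / 4), by norm_num⟩

theorem area_affSimplex (D : DarbouxChart ω) {v : Tup E4 2} (hv : v ∈ tupIn D.chart.target 2) :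
    area ω (Finsupp.single (affSimplex D.chart.symm v) 1) =
      triangleArea * omega0 (v 1 - v 0) (v 2 - v 0) := by
  obtain ⟨h1, h2⟩ := affSimplex_symm_c1 D hv
  have hpl : ∀ p ∈ triangle, SingularTwoSimplex.planar (affSimplex D.chart.symm v) p =
      D.chart.symm (plane v p) := fun p hp =>
    planar_affSimplex D.chart.continuousOn_symm (convex_target D) hv hp
  have hm : MapsTo (plane v) triangle D.chart.target := fun p hp => plane_mem (convex_target D) hv hp
  rw [area, extend_single, one_smul, SingularTwoSimplex.integral]
  have : ∀ p ∈ triangle, SingularTwoSimplex.pullback ω.form (affSimplex D.chart.symm v) p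
      ![(1, 0), (0, 1)] = omega0 (v 1 - v 0) (v 2 - v 0) := fun p hp => by
    rw [pullback_eq D h1 hp (by rw [hpl p hp]; exact D.chart.map_target (hm hp)),
      fderivWithin_congr (readIn_eqOn D hm hpl) (readIn_eqOn D hm hpl hp),
      (hasFDerivAt_plane v p).hasFDerivWithinAt.fderivWithin (uniqueDiffOn_triangle p hp)]
    simp
  rw [setIntegral_congr_fun isCompact_triangle.measurableSet this, setIntegral_const, smul_eq_mul]
  rfl

/-- The classes of the affine triangles in a chart form an isotropic cocycle. -/
theorem isotropicCocycle (D : DarbouxChart ω) {ρ : ℝ} (hρ : cube ρ ⊆ D.chart.target) :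
    IsotropicCocycle ρ fun p q r =>
      lagClass ω (Finsupp.single (affSimplex D.chart.symm ![p, q, r]) 1) where
  cocycle a ha b hb c hc d hd := by
    have hv : (![a, b, c, d] : Tup E4 3) ∈ tupIn D.chart.target 3 := fun i => by
      fin_cases i
      exacts [hρ ha, hρ hb, hρ hc, hρ hd]
    have h := lagClass_bd (ω := ω) (Finsupp.single (affSimplex D.chart.symm ![a, b, c, d]) 1)
    rw [← push_single, bd_push D.chart.continuousOn_symm (convex_target D)
      (single_mem_chainsIn hv 1), tbd_single, Fin.sum_univ_four] at h
    have e0 : (![a, b, c, d] : Tup E4 3) ∘ Fin.succAbove 0 = ![b, c, d] := by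
      ext i : 1
      fin_cases i <;> rfl
    have e1 : (![a, b, c, d] : Tup E4 3) ∘ Fin.succAbove 1 = ![a, c, d] := by
      ext i : 1
      fin_cases i <;> rfl
    have e2 : (![a, b, c, d] : Tup E4 3) ∘ Fin.succAbove 2 = ![a, b, d] := by
      ext i : 1
      fin_cases i <;> rfl
    have e3 : (![a, b, c, d] : Tup E4 3) ∘ Fin.succAbove 3 = ![a, b, c] := by
      ext i : 1
      fin_cases i <;> rfl
    rw [e0, e1, e2, e3] at h
    simp only [map_add, map_zsmul, push_single] at h
    have p2 : ((-1 : ℤ) ^ ((2 : Fin 4) : ℕ)) = 1 := by norm_num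
    have p3 : ((-1 : ℤ) ^ ((3 : Fin 4) : ℕ)) = -1 := by decide
    rw [p2, p3] at h
    simp only [Fin.val_zero, Fin.val_one, pow_zero, pow_one, one_smul, neg_smul] at h
    rw [← h]
    abel
  vanish a ha b hb c hc h := by
    refine lagClass_lagIn D (single_mem_chainsIn ?_ 1)
    refine affSimplex_mem_lagIn D (h := id) (convex_target D) (fun _ _ => contDiffAt_id)
      (mapsTo_id _) (triple_mem (hρ ha) (hρ hb) (hρ hc)) fun q _ => ?_
    rw [fderiv_id]
    change omega0 (b - a) (c - a) = 0
    rw [omega0_eq_det, h]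

/-- The class of an affine chain in the chart is a function of its area. -/
def IsRigid (D : DarbouxChart ω) (Ψ : ℝ →+ LagQuotient ω) : Prop :=
  ∀ c ∈ chainsIn (tupIn D.chart.target 2),
    lagClass ω (push D.chart.symm c) = Ψ (area ω (push D.chart.symm c))

/-- The restriction of a Darboux chart to a smaller ball. -/
def DarbouxChart.shrink (D : DarbouxChart ω) {s : ℝ} (hs : s ≤ D.radius) : DarbouxChart ω where
  chart := (D.chart.symm.restrOpen (Metric.ball 0 s) Metric.isOpen_ball).symm
  radius := s
  target_eq := by
    change D.chart.target ∩ Metric.ball 0 s = _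
    rw [D.target_eq]
    exact inter_eq_right.2 (Metric.ball_subset_ball hs)
  contMDiffOn := D.contMDiffOn.mono fun _ hx => hx.1
  contMDiffOn_symm := D.contMDiffOn_symm.mono fun _ hx => hx.1
  symplectic y hy := D.symplectic y hy.1

theorem exists_isRigid [IsManifold (𝓡 4) ((⊤ : ℕ∞) : WithTop ℕ∞) N] (ω : SymplecticForm N) (x : N)
    {U : Set N} (hU : U ∈ 𝓝 x) : ∃ D : DarbouxChart ω, x ∈ D.chart.source ∧ D.chart.source ⊆ U ∧
      ∃ Ψ, IsRigid D Ψ := by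
  obtain ⟨D, hx, hDU, h0⟩ := exists_darbouxChart ω x hU
  have hr : 0 < D.radius := by
    have := D.chart.map_source hx
    rw [h0, D.target_eq] at this
    exact Metric.pos_of_mem_ball this
  -- Four coordinates below half the radius give a norm below the radius.
  have hcube : cube (D.radius / 2) ⊆ D.chart.target := fun y hy => by
    rw [D.target_eq, mem_ball_zero_iff, EuclideanSpace.norm_eq, Real.sqrt_lt' hr, Fin.sum_univ_four]
    have h : ∀ i, ‖y i‖ ^ 2 < (D.radius / 2) ^ 2 := fun i =>
      pow_lt_pow_left₀ (hy i) (abs_nonneg (y i)) two_ne_zero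
    nlinarith [h 0, h 1, h 2, h 3]
  obtain ⟨Φ, hΦ⟩ := (isotropicCocycle D hcube).exists_hom (by positivity)
  have hs : D.radius / 2 / 8 ≤ D.radius := by linarith
  -- Rigidity holds only on the smaller ball. The factor converts the integral of `ω` over an affine
  -- triangle into the value of `omega0` on its edges.
  refine ⟨D.shrink hs, ?_, fun y hy => hDU hy.1, Φ.comp (AddMonoidHom.mulRight triangleArea⁻¹), ?_⟩
  · change x ∈ D.chart.source ∩ D.chart ⁻¹' _
    refine ⟨hx, ?_⟩
    rw [mem_preimage, h0]
    exact Metric.mem_ball_self (by positivity)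
  · intro c hc
    refine eqOn_chainsIn (f := (lagClass ω).comp (push (D.shrink hs).chart.symm))
      (g := (Φ.comp (AddMonoidHom.mulRight triangleArea⁻¹)).comp
        ((area ω).comp (push (D.shrink hs).chart.symm))) (fun v hv => ?_) hc
    simp only [AddMonoidHom.comp_apply, push_single]
    rw [area_affSimplex _ hv]
    rw [(D.shrink hs).target_eq] at hv
    have e : v = ![v 0, v 1, v 2] := by
      ext i : 1
      fin_cases i <;> rfl
    have h1 := hΦ _ (hv 0) _ (hv 1) _ (hv 2)
    rw [← e] at h1
    refine Eq.trans h1 (congrArg Φ ?_)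
    change _ = _ * triangleArea⁻¹
    field_simp [triangleArea_pos.ne']

end Classes
end LagrangianCycles

end

/-! ### Segments of one chart in another -/

noncomputable section

set_option linter.unusedSectionVars false
set_option maxSynthPendingDepth 4
namespace LagrangianCycles

section Segments
open Set Filter Topology MeasureTheory

variable {N : Type u} [TopologicalSpace N] [ChartedSpace E4 N] {ω : SymplecticForm N}

/-- The singular edge that is a segment in a chart. -/
def segment (D : DarbouxChart ω) (p q : E4) : Simp N 1 := affSimplex D.chart.symm ![p, q]

theorem contDiffAt_transition (D D' : DarbouxChart ω) {y : E4} (hy : y ∈ D'.chart.target)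
    (hy' : D'.chart.symm y ∈ D.chart.source) : ContDiffAt ℝ 2 (fun z => D.chart (D'.chart.symm z)) y := by
  rw [← contMDiffAt_iff_contDiffAt]
  exact (D.contMDiffOn.contMDiffAt (D.chart.open_source.mem_nhds hy')).comp y
    (D'.contMDiffOn_symm.contMDiffAt (D'.chart.open_target.mem_nhds hy))

theorem segment_range (D : DarbouxChart ω) {p q : E4} (hp : p ∈ D.chart.target)
    (hq : q ∈ D.chart.target) {S : Set N} (h : segment D p q ∈ simpIn S 1) {t : ℝ}
    (ht : t ∈ Icc (0 : ℝ) 1) : p + t • (q - p) ∈ D.chart.target ∧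
      D.chart.symm (p + t • (q - p)) ∈ S := by
  refine ⟨(convex_target D).add_smul_sub_mem hp hq ht, ?_⟩
  have hx : (![1 - t, t] : Fin 2 → ℝ) ∈ stdSimplex ℝ (Fin 2) := by
    refine ⟨fun i => ?_, by simp⟩
    fin_cases i
    · exact sub_nonneg.2 ht.2
    · exact ht.1
  have h1 : segment D p q ⟨_, hx⟩ ∈ S := h ⟨⟨_, hx⟩, rfl⟩
  rw [segment, affSimplex_apply D.chart.continuousOn_symm (convex_target D) (pair_mem hp hq)] at h1
  convert h1 using 2
  change _ = comb ![p, q] ![1 - t, t]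
  rw [comb_pair]
  simp only [Matrix.cons_val]
  module

/-- The segments of one chart are regular curves in the others. -/
theorem segment_mem_lagEdges (D D' : DarbouxChart ω) {p q : E4} (hp : p ∈ D'.chart.target)
    (hq : q ∈ D'.chart.target) (h : segment D' p q ∈ simpIn D.chart.source 1) :
    Finsupp.single (segment D' p q) 1 ∈ lagEdges D := by
  set ℓ : ℝ → E4 := fun t => p + t • (q - p) with hℓ
  set γ : ℝ → E4 := fun t => D.chart (D'.chart.symm (ℓ t)) with hγ
  have hm : ∀ t ∈ Icc (0 : ℝ) 1, ℓ t ∈ D'.chart.target ∧ D'.chart.symm (ℓ t) ∈ D.chart.source :=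
    fun t ht => segment_range D' hp hq h ht
  have hγm : MapsTo γ (Icc 0 1) D.chart.target := fun t ht => D.chart.map_source (hm t ht).2
  have cℓ : ContDiff ℝ 2 ℓ := by fun_prop
  have cγ : ∀ t ∈ Icc (0 : ℝ) 1, ContDiffAt ℝ 2 γ t := fun t ht =>
    (contDiffAt_transition D D' (hm t ht).1 (hm t ht).2).comp t cℓ.contDiffAt
  have dℓ : ∀ t, HasDerivAt ℓ (q - p) t := fun t => by
    have := ((hasDerivAt_id t).smul_const (q - p)).const_add p
    rw [one_smul] at this
    exact this
  have cγ0 : ContinuousOn γ (Icc 0 1) := fun t ht => (cγ t ht).continuousAt.continuousWithinAt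
  have i0 : (0 : ℝ) ∈ Icc (0 : ℝ) 1 := by simp
  have i1 : (1 : ℝ) ∈ Icc (0 : ℝ) 1 := by simp
  have e : Finsupp.single (segment D' p q) 1 = arc D γ 0 1 := by
    rw [arc, segment]
    congr 1
    refine affSimplex_eq D'.chart.continuousOn_symm (convex_target D')
      (D.chart.continuousOn_symm.comp cγ0 hγm) (convex_Icc 0 1) hp hq i0 i1 fun a b ha hb hab => ?_
    have e1 : a • p + b • q = ℓ b := by
      rw [← eq_sub_iff_add_eq] at hab
      rw [hab, hℓ]
      module
    have e2 : a • (0 : ℝ) + b • (1 : ℝ) = b := by simp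
    rw [e1, e2]
    exact (D.chart.left_inv (hm b ⟨hb, by linarith⟩).2).symm
  rw [e]
  -- A constant segment is a degenerate affine edge. Otherwise `γ` is regular: were its velocity
  -- zero, the transition map back to `D'` would give `ℓ` velocity zero, whereas it is `q - p`.
  by_cases hpq : q = p
  · refine arc_lineMap_mem D (γ 0) 0 (fun t _ => ?_) fun t ht => ?_
    · simp [hγ, hℓ, hpq]
    · rw [uIcc_of_le zero_le_one] at ht
      exact hγm ht
  · refine arc_mem D cγ (fun t ht hd => hpq ?_) hγm
    have h1 := (cγ t ht).differentiableAt (by norm_num) |>.hasDerivAt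
    rw [hd] at h1
    have hy' : D.chart.symm (γ t) ∈ D'.chart.source := by
      rw [hγ]
      simp only
      rw [D.chart.left_inv (hm t ht).2]
      exact D'.chart.map_target (hm t ht).1
    have h2 := ((contDiffAt_transition D' D (hγm ht) hy').differentiableAt
      (by norm_num)).hasFDerivAt.comp_hasDerivAt t h1
    have heq : ℓ =ᶠ[𝓝 t] (fun z => D'.chart (D.chart.symm z)) ∘ γ := by
      have o1 := cℓ.continuous.continuousAt.eventually_mem (D'.chart.open_target.mem_nhds (hm t ht).1)
      have o2 := (ContinuousAt.comp (f := ℓ) (D'.chart.symm.continuousAt (hm t ht).1)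
        cℓ.continuous.continuousAt).eventually_mem (D.chart.open_source.mem_nhds (hm t ht).2)
      filter_upwards [o1, o2] with s hs hs'
      change _ = D'.chart (D.chart.symm (D.chart (D'.chart.symm (ℓ s))))
      rw [D.chart.left_inv (show D'.chart.symm (ℓ s) ∈ _ from hs'), D'.chart.right_inv hs]
    have h3 := (h2.congr_of_eventuallyEq heq).unique (dℓ t)
    rw [map_zero] at h3
    exact (sub_eq_zero.1 h3.symm)

theorem zero_mem_target (D : DarbouxChart ω) {x : N} (hx : x ∈ D.chart.source) :
    (0 : E4) ∈ D.chart.target := by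
  have h := D.chart.map_source hx
  rw [D.target_eq] at h ⊢
  exact Metric.mem_ball_self (Metric.pos_of_mem_ball h)

/-- An affine one-chain in a chart whose image is a cycle bounds an affine chain. -/
theorem exists_tbd_eq (D : DarbouxChart ω) (h0 : (0 : E4) ∈ D.chart.target) {c : Tup E4 1 →₀ ℤ}
    (hc : c ∈ chainsIn (tupIn D.chart.target 1)) (h : bd 0 (push D.chart.symm c) = 0) :
    ∃ b ∈ chainsIn (tupIn D.chart.target 2), tbd 1 b = c := by
  have h1 : tbd 0 c = 0 := by
    rw [bd_push D.chart.continuousOn_symm (convex_target D) hc] at h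
    -- Reading points in the chart is a left inverse of `push` in degree zero, so a cycle of the
    -- manifold comes from a cycle of tuples, which is filled by a cone.
    let ret : (Simp N 0 →₀ ℤ) →+ (Tup E4 0 →₀ ℤ) :=
      Finsupp.mapDomain.addMonoidHom fun σ _ => D.chart (σ (stdSimplex.vertex 0))
    have h2 : ∀ z ∈ chainsIn (tupIn D.chart.target 0), ret (push D.chart.symm z) = z := fun z hz => by
      refine eqOn_chainsIn (f := ret.comp (push D.chart.symm)) (g := AddMonoidHom.id _)
        (fun v hv => ?_) hz
      simp only [AddMonoidHom.comp_apply, push_single, AddMonoidHom.id_apply, ret,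
        Finsupp.mapDomain.addMonoidHom_apply, Finsupp.mapDomain_single]
      congr 1
      ext i : 1
      have hi : i = 0 := Fin.fin_one_eq_zero i
      subst hi
      rw [affSimplex_apply D.chart.continuousOn_symm (convex_target D) hv]
      have : comb v (stdSimplex.vertex (S := ℝ) (0 : Fin 1) : Fin 1 → ℝ) = v 0 := by
        rw [comb_apply]
        simp [stdSimplex.vertex]
      rw [this, D.chart.right_inv (hv 0)]
    rw [← h2 _ (tbd_mem hc), h, map_zero]
  exact ⟨cone 0 c, cone_mem h0 hc, by rw [tbd_cone, h1, map_zero, sub_zero]⟩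

/-- A chain in a rigid chart whose boundary is joined to affine edges by lagrangian strips is
homologous to a `C^1` chain, and its class is a function of the area of that chain. -/
theorem exists_straight {D : DarbouxChart ω} {Ψ : ℝ →+ LagQuotient ω} (hD : IsRigid D Ψ)
    (h0 : (0 : E4) ∈ D.chart.target) {c : Simp N 2 →₀ ℤ} (hc : c ∈ chainsIn (simpIn D.chart.source 2))
    (h : bd 1 c ∈ lagEdges D) : ∃ w ∈ chainsIn (c1Simp N ∩ simpIn D.chart.source 2),
      bd 1 w = bd 1 c ∧ c - w ∈ (bd 2).range ∧ lagClass ω w = Ψ (area ω w) := by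
  obtain ⟨x, hx, y, hy, hls⟩ := AddSubgroup.mem_sup.1 (show bd 1 c ∈ _ ⊔ _ from h)
  obtain ⟨l, hl, rfl⟩ := AddSubgroup.mem_map.1 hx
  obtain ⟨s, hs, rfl⟩ := AddSubgroup.mem_map.1 hy
  have hs0 : bd 0 (push D.chart.symm s) = 0 := by
    have := congrArg (bd 0) hls
    rwa [map_add, bd_bd, bd_bd, zero_add] at this
  obtain ⟨b, hb, rfl⟩ := exists_tbd_eq D h0 hs hs0
  have hl1 : l ∈ chainsIn (c1Simp N ∩ simpIn D.chart.source 2) :=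
    chainsIn_mono (s := lagIn D) (t := c1Simp N ∩ simpIn D.chart.source 2)
      (fun σ hσ => ⟨hσ.1.1, hσ.2⟩) hl
  have hb1 : push D.chart.symm b ∈ chainsIn (c1Simp N ∩ simpIn D.chart.source 2) :=
    map_mem_of_chainsIn _ _ (fun v hv => by
      rw [push_single]
      exact single_mem_chainsIn (affSimplex_symm_c1 D hv) 1) hb
  have hbd : bd 1 (l + push D.chart.symm b) = bd 1 c := by
    rw [map_add, bd_push D.chart.continuousOn_symm (convex_target D) hb, ← hls]
  -- The chains `c` and `l + push D.chart.symm b` have the same boundary and lie in a chart ball, so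
  -- they are homologous. The lagrangian part `l` has zero class and zero area, which leaves the
  -- affine part, where rigidity applies.
  refine ⟨l + push D.chart.symm b, add_mem hl1 hb1, hbd, ?_, ?_⟩
  · obtain ⟨d, -, hd⟩ := exists_bd_eq D.target_eq (sub_mem hc (chainsIn_mono (fun _ h => h.2)
      (add_mem hl1 hb1))) (by rw [map_sub, hbd, sub_self])
    exact ⟨d, hd⟩
  · rw [map_add, map_add, lagClass_lagIn D hl, area_lagIn D hl, zero_add, zero_add, hD b hb]

theorem lagClass_eq_of_sub_mem {c w : Simp N 2 →₀ ℤ} (h : c - w ∈ (bd 2).range) :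
    lagClass ω c = lagClass ω w := by
  obtain ⟨d, hd⟩ := h
  rw [← sub_eq_zero, ← map_sub, ← hd, lagClass_bd]

end Segments
end LagrangianCycles

end

/-! ### One homomorphism for all charts; nested families of charts -/

noncomputable section

set_option linter.unusedSectionVars false
set_option maxSynthPendingDepth 4
namespace LagrangianCycles

section Global
open Set Filter Topology MeasureTheory

/-- Every real number is an integral multiple of a small one. No continuity of the homomorphisms is
available or needed. -/
theorem hom_eq_of_small {G : Type*} [AddCommGroup G] {Φ Ψ : ℝ →+ G} {ε : ℝ} (hε : 0 < ε)
    (h : ∀ a, |a| ≤ ε → Φ a = Ψ a) : Φ = Ψ := by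
  ext a
  obtain ⟨n, hn⟩ := exists_nat_gt (|a| / ε)
  have hn0 : (0 : ℝ) < n := (by positivity : 0 ≤ |a| / ε).trans_lt hn
  have e : a = n • (a / n) := by
    rw [nsmul_eq_mul]
    field_simp
  rw [e, map_nsmul, map_nsmul, h]
  rw [abs_div, Nat.abs_cast, div_le_iff₀ hn0]
  rw [div_lt_iff₀ hε] at hn
  linarith

variable {N : Type u} [TopologicalSpace N] [ChartedSpace E4 N] {ω : SymplecticForm N}

/-- The homomorphisms of overlapping rigid charts agree. -/
theorem isRigid_unique {D D' : DarbouxChart ω} {Ψ Ψ' : ℝ →+ LagQuotient ω} (hD : IsRigid D Ψ)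
    (hD' : IsRigid D' Ψ') {x : N} (hx : x ∈ D.chart.source) (hx' : x ∈ D'.chart.source) :
    Ψ = Ψ' := by
  set y := D.chart x with hy
  have hyt : y ∈ D.chart.target := D.chart.map_source hx
  have ev : ∀ᶠ z in 𝓝 y, z ∈ D.chart.target ∧ D.chart.symm z ∈ D'.chart.source := by
    have h1 := (D.chart.symm.continuousAt hyt).eventually_mem
      (D'.chart.open_source.mem_nhds (by rwa [hy, D.chart.left_inv hx]))
    filter_upwards [D.chart.open_target.mem_nhds hyt, h1] with z hz hz'
    exact ⟨hz, hz'⟩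
  obtain ⟨δ, hδ, H⟩ := Metric.eventually_nhds_iff_ball.1 ev
  set s := δ / 2 with hs
  have hs0 : 0 < s := by positivity
  have hκ := triangleArea_pos
  -- Each `a` in this range is the area of a right triangle at `y` with legs `s` and `|b| ≤ s`,
  -- which lies in the ball of radius `δ = 2 * s`.
  refine hom_eq_of_small (ε := triangleArea * s * s) (by positivity) fun a ha => ?_
  set b := a / (triangleArea * s) with hb
  have hbs : |b| ≤ s := by
    rw [hb, abs_div, abs_of_pos (by positivity : 0 < triangleArea * s), div_le_iff₀ (by positivity)]
    linarith
  set v : Tup E4 2 := ![y, y + EuclideanSpace.single 0 s, y + EuclideanSpace.single 1 b] with hv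
  have hvK : v ∈ tupIn (Metric.ball y δ) 2 := by
    refine triple_mem (Metric.mem_ball_self hδ) ?_ ?_
    · rw [mem_ball_iff_norm, add_sub_cancel_left, PiLp.norm_single, Real.norm_eq_abs,
        abs_of_pos hs0]
      linarith
    · rw [mem_ball_iff_norm, add_sub_cancel_left, PiLp.norm_single, Real.norm_eq_abs]
      linarith
  have hvt : v ∈ tupIn D.chart.target 2 := fun i => (H _ (hvK i)).1
  have hcont : ContinuousOn D.chart.symm (Metric.ball y δ) :=
    D.chart.continuousOn_symm.mono fun z hz => (H z hz).1
  have range' : ∀ {n : ℕ} {w : Tup E4 n}, w ∈ tupIn (Metric.ball y δ) n →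
      affSimplex D.chart.symm w ∈ simpIn D'.chart.source n := fun hw => by
    rintro _ ⟨z, rfl⟩
    rw [affSimplex_apply hcont (convex_ball y δ) hw]
    exact (H _ (comb_mem (convex_ball y δ) hw z.2)).2
  set c : Simp N 2 →₀ ℤ := Finsupp.single (affSimplex D.chart.symm v) 1 with hc
  have harea : area ω c = a := by
    rw [hc, area_affSimplex D hvt]
    have : omega0 (v 1 - v 0) (v 2 - v 0) = s * b := by
      simp [hv, omega0]
    rw [this, hb]
    field_simp
  have hseg : ∀ p ∈ Metric.ball y δ, ∀ q ∈ Metric.ball y δ,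
      Finsupp.single (affSimplex (n := 1) D.chart.symm ![p, q]) 1 ∈ lagEdges D' := fun p hp q hq =>
    segment_mem_lagEdges D' D (H p hp).1 (H q hq).1 (range' (pair_mem hp hq))
  have hbd : bd 1 c ∈ lagEdges D' := by
    rw [hc, ← push_single, bd_push hcont (convex_ball y δ) (single_mem_chainsIn hvK 1),
      tbd_one_single]
    simp only [map_add, map_sub, push_single]
    exact add_mem (sub_mem (hseg _ (hvK 1) _ (hvK 2)) (hseg _ (hvK 0) _ (hvK 2)))
      (hseg _ (hvK 0) _ (hvK 1))
  have hc1 : c ∈ chainsIn (c1Simp N ∩ simpIn D'.chart.source 2) :=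
    single_mem_chainsIn (s := c1Simp N ∩ simpIn D'.chart.source 2) ⟨(affSimplex_symm_c1 D hvt).1, range' hvK⟩ 1
  -- In `D'` the triangle is homologous to a `C^1` chain with the same boundary. By Stokes in `D'`
  -- both have area `a`, so the class of the triangle is both `Ψ a` and `Ψ' a`.
  obtain ⟨w, hw, hwc, hcw, hwΨ⟩ := exists_straight hD' (zero_mem_target D' hx')
    (single_mem_chainsIn (range' hvK) 1) hbd
  have h1 := hD _ (single_mem_chainsIn hvt 1)
  rw [push_single, harea] at h1
  rw [← h1, lagClass_eq_of_sub_mem hcw, hwΨ, area_eq_edgeAction D' hw, hwc,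
    ← area_eq_edgeAction D' hc1, harea]

variable [IsManifold (𝓡 4) ((⊤ : ℕ∞) : WithTop ℕ∞) N]

/-- On a connected manifold the same homomorphism serves for all rigid charts. -/
theorem exists_global_hom [ConnectedSpace N] (ω : SymplecticForm N) :
    ∃ Ψ : ℝ →+ LagQuotient ω, ∀ D : DarbouxChart ω, ∀ x ∈ D.chart.source, ∀ Ψ',
      IsRigid D Ψ' → Ψ' = Ψ := by
  choose D hx _ Φ hΦ using fun x => exists_isRigid ω x (univ_mem (f := 𝓝 x))
  have hloc : IsLocallyConstant Φ := by
    rw [IsLocallyConstant.iff_eventually_eq]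
    intro x
    filter_upwards [(D x).chart.open_source.mem_nhds (hx x)] with y hy
    exact isRigid_unique (hΦ y) (hΦ x) (hx y) hy
  obtain ⟨x₀⟩ : Nonempty N := inferInstance
  refine ⟨Φ x₀, fun D' x hx' Ψ' hΨ' => ?_⟩
  rw [hloc.apply_eq_of_preconnectedSpace x₀ x]
  exact isRigid_unique hΨ' (hΦ x) hx' (hx x)

/-- A cover of a compact set by small open sets, with three nested families of Darboux charts
attached to the points of the set. -/
structure NestedCharts (ω : SymplecticForm N) (K : Set N) where
  /-- The small open sets. -/
  U : N → Set N
  /-- The small charts. -/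
  D₁ : N → DarbouxChart ω
  /-- The intermediate charts. -/
  D₂ : N → DarbouxChart ω
  /-- The large charts. -/
  D₃ : N → DarbouxChart ω
  /-- The class of an affine chain as a function of its area. -/
  Ψ : ℝ →+ LagQuotient ω
  isOpen : ∀ x, IsOpen (U x)
  mem : ∀ x, x ∈ U x
  rigid : ∀ y ∈ K, IsRigid (D₂ y) Ψ
  sub₁ : ∀ i, ∀ y ∈ K ∩ U i, U i ⊆ (D₁ y).chart.source
  sub₂ : ∀ i, ∀ y ∈ K ∩ U i, ∀ y' ∈ K ∩ U i, (D₁ y').chart.source ⊆ (D₂ y).chart.source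
  sub₃ : ∀ i, ∀ y ∈ K ∩ U i, ∀ y' ∈ K ∩ U i, (D₂ y').chart.source ⊆ (D₃ y).chart.source

theorem exists_nested_charts [T2Space N] [SecondCountableTopology N] [ConnectedSpace N]
    (ω : SymplecticForm N) {K : Set N} (hK : IsCompact K) : Nonempty (NestedCharts ω K) := by
  have : LocallyCompactSpace N := ChartedSpace.locallyCompactSpace E4 N
  let _ : MetricSpace N := TopologicalSpace.metrizableSpaceMetric N
  obtain ⟨Ψ, hΨ⟩ := exists_global_hom ω
  have nest : ∀ δ > 0, ∃ δ' > 0, δ' ≤ δ ∧ ∀ y ∈ K, ∃ D : DarbouxChart ω, IsRigid D Ψ ∧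
      Metric.ball y δ' ⊆ D.chart.source ∧ D.chart.source ⊆ Metric.ball y δ := by
    intro δ hδ
    -- With half the radius, a chart that contains `y` stays in the ball of radius `δ` around `y`.
    choose D hx hDU Φ hΦ using fun x : N =>
      exists_isRigid ω x (Metric.ball_mem_nhds x (half_pos hδ))
    obtain ⟨δ', hδ', h⟩ := lebesgue_number_lemma_of_metric hK (fun x => (D x).chart.open_source)
      fun x _ => mem_iUnion.2 ⟨x, hx x⟩
    refine ⟨min δ' δ, lt_min hδ' hδ, min_le_right _ _, fun y hy => ?_⟩
    obtain ⟨x, hxy⟩ := h y hy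
    refine ⟨D x, ?_, (Metric.ball_subset_ball (min_le_left _ _)).trans hxy, fun z hz => ?_⟩
    · rw [← hΨ (D x) x (hx x) (Φ x) (hΦ x)]
      exact hΦ x
    · have h1 := hDU x hz
      have h2 := hDU x (hxy (Metric.mem_ball_self hδ'))
      rw [Metric.mem_ball] at h1 h2 ⊢
      have := dist_triangle_right z y x
      linarith
  obtain ⟨x₀⟩ : Nonempty N := inferInstance
  obtain ⟨D₀, -⟩ := exists_darbouxChart ω x₀ univ_mem
  have : Nonempty (DarbouxChart ω) := ⟨D₀⟩
  -- The radii are at least halved at each stage. Two points in a common `U i` are at distance less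
  -- than `δ₀`, so passing from one to the other costs at most half of the next radius.
  obtain ⟨δ₂, hδ₂, -, h3⟩ := nest 1 one_pos
  obtain ⟨δ₁, hδ₁, hδ₁₂, h2⟩ := nest (δ₂ / 2) (half_pos hδ₂)
  obtain ⟨δ₀, hδ₀, hδ₀₁, h1⟩ := nest (δ₁ / 2) (half_pos hδ₁)
  choose! D₃ _ in₃ _ using h3
  choose! D₂ r₂ in₂ out₂ using h2
  choose! D₁ _ in₁ out₁ using h1
  refine ⟨fun x => Metric.ball x (δ₀ / 2), D₁, D₂, D₃, Ψ, fun _ => Metric.isOpen_ball,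
    fun x => Metric.mem_ball_self (half_pos hδ₀), r₂, fun i y hy => ?_, fun i y hy y' hy' => ?_,
    fun i y hy y' hy' => ?_⟩
  · refine fun z hz => in₁ y hy.1 ?_
    have h1 := Metric.mem_ball.1 hy.2
    have h2 := Metric.mem_ball.1 hz
    have := dist_triangle_right z y i
    exact Metric.mem_ball.2 (by linarith)
  all_goals
    have h1 := Metric.mem_ball.1 hy.2
    have h2 := Metric.mem_ball.1 hy'.2
    have h3 := dist_triangle_right y' y i
    intro z hz
  · have h4 := Metric.mem_ball.1 (out₁ y' hy'.1 hz)
    have h5 := dist_triangle z y' y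
    exact in₂ y hy.1 (Metric.mem_ball.2 (by linarith))
  · have h4 := Metric.mem_ball.1 (out₂ y' hy'.1 hz)
    have h5 := dist_triangle z y' y
    exact in₃ y hy.1 (Metric.mem_ball.2 (by linarith))

end Global
end LagrangianCycles

end

/-! ### Edges of class `C^1` and their action -/

noncomputable section

set_option linter.unusedSectionVars false
set_option maxSynthPendingDepth 4
namespace LagrangianCycles

section Edges
open Set Filter Topology MeasureTheory

variable {N : Type u} [TopologicalSpace N] [ChartedSpace E4 N] {ω : SymplecticForm N}

/-- A singular edge as a curve. -/
def edgeCurve (e : Simp N 1) (t : ℝ) : N := ambient e ![1 - t, t]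

theorem pair_mem_stdSimplex {t : ℝ} (ht : t ∈ Icc (0 : ℝ) 1) :
    (![1 - t, t] : Fin 2 → ℝ) ∈ stdSimplex ℝ (Fin 2) := by
  refine ⟨fun i => ?_, by simp⟩
  fin_cases i
  · exact sub_nonneg.2 ht.2
  · exact ht.1

theorem continuousOn_edgeCurve (e : Simp N 1) : ContinuousOn (edgeCurve e) (Icc 0 1) :=
  (continuousOn_ambient e).comp (by fun_prop) fun _ ht => pair_mem_stdSimplex ht

theorem edgeCurve_mem {e : Simp N 1} {S : Set N} (h : e ∈ simpIn S 1) {t : ℝ}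
    (ht : t ∈ Icc (0 : ℝ) 1) : edgeCurve e t ∈ S := by
  rw [edgeCurve, ambient_of_mem _ (pair_mem_stdSimplex ht)]
  exact h ⟨_, rfl⟩

/-- The `C^1` edges. -/
def c1Edge (N : Type u) [TopologicalSpace N] [ChartedSpace E4 N] : Set (Simp N 1) :=
  {e | ContMDiffOn 𝓘(ℝ, ℝ) (𝓡 4) 1 (edgeCurve e) (Icc 0 1)}

theorem face_mem_c1Edge {σ : Simp N 2} (hσ : σ ∈ c1Simp N) (i : Fin 3) :
    Simp.face (n := 1) i σ ∈ c1Edge N := by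
  have key : ∀ ℓ : ℝ → ℝ × ℝ, ContDiff ℝ 1 ℓ → MapsTo ℓ (Icc 0 1) triangle →
      ContMDiffOn 𝓘(ℝ, ℝ) (𝓡 4) 1 (fun t => SingularTwoSimplex.planar σ (ℓ t)) (Icc 0 1) :=
    fun ℓ hℓ hm => ContMDiffOn.comp hσ hℓ.contMDiff.contMDiffOn hm
  fin_cases i
  · exact (key (fun t => (1 - t, t)) (by fun_prop) fun t ht =>
      ⟨sub_nonneg.2 ht.2, ht.1, by simp⟩).congr fun t ht => (ambient_face_two σ ht).1
  · exact (key (fun t => (0, t)) (by fun_prop) fun t ht =>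
      ⟨le_rfl, ht.1, by simpa using ht.2⟩).congr fun t ht => (ambient_face_two σ ht).2.1
  · exact (key (fun t => (t, 0)) (by fun_prop) fun t ht =>
      ⟨ht.1, le_rfl, by simpa using ht.2⟩).congr fun t ht => (ambient_face_two σ ht).2.2

theorem edgeCurve_segment (D : DarbouxChart ω) {p q : E4} (hp : p ∈ D.chart.target)
    (hq : q ∈ D.chart.target) {t : ℝ} (ht : t ∈ Icc (0 : ℝ) 1) :
    edgeCurve (segment D p q) t = D.chart.symm (p + t • (q - p)) := by
  rw [edgeCurve, ambient_of_mem _ (pair_mem_stdSimplex ht), segment,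
    affSimplex_apply D.chart.continuousOn_symm (convex_target D) (pair_mem hp hq)]
  congr 1
  change comb ![p, q] ![1 - t, t] = _
  rw [comb_pair]
  simp only [Matrix.cons_val]
  module

theorem segment_mem_c1Edge (D : DarbouxChart ω) {p q : E4} (hp : p ∈ D.chart.target)
    (hq : q ∈ D.chart.target) : segment D p q ∈ c1Edge N := by
  have h1 : ContDiff ℝ 1 fun t : ℝ => p + t • (q - p) := by fun_prop
  exact (((D.contMDiffOn_symm.of_le (by norm_num)).comp h1.contMDiff.contMDiffOn
    fun t ht => (convex_target D).add_smul_sub_mem hp hq ht)).congr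
      fun t ht => edgeCurve_segment D hp hq ht

theorem arc_edgeCurve (D : DarbouxChart ω) {e : Simp N 1} (he : e ∈ simpIn D.chart.source 1) :
    arc D (fun t => D.chart (edgeCurve e t)) 0 1 = Finsupp.single e 1 := by
  have hc : ContinuousOn (D.chart.symm ∘ fun t => D.chart (edgeCurve e t)) (Icc 0 1) :=
    (continuousOn_edgeCurve e).congr fun t ht => D.chart.left_inv (edgeCurve_mem he ht)
  rw [arc]
  congr 1
  conv_rhs => rw [← affSimplex_ambient e]
  have e1 : stdTup 1 = ![Pi.single 0 1, Pi.single 1 1] := by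
    ext i : 1
    fin_cases i <;> rfl
  rw [e1]
  refine affSimplex_eq hc (convex_Icc 0 1) (continuousOn_ambient e) (convex_stdSimplex ℝ _)
    (by simp) (by simp) (by rw [← stdSimplex.vertex_coe]; exact (stdSimplex.vertex _).2)
    (by rw [← stdSimplex.vertex_coe]; exact (stdSimplex.vertex _).2) fun a b ha hb hab => ?_
  have hb' : b ∈ Icc (0 : ℝ) 1 := ⟨hb, by linarith⟩
  have e2 : a • (0 : ℝ) + b • (1 : ℝ) = b := by simp
  rw [e2]
  refine (D.chart.left_inv (edgeCurve_mem he hb')).trans ?_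
  rw [edgeCurve]
  congr 1
  ext i
  fin_cases i
  · simp [show (1 : ℝ) - b = a by linarith]
  · simp

theorem edgeCurve_ite (e : Simp N 1) (i : Fin 2) :
    edgeCurve e (if i = 0 then 1 else 0) = e (stdSimplex.vertex (i.succAbove 0)) := by
  rw [← ambient_coe, stdSimplex.vertex_coe, edgeCurve]
  congr 1
  ext j
  fin_cases i <;> fin_cases j <;> simp

theorem face_apply_vertex (e : Simp N 1) (i : Fin 2) :
    e.face i (stdSimplex.vertex 0) = edgeCurve e (if i = 0 then 1 else 0) := by
  change e (stdSimplex.map i.succAbove (stdSimplex.vertex 0)) = _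
  rw [stdSimplex.map_vertex, edgeCurve_ite]

/-- The boundary of an edge is determined by its end points. -/
theorem bd_zero_eq {e e' : Simp N 1} (h0 : edgeCurve e 0 = edgeCurve e' 0)
    (h1 : edgeCurve e 1 = edgeCurve e' 1) :
    bd 0 (Finsupp.single e 1) = bd 0 (Finsupp.single e' 1) := by
  have hf : ∀ i : Fin 2, e.face i = e'.face i := fun i => by
    ext x
    have hx : x = stdSimplex.vertex 0 := by
      apply Subtype.ext
      have := x.2.2
      rw [Fin.sum_univ_one] at this
      ext j
      rw [Fin.fin_one_eq_zero j]
      simpa using this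
    rw [hx, face_apply_vertex, face_apply_vertex]
    fin_cases i
    · exact h1
    · exact h0
  rw [bd_single, bd_single]
  exact Finset.sum_congr rfl fun i _ => by rw [hf i]

/-- A `C^1` cycle of edges in a chart bounds a `C^1` chain in that chart. -/
theorem exists_c1_fill (D : DarbouxChart ω) (h0 : (0 : E4) ∈ D.chart.target) {z : Simp N 1 →₀ ℤ}
    (hz : z ∈ chainsIn (c1Edge N ∩ simpIn D.chart.source 1)) (h : bd 0 z = 0) :
    ∃ w ∈ chainsIn (c1Simp N ∩ simpIn D.chart.source 2), bd 1 w = z := by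
  let g : Simp N 1 → ℝ → E4 := fun e t => D.chart (edgeCurve e t)
  -- A barycentric cone on a `C^1` edge need not be `C^1` at its apex, whereas the homotopy `s • g e
  -- t` is `C^1` on the square. The square has an extra constant edge at the centre, which the
  -- boundary of the constant triangle cancels.
  let W : (Simp N 1 →₀ ℤ) →+ (Simp N 2 →₀ ℤ) := extend fun e =>
    push (D.chart.symm ∘ homotopy (fun _ => 0) (g e)) (squareTup 0 1) +
      push D.chart.symm (Finsupp.single ![0, 0, 0] 1)
  let R : (Simp N 0 →₀ ℤ) →+ (Simp N 1 →₀ ℤ) := Finsupp.mapDomain.addMonoidHom fun s =>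
    segment D 0 (D.chart (s (stdSimplex.vertex 0)))
  have u01 : uIcc (0 : ℝ) 1 = Icc 0 1 := uIcc_of_le zero_le_one
  have cont : ∀ e ∈ c1Edge N ∩ simpIn D.chart.source 1, ContDiffOn ℝ 1 (g e) (Icc 0 1) := fun e he => by
    have h1 : ContMDiffOn 𝓘(ℝ, ℝ) 𝓘(ℝ, E4) 1 (D.chart ∘ edgeCurve e) (Icc 0 1) :=
      (D.contMDiffOn.of_le (by norm_num)).comp he.1 fun t ht => edgeCurve_mem he.2 ht
    exact contMDiffOn_iff_contDiffOn.1 h1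
  have maps : ∀ e ∈ c1Edge N ∩ simpIn D.chart.source 1, MapsTo (g e) (Icc 0 1) D.chart.target :=
    fun e he t ht => D.chart.map_source (edgeCurve_mem he.2 ht)
  have hv0 : (![0, 0, 0] : Tup E4 2) ∈ tupIn D.chart.target 2 := triple_mem h0 h0 h0
  refine ⟨W z, map_mem_of_chainsIn _ _ (fun e he => ?_) hz, ?_⟩
  · simp only [W, extend_single, one_smul]
    refine add_mem (map_mem_of_chainsIn _ _ (fun v hv => ?_) (squareTup_mem 0 1)) ?_
    · rw [push_single]
      have hm : MapsTo (homotopy (fun _ => 0) (g e)) (Icc (0 : ℝ) 1 ×ˢ uIcc (0 : ℝ) 1)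
          D.chart.target := mapsTo_homotopy D (fun _ _ => h0) (by rw [u01]; exact maps e he)
      have hc : ContDiffOn ℝ 1 (homotopy (fun _ => 0) (g e)) (Icc (0 : ℝ) 1 ×ˢ uIcc (0 : ℝ) 1) := by
        have h1 : ContDiffOn ℝ 1 (fun q : ℝ × ℝ => g e q.2) (Icc (0 : ℝ) 1 ×ˢ uIcc (0 : ℝ) 1) :=
          (cont e he).comp contDiffOn_snd fun q hq => by rw [← u01]; exact hq.2
        exact contDiffOn_const.add (contDiffOn_fst.smul (h1.sub contDiffOn_const))
      exact single_mem_chainsIn (s := c1Simp N ∩ simpIn D.chart.source 2)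
        ⟨isC1_affSimplex D (convex_square 0 1) hc hm hv,
          affSimplex_mem_simpIn D (convex_square 0 1) hc.continuousOn hm hv⟩ 1
    · rw [push_single]
      exact single_mem_chainsIn (affSimplex_symm_c1 D hv0) 1
  · have key : ∀ y ∈ chainsIn (c1Edge N ∩ simpIn D.chart.source 1), bd 1 (W y) = y - R (bd 0 y) := by
      intro y hy
      refine eqOn_chainsIn (f := (bd 1).comp W) (g := AddMonoidHom.id _ - R.comp (bd 0))
        (fun e he => ?_) hy
      have hR : R (bd 0 (Finsupp.single e 1)) =
          Finsupp.single (segment D 0 (g e 1)) 1 - Finsupp.single (segment D 0 (g e 0)) 1 := by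
        rw [bd_single, Fin.sum_univ_two]
        simp only [R, map_add, map_zsmul, Finsupp.mapDomain.addMonoidHom_apply,
          Finsupp.mapDomain_single, face_apply_vertex]
        simp [g, sub_eq_add_neg]
      have e0 : arc D (fun _ => 0) 0 1 = push D.chart.symm (Finsupp.single ![0, 0] 1) := by
        rw [arc, push_single]
        congr 1
        exact affSimplex_eq (K := univ) (by exact continuousOn_const) convex_univ
          D.chart.continuousOn_symm (convex_target D) (mem_univ _) (mem_univ _) h0 h0
          fun a b _ _ _ => by simp
      simp only [AddMonoidHom.comp_apply, AddMonoidHom.sub_apply, AddMonoidHom.id_apply, hR]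
      simp only [W, extend_single, one_smul]
      rw [map_add, bd_push_homotopy D continuousOn_const (by rw [u01]; exact (cont e he).continuousOn)
        (fun _ _ => h0) (by rw [u01]; exact maps e he), arc_edgeCurve D he.2, e0,
        bd_push D.chart.continuousOn_symm (convex_target D) (single_mem_chainsIn hv0 1),
        tbd_one_single]
      simp only [map_add, map_sub, push_single, segment, Matrix.cons_val]
      abel
    rw [key z hz, h, map_zero, sub_zero]

/-- The action of a cycle does not depend on the chart. -/
theorem edgeAction_eq {D D' : DarbouxChart ω} (h0 : (0 : E4) ∈ D.chart.target)
    (hDD' : D.chart.source ⊆ D'.chart.source) {z : Simp N 1 →₀ ℤ}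
    (hz : z ∈ chainsIn (c1Edge N ∩ simpIn D.chart.source 1)) (h : bd 0 z = 0) :
    edgeAction D z = edgeAction D' z := by
  -- A `C^1` filling inside the smaller chart lies in both charts, and Stokes' formula in either
  -- gives its area.
  obtain ⟨w, hw, rfl⟩ := exists_c1_fill D h0 hz h
  rw [← area_eq_edgeAction D hw, area_eq_edgeAction D' (chainsIn_mono (fun σ hσ =>
    ⟨hσ.1, hσ.2.trans hDD'⟩ : c1Simp N ∩ simpIn D.chart.source 2 ⊆
      c1Simp N ∩ simpIn D'.chart.source 2) hw)]

end Edges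
end LagrangianCycles

end

/-! ### Straightening the edges of small chains -/

noncomputable section

set_option linter.unusedSectionVars false
set_option maxSynthPendingDepth 4
namespace LagrangianCycles

section Small
open Set Filter Topology MeasureTheory

variable {N : Type u} [TopologicalSpace N]

/-- The zeroth vertex of a singular simplex. -/
def start {n : ℕ} (σ : Simp N n) : N := σ (stdSimplex.vertex 0)

/-- The union of the images of the simplices of a chain. -/
def carrier {n : ℕ} (c : Simp N n →₀ ℤ) : Set N := ⋃ σ ∈ c.support, range σ

theorem isCompact_carrier {n : ℕ} (c : Simp N n →₀ ℤ) : IsCompact (carrier c) :=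
  c.support.finite_toSet.isCompact_biUnion fun σ _ => isCompact_range σ.continuous

theorem range_subset_carrier {n : ℕ} {c : Simp N n →₀ ℤ} {σ : Simp N n} (hσ : σ ∈ c.support) :
    range σ ⊆ carrier c := subset_biUnion_of_mem (u := fun σ : Simp N n => range σ) hσ

theorem bd_single_mem {n : ℕ} (σ : Simp N (n + 1)) :
    bd n (Finsupp.single σ 1) ∈ chainsIn (simpIn (range σ) n) :=
  bd_mem (single_mem_chainsIn Subset.rfl 1)

variable [ChartedSpace E4 N] {ω : SymplecticForm N} {K : Set N} (C : NestedCharts ω K)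

/-- The small simplices. -/
def NestedCharts.small (n : ℕ) : Set (Simp N n) := {σ | range σ ⊆ K ∧ ∃ i, range σ ⊆ C.U i}

namespace NestedCharts

theorem exists_subdiv_mem {n : ℕ} {c : Simp N n →₀ ℤ} (hK : carrier c ⊆ K) :
    ∃ k, subdiv k n c ∈ chainsIn (C.small n) := by
  obtain ⟨k, hk⟩ := exists_subdiv c C.U C.isOpen fun σ _ x => ⟨σ x, C.mem _⟩
  refine ⟨k, fun τ hτ => ?_⟩
  obtain ⟨⟨σ, hσ, h⟩, h'⟩ := hk k le_rfl τ hτ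
  refine ⟨?_, h'⟩
  exact h.trans ((range_subset_carrier hσ).trans hK)

variable {C} {m n : ℕ} {σ : Simp N m} {τ : Simp N n}

theorem small_of_range (hσ : σ ∈ C.small m) (hτ : τ ∈ simpIn (range σ) n) : τ ∈ C.small n := by
  obtain ⟨h1, i, hi⟩ := hσ
  exact ⟨hτ.trans h1, i, hτ.trans hi⟩

theorem mem_source₁ (hσ : σ ∈ C.small m) : range σ ⊆ (C.D₁ (start σ)).chart.source := by
  obtain ⟨h1, i, hi⟩ := hσ
  exact hi.trans (C.sub₁ i _ ⟨h1 ⟨_, rfl⟩, hi ⟨_, rfl⟩⟩)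

/-- The chart used to straighten a simplex is fixed by its own starting point, so that neighbouring
simplices treat a common face alike. This inclusion places the charts of all faces in one chart of
the ambient simplex. -/
theorem source₁_subset (hσ : σ ∈ C.small m) (hτ : τ ∈ simpIn (range σ) n) :
    (C.D₁ (start τ)).chart.source ⊆ (C.D₂ (start σ)).chart.source := by
  obtain ⟨h1, i, hi⟩ := hσ
  have hs : start τ ∈ range σ := hτ ⟨_, rfl⟩
  exact C.sub₂ i _ ⟨h1 ⟨_, rfl⟩, hi ⟨_, rfl⟩⟩ _ ⟨h1 hs, hi hs⟩

theorem source₂_subset (hσ : σ ∈ C.small m) (hτ : τ ∈ simpIn (range σ) n) :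
    (C.D₂ (start τ)).chart.source ⊆ (C.D₃ (start σ)).chart.source := by
  obtain ⟨h1, i, hi⟩ := hσ
  have hs : start τ ∈ range σ := hτ ⟨_, rfl⟩
  exact C.sub₃ i _ ⟨h1 ⟨_, rfl⟩, hi ⟨_, rfl⟩⟩ _ ⟨h1 hs, hi hs⟩

theorem mem_source₂ (hσ : σ ∈ C.small m) : range σ ⊆ (C.D₂ (start σ)).chart.source :=
  (mem_source₁ hσ).trans (source₁_subset hσ Subset.rfl)

theorem zero_mem₁ (hσ : σ ∈ C.small m) : (0 : E4) ∈ (C.D₁ (start σ)).chart.target :=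
  zero_mem_target _ (mem_source₁ hσ ⟨stdSimplex.vertex 0, rfl⟩)

theorem zero_mem₂ (hσ : σ ∈ C.small m) : (0 : E4) ∈ (C.D₂ (start σ)).chart.target :=
  zero_mem_target _ (mem_source₂ hσ ⟨stdSimplex.vertex 0, rfl⟩)

variable (C) in
/-- The segment with the end points of an edge. -/
def straightEdge (e : Simp N 1) : Simp N 1 :=
  segment (C.D₁ (start e)) ((C.D₁ (start e)).chart (edgeCurve e 0))
    ((C.D₁ (start e)).chart (edgeCurve e 1))

variable (C) in
/-- The replacement of edges by segments. -/
def straight : (Simp N 1 →₀ ℤ) →+ (Simp N 1 →₀ ℤ) :=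
  extend fun e => Finsupp.single (C.straightEdge e) 1

variable {e : Simp N 1}

theorem end_mem (he : e ∈ C.small 1) {t : ℝ} (ht : t ∈ Icc (0 : ℝ) 1) :
    (C.D₁ (start e)).chart (edgeCurve e t) ∈ (C.D₁ (start e)).chart.target :=
  (C.D₁ (start e)).chart.map_source (edgeCurve_mem (mem_source₁ he) ht)

theorem straightEdge_mem (he : e ∈ C.small 1) :
    C.straightEdge e ∈ c1Edge N ∩ simpIn (C.D₁ (start e)).chart.source 1 :=
  ⟨segment_mem_c1Edge _ (end_mem he (by simp)) (end_mem he (by simp)),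
    affSimplex_mem_simpIn _ (h := id) (convex_target _) continuousOn_id (mapsTo_id _)
      (pair_mem (end_mem he (by simp)) (end_mem he (by simp)))⟩

theorem bd_straightEdge (he : e ∈ C.small 1) :
    bd 0 (Finsupp.single (C.straightEdge e) 1) = bd 0 (Finsupp.single e 1) := by
  have h0 : (0 : ℝ) ∈ Icc (0 : ℝ) 1 := by simp
  have h1 : (1 : ℝ) ∈ Icc (0 : ℝ) 1 := by simp
  refine bd_zero_eq ?_ ?_
  · rw [straightEdge, edgeCurve_segment _ (end_mem he h0) (end_mem he h1) h0, zero_smul, add_zero,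
      (C.D₁ (start e)).chart.left_inv (edgeCurve_mem (mem_source₁ he) h0)]
  · rw [straightEdge, edgeCurve_segment _ (end_mem he h0) (end_mem he h1) h1, one_smul,
      add_sub_cancel, (C.D₁ (start e)).chart.left_inv (edgeCurve_mem (mem_source₁ he) h1)]

theorem bd_straight {c : Simp N 1 →₀ ℤ} (hc : c ∈ chainsIn (C.small 1)) :
    bd 0 (C.straight c) = bd 0 c :=
  eqOn_chainsIn (f := (bd 0).comp C.straight) (fun e he => by
    simp only [AddMonoidHom.comp_apply, straight, extend_single, one_smul]
    exact bd_straightEdge he) hc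

theorem straight_mem (hσ : σ ∈ C.small m) {c : Simp N 1 →₀ ℤ}
    (hc : c ∈ chainsIn (simpIn (range σ) 1)) :
    C.straight c ∈ chainsIn (c1Edge N ∩ simpIn (C.D₂ (start σ)).chart.source 1) := by
  refine map_mem_of_chainsIn _ _ (fun e he => ?_) hc
  rw [straight, extend_single, one_smul]
  obtain ⟨h1, h2⟩ := straightEdge_mem (small_of_range hσ he)
  exact single_mem_chainsIn (s := c1Edge N ∩ simpIn (C.D₂ (start σ)).chart.source 1)
    ⟨h1, h2.trans (source₁_subset hσ he)⟩ 1

/-- The straightened edges are segments of various small charts, all contained in the chart `D₂` of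
`σ`; there they are regular arcs. -/
theorem straight_mem_lagEdges (hσ : σ ∈ C.small m) {c : Simp N 1 →₀ ℤ}
    (hc : c ∈ chainsIn (simpIn (range σ) 1)) : C.straight c ∈ lagEdges (C.D₂ (start σ)) := by
  refine map_mem_of_chainsIn _ _ (fun e he => ?_) hc
  rw [straight, extend_single, one_smul]
  have he' := small_of_range hσ he
  exact segment_mem_lagEdges _ _ (end_mem he' (by simp)) (end_mem he' (by simp))
    ((straightEdge_mem he').2.trans (source₁_subset hσ he))

variable (C) in
/-- The action of the straightened boundary. -/
def straightArea : (Simp N 2 →₀ ℤ) →+ ℝ :=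
  extend fun σ => edgeAction (C.D₂ (start σ)) (C.straight (bd 1 (Finsupp.single σ 1)))

theorem straightArea_bd {b : Simp N 3 →₀ ℤ} (hb : b ∈ chainsIn (C.small 3)) :
    C.straightArea (bd 2 b) = 0 := by
  refine eqOn_chainsIn (f := C.straightArea.comp (bd 2)) (g := 0) (fun τ hτ => ?_) hb
  -- The straightened boundary of each face is a cycle, so its action may be computed in the large
  -- chart of `τ`. There the sum over the faces involves `∂∂τ = 0`.
  have key : ∀ y ∈ chainsIn (simpIn (range τ) 2),
      C.straightArea y = edgeAction (C.D₃ (start τ)) (C.straight (bd 1 y)) := fun y hy => by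
    refine eqOn_chainsIn (f := C.straightArea)
      (g := (edgeAction (C.D₃ (start τ))).comp (C.straight.comp (bd 1))) (fun σ hσ => ?_) hy
    have hσ' := small_of_range hτ hσ
    simp only [straightArea, extend_single, one_smul, AddMonoidHom.comp_apply]
    refine edgeAction_eq (zero_mem₂ hσ') (source₂_subset hτ hσ)
      (straight_mem hσ' (bd_single_mem σ)) ?_
    rw [bd_straight (chainsIn_mono (fun e he => small_of_range hσ' he) (bd_single_mem σ)), bd_bd]
  rw [AddMonoidHom.comp_apply, key _ (bd_single_mem τ), bd_bd, map_zero, map_zero]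
  rfl

/-- The area of a small `C^1` cycle. -/
theorem area_eq_straightArea {c : Simp N 2 →₀ ℤ} (hc : c ∈ chainsIn (c1Simp N ∩ C.small 2))
    (h : bd 1 c = 0) : area ω c = C.straightArea c := by
  -- The error of straightening an edge. An edge minus its segment is a cycle, so the error does not
  -- depend on the chart; the area and `straightArea` thus differ by a function of the boundary,
  -- which is zero on cycles.
  let J : (Simp N 1 →₀ ℤ) →+ ℝ := extend fun e =>
    edgeAction (C.D₁ (start e)) (Finsupp.single e 1 - Finsupp.single (C.straightEdge e) 1)
  have key : ∀ y ∈ chainsIn (c1Simp N ∩ C.small 2), area ω y = C.straightArea y + J (bd 1 y) := by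
    intro y hy
    refine eqOn_chainsIn (f := area ω) (g := C.straightArea + J.comp (bd 1)) (fun σ hσ => ?_) hy
    have hb : bd 1 (Finsupp.single σ 1) ∈ chainsIn (c1Edge N ∩ simpIn (range σ) 1) :=
      altSum_mem (s := c1Simp N ∩ {σ}) (t := c1Edge N ∩ simpIn (range σ) 1) _
        (by
          rintro _ ⟨hx, rfl⟩ i
          exact ⟨face_mem_c1Edge hx i, face_mem_simpIn Subset.rfl i⟩)
        (single_mem_chainsIn (s := c1Simp N ∩ {σ}) ⟨hσ.1, rfl⟩ 1)
    have hJ : J (bd 1 (Finsupp.single σ 1)) = edgeAction (C.D₂ (start σ))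
        (bd 1 (Finsupp.single σ 1) - C.straight (bd 1 (Finsupp.single σ 1))) := by
      refine eqOn_chainsIn (f := J) (g := (edgeAction (C.D₂ (start σ))).comp
        (AddMonoidHom.id _ - C.straight)) (fun e he => ?_) hb
      have he' := small_of_range hσ.2 he.2
      simp only [J, extend_single, one_smul, AddMonoidHom.comp_apply, AddMonoidHom.sub_apply,
        AddMonoidHom.id_apply, straight]
      refine edgeAction_eq (zero_mem₁ he') (source₁_subset hσ.2 he.2) (sub_mem ?_ ?_) ?_
      · exact single_mem_chainsIn (s := c1Edge N ∩ simpIn (C.D₁ (start e)).chart.source 1)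
          ⟨he.1, mem_source₁ he'⟩ 1
      · exact single_mem_chainsIn (straightEdge_mem he') 1
      · rw [map_sub, bd_straightEdge he', sub_self]
    rw [AddMonoidHom.add_apply, AddMonoidHom.comp_apply, hJ, map_sub,
      area_eq_edgeAction (C.D₂ (start σ)) (single_mem_chainsIn
        (s := c1Simp N ∩ simpIn (C.D₂ (start σ)).chart.source 2) ⟨hσ.1, mem_source₂ hσ.2⟩ 1)]
    simp only [straightArea, extend_single, one_smul]
    ring
  rw [key c hc, h, map_zero, add_zero]

theorem exists_edge_homology (he : e ∈ C.small 1) :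
    ∃ b ∈ chainsIn (simpIn (C.D₁ (start e)).chart.source 2),
      bd 1 b = Finsupp.single e 1 - C.straight (Finsupp.single e 1) := by
  refine exists_bd_eq (C.D₁ (start e)).target_eq (n := 0) ?_ ?_
  · rw [straight, extend_single, one_smul]
    exact sub_mem (single_mem_chainsIn (mem_source₁ he) 1)
      (single_mem_chainsIn (straightEdge_mem he).2 1)
  · rw [map_sub, bd_straight (single_mem_chainsIn he 1), sub_self]

/-- Small cycles are homologous to `C^1` cycles whose class is a function of their area. -/
theorem exists_c1_homologous {c : Simp N 2 →₀ ℤ} (hc : c ∈ chainsIn (C.small 2))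
    (h : bd 1 c = 0) : ∃ w ∈ chainsIn (c1Simp N), c - w ∈ (bd 2).range ∧
      lagClass ω w = C.Ψ (area ω w) := by
  choose! η hη hηb using fun e (he : e ∈ C.small 1) => exists_edge_homology he
  let H : (Simp N 1 →₀ ℤ) →+ (Simp N 2 →₀ ℤ) := extend η
  have hH : ∀ y ∈ chainsIn (C.small 1), bd 1 (H y) = y - C.straight y := fun y hy =>
    eqOn_chainsIn (f := (bd 1).comp H) (g := AddMonoidHom.id _ - C.straight) (fun e he => by
      simp only [H, AddMonoidHom.comp_apply, extend_single, one_smul]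
      exact hηb e he) hy
  have hHm : ∀ σ ∈ C.small 2, H (bd 1 (Finsupp.single σ 1)) ∈
      chainsIn (simpIn (C.D₂ (start σ)).chart.source 2) := fun σ hσ => by
    refine map_mem_of_chainsIn H _ (fun e he => ?_) (bd_single_mem σ)
    simp only [H, extend_single, one_smul]
    exact chainsIn_mono (fun ρ hρ => hρ.trans (source₁_subset hσ he)) (hη e (small_of_range hσ he))
  have key : ∀ σ : Simp N 2, ∃ w : Simp N 2 →₀ ℤ, σ ∈ C.small 2 →
      w ∈ chainsIn (c1Simp N) ∧
      Finsupp.single σ 1 - H (bd 1 (Finsupp.single σ 1)) - w ∈ (bd 2).range ∧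
      lagClass ω w = C.Ψ (area ω w) := fun σ => by
    by_cases hσ : σ ∈ C.small 2
    · have hb := bd_single_mem σ
      -- Removing the homotopies of its edges turns `σ` into a chain with straightened boundary, to
      -- which `exists_straight` applies.
      have hbd : bd 1 (Finsupp.single σ 1 - H (bd 1 (Finsupp.single σ 1))) =
          C.straight (bd 1 (Finsupp.single σ 1)) := by
        rw [map_sub, hH _ (chainsIn_mono (fun e he => small_of_range hσ he) hb), sub_sub_cancel]
      obtain ⟨w, hw, -, h2, h3⟩ := exists_straight (C.rigid _ (hσ.1 ⟨stdSimplex.vertex 0, rfl⟩))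
        (zero_mem₂ hσ) (sub_mem (single_mem_chainsIn (mem_source₂ hσ) 1) (hHm σ hσ))
        (by rw [hbd]; exact straight_mem_lagEdges hσ hb)
      exact ⟨w, fun _ => ⟨chainsIn_mono (fun _ hx => hx.1) hw, h2, h3⟩⟩
    · exact ⟨0, fun h => absurd h hσ⟩
  choose w hw using key
  let W : (Simp N 2 →₀ ℤ) →+ (Simp N 2 →₀ ℤ) := extend w
  refine ⟨W c, map_mem_of_chainsIn W _ (fun σ hσ => ?_) hc, ?_, ?_⟩
  · simp only [W, extend_single, one_smul]
    exact (hw σ hσ).1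
  -- The corrections by `H` add up to `H (∂c)`, which is zero because `c` is a cycle.
  · have := map_mem_of_chainsIn (AddMonoidHom.id _ - H.comp (bd 1) - W) (bd 2).range (fun σ hσ => by
      simp only [W, AddMonoidHom.sub_apply, AddMonoidHom.comp_apply, AddMonoidHom.id_apply,
        extend_single, one_smul]
      exact (hw σ hσ).2.1) hc
    simpa [h] using this
  · refine eqOn_chainsIn (f := (lagClass ω).comp W) (g := C.Ψ.comp ((area ω).comp W))
      (fun σ hσ => ?_) hc
    simp only [W, AddMonoidHom.comp_apply, extend_single, one_smul]
    exact (hw σ hσ).2.2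

end NestedCharts

end Small

/-! ### The pairing, and good representatives of classes -/

section Main
open Set

variable {N : Type u} [TopologicalSpace N] [T2Space N] [SecondCountableTopology N]
    [ConnectedSpace N] [ChartedSpace E4 N] [IsManifold (𝓡 4) ((⊤ : ℕ∞) : WithTop ℕ∞) N]
    (ω : SymplecticForm N)

/-- A closed two-form has integral zero over the `C^1` chains that are boundaries. -/
theorem area_bd_eq_zero {b : Simp N 3 →₀ ℤ} (h : bd 2 b ∈ chainsIn (c1Simp N)) :
    area ω (bd 2 b) = 0 := by
  -- The chain `b` is merely continuous, so Stokes does not apply to it directly. After subdivision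
  -- its boundary is a small `C^1` cycle, whose area is its `straightArea`, and this is defined for
  -- continuous chains and vanishes on boundaries.
  obtain ⟨C⟩ := exists_nested_charts ω (isCompact_carrier b)
  obtain ⟨k, hk⟩ := C.exists_subdiv_mem (c := b) Subset.rfl
  have h1 : bd 1 (bd 2 b) = 0 := bd_bd b
  rw [← area_subdiv ω k h h1]
  have h2 : subdiv k 2 (bd 2 b) = bd 2 (subdiv k 3 b) := (bd_subdiv k b).symm
  have h3 : bd 2 (subdiv k 3 b) ∈ chainsIn (C.small 2) :=
    altSum_mem (s := C.small 3) (t := C.small 2) _ (fun σ hσ i =>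
      NestedCharts.small_of_range hσ (face_mem_simpIn Subset.rfl i)) hk
  have h4 := subdiv_mem_c1 k h
  rw [h2] at h4 ⊢
  rw [NestedCharts.area_eq_straightArea (C := C) (fun σ hσ => ⟨h4 σ hσ, h3 σ hσ⟩) (bd_bd _),
    NestedCharts.straightArea_bd hk]

theorem area_eq_of_represents {c c' : TwoChain N} {α : H2 N} (h : c.Represents α) (hc : c.IsC1)
    (h' : c'.Represents α) (hc' : c'.IsC1) : area ω c = area ω c' := by
  obtain ⟨b, hb⟩ := exists_bd_of_represents h h'
  have hm : c - c' ∈ chainsIn (c1Simp N) := sub_mem (fun σ hσ => hc σ hσ) fun σ hσ => hc' σ hσ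
  rw [← sub_eq_zero, ← map_sub, hb, area_bd_eq_zero ω (by rwa [← hb])]

theorem deRhamPairing_eq_area {c : TwoChain N} {α : H2 N} (h : c.Represents α) (hc : c.IsC1) :
    deRhamPairing ω α = area ω c := by
  have hex : ∃ c : TwoChain N, c.Represents α ∧ c.IsC1 := ⟨c, h, hc⟩
  rw [deRhamPairing, dif_pos hex, integral_eq_area]
  exact area_eq_of_represents ω hex.choose_spec.1 hex.choose_spec.2 h hc

/-- Every class is represented by a `C^1` cycle whose class modulo lagrangian simplices is a function
of its area. -/
theorem exists_c1_represents (α : H2 N) : ∃ (w : TwoChain N) (Ψ : ℝ →+ LagQuotient ω),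
    w.Represents α ∧ w.IsC1 ∧ lagClass ω w = Ψ (area ω w) := by
  obtain ⟨c, hc⟩ := exists_represents α
  obtain ⟨C⟩ := exists_nested_charts ω (isCompact_carrier c)
  obtain ⟨k, hk⟩ := C.exists_subdiv_mem (c := c) Subset.rfl
  have h0 := bd_eq_zero_of_represents hc
  have hsub : bd 1 (subdiv k 2 c) = 0 := by rw [bd_subdiv, h0, map_zero]
  obtain ⟨w, hw, ⟨b, hb⟩, hΨ⟩ := NestedCharts.exists_c1_homologous hk hsub
  have h1 := bd_subdivT k (n := 1) c
  rw [h0, map_zero, sub_zero] at h1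
  refine ⟨w, C.Ψ, ?_, hw, hΨ⟩
  -- The first term passes from `c` to its subdivision, the second from the subdivision to `w`.
  have h2 := represents_add_bd hc (-subdivT k 2 c - b)
  convert h2 using 1
  rw [map_sub, map_neg, h1, hb]
  abel

end Main
end LagrangianCycles

end

open LagrangianCycles

theorem proposition2p1 {N : Type u} [TopologicalSpace N] [T2Space N] [SecondCountableTopology N]
    [ConnectedSpace N] [ChartedSpace (EuclideanSpace ℝ (Fin 4)) N] 
    [IsManifold (𝓡 4) ((⊤ : ℕ∞) : WithTop ℕ∞) N]
    (ω : SymplecticForm N) (α : H2 N) :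
    IsLagrangianClass ω α ↔ deRhamPairing ω α = 0 := by
  constructor
  · rintro ⟨c, hc, hl⟩
    rw [deRhamPairing_eq_area ω hc fun σ hσ => (hl σ hσ).1]
    exact area_eq_zero_of_isLagrangian hl
  · intro h
    obtain ⟨w, Ψ, hw, hw1, hΨ⟩ := exists_c1_represents ω α
    rw [deRhamPairing_eq_area ω hw hw1] at h
    -- Zero area means zero class, that is, `w` is a lagrangian chain plus a boundary; removing the
    -- boundary leaves a lagrangian representative.
    rw [h, map_zero, lagClass_eq_zero] at hΨ
    obtain ⟨l, hl, _, ⟨b, rfl⟩, hlb⟩ := AddSubgroup.mem_sup.1 hΨ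
    refine ⟨l, ?_, hl⟩
    have := represents_add_bd hw (-b)
    rwa [map_neg, ← hlb, add_neg_cancel_right] at this
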